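/- Let $q$ be a real-valued measurable function on $(0,\infty)$ with $\int_0^\infty (1+x)|q(x)|\,dx<\infty$. For $\operatorname{Im}k\ge 0$ there is exactly one function $f(\cdot,k)$ on $[0,\infty)$ (the Jost solution) that has a locally absolutely continuous derivative $f'=\partial_x f$, satisfies $-f''+q(x)f=k^2f$ for almost every $x>0$, and satisfies $e^{-ikx}f(x,k)\to 1$ as $x\to+\infty$. Put $f(k):=f(0,k)$ (the Jost function) and $I(k):=f'(0,k)/f(k)$. (a) Let $k_j>0$, $1\le j\le J$, be the numbers such that $-k_j^2$ are the negative eigenvalues of $-\frac{d^2}{dx^2}+q$ in $L^2(0,\infty)$ with the boundary condition $u(0)=0$. Then $J<\infty$, the function $I$ is meromorphic in $\mathbb C_+=\{z\in\mathbb C:\operatorname{Im}z>0\}$, and its poles in $\mathbb C_+$ are exactly the points $ik_j$, $1\le j\le J$, all of them simple. (b) One has $s/\operatorname{Im}I(s)>0$ for all real $s\neq 0$. Put $w(z):=\prod_{j=1}^J\frac{z-ik_j}{z+ik_j}$. Then, for all $z$ with $\operatorname{Im}z>0$, $$f(z)=w(z)\,\exp\left(\frac1{2\pi i}\int_{-\infty}^\infty\frac{\ln\frac{s}{\operatorname{Im}I(s)}}{s-z}\,ds\right),$$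 where the integral converges absolutely. (c) If $f(0)=0$, put $w_1(z):=\frac{z}{z+i}\,w(z)$. Then also, for all $z$ with $\operatorname{Im}z>0$, $$f(z)=w_1(z)\,\exp\left(\frac1{2\pi i}\int_{-\infty}^\infty\frac{\ln\frac{s^2+1}{s\operatorname{Im}I(s)}}{s-z}\,ds\right),$$ where the integral converges absolutely. (d) The values $I(k)$, $k>0$, determine $J$, the numbers $k_j$, and $f$ in $\mathbb C_+$: if two potentials of the above class have the same $I(k)$ for all $k>0$, then they have the same $J$, the same $k_j$, and the same $f(z)$ for $\operatorname{Im}z>0$. -/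

import Mathlib

open Set Filter Topology MeasureTheory

namespace Schrodinger

/-- The class `L_{1,1}` of real potentials on the half-line: `∫_0^∞ (1 + x) |q x| dx < ∞`. -/
def InL11 (q : ℝ → ℝ) : Prop :=
  IntegrableOn (fun x : ℝ => (1 + x) * q x) (Ioi 0)

/-- `u` solves `-u'' + q u = E u` on the half-line in the Carathéodory sense, with `u' = v`:
`u` is differentiable on `[0, ∞)` with derivative `v`, and `v` is the primitive of `(q - E) u`
(so that `v` is locally absolutely continuous and `v' = (q - E) u` almost everywhere). -/
structure IsSolution (q : ℝ → ℝ) (E : ℂ) (u v : ℝ → ℂ) : Prop where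
  hasDeriv : ∀ x : ℝ, 0 ≤ x → HasDerivWithinAt u (v x) (Ici 0) x
  deriv_eq : ∀ x : ℝ, 0 ≤ x → v x = v 0 + ∫ t in (0 : ℝ)..x, ((q t : ℂ) - E) * u t

/-- `u` is the Jost solution at `k` (with `v = u'`): it solves `-u'' + q u = k² u` and
`u(x) = e^{ikx} (1 + o(1))` as `x → +∞`. -/
structure IsJostSolution (q : ℝ → ℝ) (k : ℂ) (u v : ℝ → ℂ) : Prop where
  isSolution : IsSolution q (k ^ 2) u v
  asymptotics : Tendsto (fun x : ℝ => Complex.exp (-(Complex.I * k * x)) * u x) atTop (𝓝 1)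

/-- The pair `(f(·, k), f'(·, k))` of the Jost solution and its derivative in `x`; it is used
for `0 ≤ Im k` only, where it exists and is unique on `[0, ∞)`. -/
noncomputable def jostPair (q : ℝ → ℝ) (k : ℂ) : (ℝ → ℂ) × (ℝ → ℂ) :=
  Classical.epsilon fun p => IsJostSolution q k p.1 p.2

/-- The Jost function `f(k) = f(0, k)`. -/
noncomputable def jostFunction (q : ℝ → ℝ) (k : ℂ) : ℂ := (jostPair q k).1 0

/-- The I-function `I(k) = f'(0, k) / f(k)`. -/
noncomputable def iFunction (q : ℝ → ℝ) (k : ℂ) : ℂ := (jostPair q k).2 0 / jostFunction q k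

/-- `E` is an eigenvalue of `-d²/dx² + q` in `L²(0, ∞)` with the condition `u(0) = 0`. -/
def IsDirichletEigenvalue (q : ℝ → ℝ) (E : ℝ) : Prop :=
  ∃ u v : ℝ → ℂ, IsSolution q (E : ℂ) u v ∧ u 0 = 0 ∧
    MemLp u 2 (volume.restrict (Ioi (0 : ℝ))) ∧ ∃ x : ℝ, 0 < x ∧ u x ≠ 0

/-- The numbers `k_j > 0` such that `-k_j²` is a (negative) Dirichlet eigenvalue. -/
def boundStates (q : ℝ → ℝ) : Set ℝ :=
  {κ : ℝ | 0 < κ ∧ IsDirichletEigenvalue q (-κ ^ 2)}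

/-- The open upper half-plane as a set of complex numbers. -/
def upperHalf : Set ℂ := {z : ℂ | 0 < z.im}

/-- The poles of `F` in the open upper half-plane. -/
def upperPoles (F : ℂ → ℂ) : Set ℂ := {p : ℂ | p ∈ upperHalf ∧ meromorphicOrderAt F p < 0}

/-- `w(z) = ∏_p (z - p) / (z + p)`, the product over the poles `p` of `F` in the open upper
half-plane. -/
noncomputable def w (F : ℂ → ℂ) (z : ℂ) : ℂ := ∏ᶠ p ∈ upperPoles F, (z - p) / (z + p)

/-- `w₁(z) = z / (z + i) * w(z)`. -/
noncomputable def w₁ (F : ℂ → ℂ) (z : ℂ) : ℂ := z / (z + Complex.I) * w F z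

/-- `ln (s / Im F(s)) / (s - z)`. -/
noncomputable def integrand (F : ℂ → ℂ) (z : ℂ) (s : ℝ) : ℂ :=
  (Real.log (s / (F s).im) : ℂ) / ((s : ℂ) - z)

/-- `ln ((s² + 1) / (s Im F(s))) / (s - z)`. -/
noncomputable def integrand₁ (F : ℂ → ℂ) (z : ℂ) (s : ℝ) : ℂ :=
  (Real.log ((s ^ 2 + 1) / (s * (F s).im)) : ℂ) / ((s : ℂ) - z)

end Schrodinger

/-!
Write `f(x, k) = e^{ikx} m(x, k)`. The equation for `f` with its behaviour at infinity becomes the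
Volterra equation `m(x) = 1 + ∫_x^∞ ∫_s^∞ e^{2ik(t-s)} q(t) m(t) dt ds`, whose Neumann series
converges uniformly for `x ≥ 0` and `Im k ≥ 0` because `∫ x |q| < ∞`. Hence `f(k)` is holomorphic
in the open half-plane, continuous up to the real line, and `f(k) = 1 + O(1/|k|)`.

For real `s ≠ 0` the Wronskian of `f(·, s)` and its complex conjugate is `-2is`, which says
`Im I(s) = s / |f(s)|²`: the function `I` carries exactly the boundary modulus of `f`. In the upper
half-plane the zeros of `f` are the poles of `I`; by self-adjointness they are the points `i k_j`,
and `∫ f(x, i k_j)² dx > 0` makes them simple. They are bounded and can accumulate only at `0`; but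
for small `k_i`, `k_j` the eigenfunctions, close to `e^{-k_i x}` and `e^{-k_j x}` outside a fixed
compact set, have a large inner product and cannot be orthogonal.

The quotient `f / w` has no zeros in the half-plane and has the modulus of `f` on the line. Its
logarithm decays like `1/|z|` and is recovered from its real part on the line by Cauchy's formula,
applied on `Im z = ε`; the limit `ε → 0` is dominated because `|f(k)| ≥ c |Re k|` near `0`. The
factor `(z + i) / z` does not affect this argument, which gives the second formula.

If `I₁ = I₂` on `(0, ∞)`, then also on the real line by conjugation, so `f₁' f₂ - f₁ f₂'` vanishes
there and, by Phragmén–Lindelöf, in the half-plane. Therefore `f₁` and `f₂` have the same zeros and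
the same boundary modulus, and coincide.
-/

namespace Schrodinger

section Primitives

variable {a b : ℝ}

lemma absolutelyContinuousOnInterval_integral {E : Type*} [NormedAddCommGroup E] [NormedSpace ℝ E]
    {f : ℝ → E} (hf : IntervalIntegrable f volume a b) :
    AbsolutelyContinuousOnInterval (fun x => ∫ t in a..x, f t) a b := by
  have hsub : ∀ {x y}, x ∈ uIcc a b → y ∈ uIcc a b → IntervalIntegrable f volume x y :=
    fun hx hy => hf.mono_set (uIcc_subset_uIcc hx hy)
  refine (absolutelyContinuousOnInterval_iff _ _ _).2 fun ε hε => ?_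
  obtain ⟨δ, hδ, h⟩ := (absolutelyContinuousOnInterval_iff _ _ _).1
    (hf.norm.absolutelyContinuousOnInterval_intervalIntegral (c := a) left_mem_uIcc) ε hε
  refine ⟨δ, hδ, fun I hI hlt => lt_of_le_of_lt (Finset.sum_le_sum fun i hi => ?_) (h I hI hlt)⟩
  have h₁ : IntervalIntegrable f volume a (I.2 i).1 := hsub left_mem_uIcc (hI.1 i hi).1
  have h₂ : IntervalIntegrable f volume a (I.2 i).2 := hsub left_mem_uIcc (hI.1 i hi).2
  rw [dist_comm, dist_comm (∫ v in a..(I.2 i).1, ‖f v‖), dist_eq_norm, dist_eq_norm,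
    intervalIntegral.integral_interval_sub_left h₂ h₁,
    intervalIntegral.integral_interval_sub_left h₂.norm h₁.norm, Real.norm_eq_abs]
  exact intervalIntegral.norm_integral_le_abs_integral_norm

lemma integral_eq_sub_of_absolutelyContinuousOnInterval {E : Type*} [NormedAddCommGroup E]
    [NormedSpace ℝ E] [CompleteSpace E] {f f' : ℝ → E}
    (hf : AbsolutelyContinuousOnInterval f a b) (hf' : IntervalIntegrable f' volume a b)
    (hderiv : ∀ᵐ x, x ∈ uIcc a b → HasDerivAt f (f' x) x) :
    ∫ x in a..b, f' x = f b - f a := by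
  obtain ⟨c, hc⟩ :=
    (hf.fun_sub (absolutelyContinuousOnInterval_integral hf')).const_of_ae_hasDerivAt_zero (by
      filter_upwards [hderiv, hf'.ae_hasDerivAt_integral] with x h₁ h₂ hx
      simpa only [sub_self] using (h₁ hx).fun_sub (h₂ hx a left_mem_uIcc))
  have ha := hc a left_mem_uIcc
  have hb := hc b right_mem_uIcc
  rw [intervalIntegral.integral_same, sub_zero] at ha
  rw [ha, ← hb, sub_sub_cancel]

lemma mul_eq_add_integral {R : Type*} [NormedDivisionRing R] [NormedAlgebra ℝ R] [CompleteSpace R]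
    {F G f g : ℝ → R} (hab : a ≤ b)
    (hf : IntervalIntegrable f volume a b) (hg : IntervalIntegrable g volume a b)
    (hF : ∀ x ∈ Icc a b, F x = F a + ∫ t in a..x, f t)
    (hG : ∀ x ∈ Icc a b, G x = G a + ∫ t in a..x, g t) :
    F b * G b = F a * G a + ∫ x in a..b, (f x * G x + F x * g x) := by
  let F₁ : ℝ → R := fun x => F a + ∫ t in a..x, f t
  let G₁ : ℝ → R := fun x => G a + ∫ t in a..x, g t
  have hconst : ∀ c : R, AbsolutelyContinuousOnInterval (fun _ : ℝ => c) a b := fun c =>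
    contDiff_const.contDiffOn.absolutelyContinuousOnInterval
  have hF₁ : AbsolutelyContinuousOnInterval F₁ a b :=
    (hconst _).add (absolutelyContinuousOnInterval_integral hf)
  have hG₁ : AbsolutelyContinuousOnInterval G₁ a b :=
    (hconst _).add (absolutelyContinuousOnInterval_integral hg)
  have hint := integral_eq_sub_of_absolutelyContinuousOnInterval
    (f' := fun x => f x * G₁ x + F₁ x * g x) (hF₁.fun_smul hG₁)
    ((hf.mul_continuousOn hG₁.continuousOn).add (hg.continuousOn_mul hF₁.continuousOn)) (by
      filter_upwards [hf.ae_hasDerivAt_integral, hg.ae_hasDerivAt_integral] with x hx₁ hx₂ hx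
      exact ((hx₁ hx a left_mem_uIcc).const_add (F a)).mul
        ((hx₂ hx a left_mem_uIcc).const_add (G a)))
  have hcongr : ∫ x in a..b, (f x * G x + F x * g x) = ∫ x in a..b, (f x * G₁ x + F₁ x * g x) :=
    intervalIntegral.integral_congr fun x hx => by
      rw [uIcc_of_le hab] at hx
      simp only [hF x hx, hG x hx, F₁, G₁]
  rw [hcongr, hint, hF b (right_mem_Icc.2 hab), hG b (right_mem_Icc.2 hab)]
  simp [F₁, G₁]

lemma integral_mul_primitive_pow {K : ℝ → ℝ} (hK : IntervalIntegrable K volume a b) (n : ℕ) :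
    ∫ x in a..b, K x * (∫ t in a..x, K t) ^ n = (∫ x in a..b, K x) ^ (n + 1) / (n + 1) := by
  have hP := absolutelyContinuousOnInterval_integral hK
  have hpow : ∀ m : ℕ, AbsolutelyContinuousOnInterval (fun x => (∫ t in a..x, K t) ^ m) a b := by
    intro m
    induction m with
    | zero => simpa using contDiff_const.contDiffOn.absolutelyContinuousOnInterval
    | succ m ih => simpa only [pow_succ] using ih.fun_mul hP
  have h := integral_eq_sub_of_absolutelyContinuousOnInterval
    (f' := fun x => (n + 1) * (K x * (∫ t in a..x, K t) ^ n)) (hpow (n + 1))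
    ((hK.mul_continuousOn (hpow n).continuousOn).const_mul _) (by
      filter_upwards [hK.ae_hasDerivAt_integral] with x hx₁ hx
      convert! (hx₁ hx a left_mem_uIcc).fun_pow (n + 1) using 1
      push_cast [Nat.add_sub_cancel]
      ring)
  rw [intervalIntegral.integral_const_mul, intervalIntegral.integral_same,
    zero_pow n.succ_ne_zero, sub_zero] at h
  rw [← h]
  field_simp

lemma le_mul_primitive_pow_div_factorial {M K : ℝ → ℝ} {B : ℝ} (hM : ContinuousOn M (Icc a b))
    (hMB : ∀ x ∈ Icc a b, M x ≤ B) (hK : IntervalIntegrable K volume a b)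
    (hK0 : ∀ x ∈ Icc a b, 0 ≤ K x) (hle : ∀ x ∈ Icc a b, M x ≤ ∫ t in a..x, K t * M t) (n : ℕ) :
    ∀ x ∈ Icc a b, M x ≤ B * ((∫ t in a..x, K t) ^ n / n.factorial) := by
  induction n with
  | zero => simpa using hMB
  | succ n ih =>
    intro x hx
    have hKx : IntervalIntegrable K volume a x :=
      hK.mono_set (uIcc_subset_uIcc_left (Icc_subset_uIcc hx))
    have hMx : ContinuousOn M (uIcc a x) :=
      hM.mono (uIcc_of_le hx.1 ▸ Icc_subset_Icc_right hx.2)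
    have hP := (absolutelyContinuousOnInterval_integral hKx).continuousOn
    calc M x ≤ ∫ t in a..x, K t * M t := hle x hx
      _ ≤ ∫ t in a..x, B / n.factorial * (K t * (∫ s in a..t, K s) ^ n) := by
        refine intervalIntegral.integral_mono_on hx.1 (hKx.mul_continuousOn hMx)
          ((hKx.mul_continuousOn (hP.pow n)).const_mul _) fun t ht => ?_
        have ht' : t ∈ Icc a b := ⟨ht.1, ht.2.trans hx.2⟩
        exact (mul_le_mul_of_nonneg_left (ih t ht') (hK0 t ht')).trans_eq (by ring)
      _ = B * ((∫ t in a..x, K t) ^ (n + 1) / (n + 1).factorial) := by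
        rw [intervalIntegral.integral_const_mul, integral_mul_primitive_pow hKx,
          Nat.factorial_succ]
        push_cast
        field_simp

lemma nonpos_of_le_integral_mul {M K : ℝ → ℝ} (hM : ContinuousOn M (Icc a b))
    (hK : IntervalIntegrable K volume a b) (hK0 : ∀ x ∈ Icc a b, 0 ≤ K x)
    (hle : ∀ x ∈ Icc a b, M x ≤ ∫ t in a..x, K t * M t) {x : ℝ} (hx : x ∈ Icc a b) :
    M x ≤ 0 := by
  obtain ⟨B, hB⟩ := isCompact_Icc.exists_bound_of_continuousOn hM
  have htend := (FloorSemiring.tendsto_pow_div_factorial_atTop (∫ t in a..x, K t)).const_mul B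
  rw [mul_zero] at htend
  exact ge_of_tendsto' htend fun n => le_mul_primitive_pow_div_factorial hM
    (fun y hy => (le_abs_self _).trans (hB y hy)) hK hK0 hle n x hx

end Primitives

section Solutions

variable {q : ℝ → ℝ} {E E₁ E₂ : ℂ} {u v u₁ v₁ u₂ v₂ : ℝ → ℂ} {x : ℝ}

lemma InL11.integrableOn (hq : InL11 q) : IntegrableOn q (Ioi 0) := by
  have h : IntegrableOn (fun x => (1 + x)⁻¹ * ((1 + x) * q x)) (Ioi 0) := by
    refine Integrable.bdd_mul (c := 1) hq (by fun_prop) ?_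
    filter_upwards [ae_restrict_mem measurableSet_Ioi] with x (hx : 0 < x)
    rw [norm_inv, Real.norm_of_nonneg (by linarith)]
    exact inv_le_one_of_one_le₀ (by linarith)
  refine h.congr_fun (fun x (hx : 0 < x) => ?_) measurableSet_Ioi
  exact inv_mul_cancel_left₀ (by linarith) _

lemma InL11.locallyIntegrableOn (hq : InL11 q) : LocallyIntegrableOn q (Ici 0) :=
  ((integrableOn_Ici_iff_integrableOn_Ioi).2 hq.integrableOn).locallyIntegrableOn

lemma uIcc_zero_subset_Ici (hx : 0 ≤ x) : uIcc 0 x ⊆ Ici 0 :=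
  ordConnected_Ici.uIcc_subset self_mem_Ici hx

lemma intervalIntegrable_sub_const (hq : LocallyIntegrableOn q (Ici 0)) (E : ℂ) (hx : 0 ≤ x) :
    IntervalIntegrable (fun t => (q t : ℂ) - E) volume 0 x := by
  have hqx : IntegrableOn (fun t => (q t : ℂ)) (uIcc 0 x) :=
    Integrable.ofReal (hq.integrableOn_compact_subset (uIcc_zero_subset_Ici hx) isCompact_uIcc)
  exact hqx.intervalIntegrable.sub intervalIntegrable_const

lemma Icc_mem_nhdsWithin_Ici {a b x : ℝ} (hxb : x < b) : Icc a b ∈ 𝓝[Ici a] x := by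
  rw [← Ici_inter_Iic]
  exact inter_mem self_mem_nhdsWithin (mem_nhdsWithin_of_mem_nhds (Iic_mem_nhds hxb))

namespace IsSolution

lemma continuousOn (h : IsSolution q E u v) : ContinuousOn u (Ici 0) :=
  fun x hx => (h.hasDeriv x hx).continuousWithinAt

lemma intervalIntegrable_mul (h : IsSolution q E u v) (hq : LocallyIntegrableOn q (Ici 0))
    (hx : 0 ≤ x) : IntervalIntegrable (fun t => ((q t : ℂ) - E) * u t) volume 0 x :=
  (intervalIntegrable_sub_const hq E hx).mul_continuousOn
    (h.continuousOn.mono (uIcc_zero_subset_Ici hx))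

lemma continuousOn_deriv (h : IsSolution q E u v) (hq : LocallyIntegrableOn q (Ici 0)) :
    ContinuousOn v (Ici 0) := by
  intro x hx
  have hx' : (0 : ℝ) ≤ x + 1 := add_nonneg hx zero_le_one
  have hc := (absolutelyContinuousOnInterval_integral
    (h.intervalIntegrable_mul hq hx')).continuousOn
  rw [uIcc_of_le hx'] at hc
  have hv : ContinuousWithinAt v (Icc 0 (x + 1)) x :=
    ((continuousOn_const (c := v 0)).add hc |>.congr fun t ht => h.deriv_eq t ht.1) x
      ⟨hx, by linarith⟩
  exact hv.mono_of_mem_nhdsWithin (Icc_mem_nhdsWithin_Ici (lt_add_one x))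

lemma intervalIntegrable_deriv (h : IsSolution q E u v) (hq : LocallyIntegrableOn q (Ici 0))
    (hx : 0 ≤ x) : IntervalIntegrable v volume 0 x :=
  ((h.continuousOn_deriv hq).mono (uIcc_zero_subset_Ici hx)).intervalIntegrable

lemma eq_add_integral (h : IsSolution q E u v) (hq : LocallyIntegrableOn q (Ici 0))
    (hx : 0 ≤ x) : u x = u 0 + ∫ t in (0 : ℝ)..x, v t := by
  rw [intervalIntegral.integral_eq_sub_of_hasDeriv_right_of_le hx
    (h.continuousOn.mono Icc_subset_Ici_self) (fun t ht => ?_) (h.intervalIntegrable_deriv hq hx),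
    add_sub_cancel]
  exact (h.hasDeriv t ht.1.le).mono fun s hs => ht.1.le.trans (le_of_lt hs)

lemma conj (h : IsSolution q E u v) :
    IsSolution q (starRingEnd ℂ E) (fun x => starRingEnd ℂ (u x)) fun x => starRingEnd ℂ (v x) where
  hasDeriv x hx := (h.hasDeriv x hx).star
  deriv_eq x hx := by
    rw [h.deriv_eq x hx, map_add, intervalIntegral.integral_of_le hx,
      intervalIntegral.integral_of_le hx, ← integral_conj]
    simp

lemma linear_combination (h₁ : IsSolution q E u₁ v₁) (h₂ : IsSolution q E u₂ v₂)
    (hq : LocallyIntegrableOn q (Ici 0)) (c₁ c₂ : ℂ) :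
    IsSolution q E (fun x => c₁ * u₁ x + c₂ * u₂ x) fun x => c₁ * v₁ x + c₂ * v₂ x where
  hasDeriv x hx := ((h₁.hasDeriv x hx).const_mul c₁).add ((h₂.hasDeriv x hx).const_mul c₂)
  deriv_eq x hx := by
    have hint : ∫ t in (0 : ℝ)..x, ((q t : ℂ) - E) * (c₁ * u₁ t + c₂ * u₂ t) =
        c₁ * (∫ t in (0 : ℝ)..x, ((q t : ℂ) - E) * u₁ t) +
        c₂ * (∫ t in (0 : ℝ)..x, ((q t : ℂ) - E) * u₂ t) := by
      rw [← intervalIntegral.integral_const_mul, ← intervalIntegral.integral_const_mul,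
        ← intervalIntegral.integral_add ((h₁.intervalIntegrable_mul hq hx).const_mul c₁)
          ((h₂.intervalIntegrable_mul hq hx).const_mul c₂)]
      exact intervalIntegral.integral_congr fun t _ => by ring
    rw [hint, h₁.deriv_eq x hx, h₂.deriv_eq x hx]
    ring

lemma wronskian_eq (h₁ : IsSolution q E₁ u₁ v₁) (h₂ : IsSolution q E₂ u₂ v₂)
    (hq : LocallyIntegrableOn q (Ici 0)) (hx : 0 ≤ x) :
    v₁ x * u₂ x - u₁ x * v₂ x =
      v₁ 0 * u₂ 0 - u₁ 0 * v₂ 0 + (E₂ - E₁) * ∫ t in (0 : ℝ)..x, u₁ t * u₂ t := by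
  have hvu := mul_eq_add_integral hx (h₁.intervalIntegrable_mul hq hx)
    (h₂.intervalIntegrable_deriv hq hx)
    (fun t ht => h₁.deriv_eq t ht.1) (fun t ht => h₂.eq_add_integral hq ht.1)
  have huv := mul_eq_add_integral hx (h₁.intervalIntegrable_deriv hq hx)
    (h₂.intervalIntegrable_mul hq hx)
    (fun t ht => h₁.eq_add_integral hq ht.1) (fun t ht => h₂.deriv_eq t ht.1)
  have hsub := uIcc_zero_subset_Ici hx
  have hu₁ := h₁.continuousOn.mono hsub
  have hu₂ := h₂.continuousOn.mono hsub
  have hvv : IntervalIntegrable (fun t => v₁ t * v₂ t) volume 0 x :=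
    (((h₁.continuousOn_deriv hq).mono hsub).mul
      ((h₂.continuousOn_deriv hq).mono hsub)).intervalIntegrable
  rw [hvu, huv, add_sub_add_comm, ← intervalIntegral.integral_sub
    (((h₁.intervalIntegrable_mul hq hx).mul_continuousOn hu₂).add hvv)
    (hvv.add ((h₂.intervalIntegrable_mul hq hx).continuousOn_mul hu₁)),
    ← intervalIntegral.integral_const_mul]
  congr 1
  exact intervalIntegral.integral_congr fun t _ => by ring

lemma wronskian_eq_of_energy_eq (h₁ : IsSolution q E u₁ v₁) (h₂ : IsSolution q E u₂ v₂)
    (hq : LocallyIntegrableOn q (Ici 0)) (hx : 0 ≤ x) :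
    v₁ x * u₂ x - u₁ x * v₂ x = v₁ 0 * u₂ 0 - u₁ 0 * v₂ 0 := by
  simpa using h₁.wronskian_eq h₂ hq hx

lemma norm_add_norm_le_integral (h : IsSolution q E u v) (hq : LocallyIntegrableOn q (Ici 0))
    (hu : u 0 = 0) (hv : v 0 = 0) (hx : 0 ≤ x) :
    ‖u x‖ + ‖v x‖ ≤ ∫ t in (0 : ℝ)..x, (1 + ‖(q t : ℂ) - E‖) * (‖u t‖ + ‖v t‖) := by
  have hsub := uIcc_zero_subset_Ici hx
  have hu_le : ‖u x‖ ≤ ∫ t in (0 : ℝ)..x, ‖v t‖ := by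
    rw [h.eq_add_integral hq hx, hu, zero_add]
    exact intervalIntegral.norm_integral_le_integral_norm hx
  have hv_le : ‖v x‖ ≤ ∫ t in (0 : ℝ)..x, ‖((q t : ℂ) - E) * u t‖ := by
    rw [h.deriv_eq x hx, hv, zero_add]
    exact intervalIntegral.norm_integral_le_integral_norm hx
  have hv_int := (h.intervalIntegrable_deriv hq hx).norm
  have hu_int := (h.intervalIntegrable_mul hq hx).norm
  calc ‖u x‖ + ‖v x‖
      ≤ ∫ t in (0 : ℝ)..x, (‖v t‖ + ‖((q t : ℂ) - E) * u t‖) := by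
        rw [intervalIntegral.integral_add hv_int hu_int]
        exact add_le_add hu_le hv_le
    _ ≤ ∫ t in (0 : ℝ)..x, (1 + ‖(q t : ℂ) - E‖) * (‖u t‖ + ‖v t‖) := by
        refine intervalIntegral.integral_mono_on hx (hv_int.add hu_int)
          ((intervalIntegrable_const.add
            (intervalIntegrable_sub_const hq E hx).norm).mul_continuousOn
            ((h.continuousOn.norm.add (h.continuousOn_deriv hq).norm).mono hsub)) fun t _ => ?_
        rw [norm_mul]
        nlinarith [norm_nonneg (u t), mul_nonneg (norm_nonneg ((q t : ℂ) - E)) (norm_nonneg (v t))]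

lemma eq_zero_of_initial (h : IsSolution q E u v) (hq : LocallyIntegrableOn q (Ici 0))
    (hu : u 0 = 0) (hv : v 0 = 0) (hx : 0 ≤ x) : u x = 0 ∧ v x = 0 := by
  have hle : ‖u x‖ + ‖v x‖ ≤ 0 :=
    nonpos_of_le_integral_mul (M := fun t => ‖u t‖ + ‖v t‖) (K := fun t => 1 + ‖(q t : ℂ) - E‖)
      ((h.continuousOn.norm.add (h.continuousOn_deriv hq).norm).mono Icc_subset_Ici_self)
      (intervalIntegrable_const.add (intervalIntegrable_sub_const hq E hx).norm)
      (fun t _ => by positivity)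
      (fun t ht => h.norm_add_norm_le_integral hq hu hv ht.1) (right_mem_Icc.2 hx)
  constructor <;> rw [← norm_le_zero_iff] <;> linarith [norm_nonneg (u x), norm_nonneg (v x)]

end IsSolution

end Solutions

section ParametricIntegral

variable {α : Type*} [MeasurableSpace α] {μ : Measure α} {F : ℂ → α → ℂ} {U : Set ℂ}

lemma aestronglyMeasurable_deriv_param (hU : IsOpen U)
    (hmeas : ∀ z ∈ U, AEStronglyMeasurable (F z) μ) {z₀ : ℂ} (hz₀ : z₀ ∈ U)
    (hdiff : ∀ᵐ a ∂μ, DifferentiableAt ℂ (fun z => F z a) z₀) :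
    AEStronglyMeasurable (fun a => deriv (fun z => F z a) z₀) μ := by
  obtain ⟨w, hw, hw0⟩ : ∃ w : ℕ → ℂ, (∀ n, z₀ + w n ∈ U) ∧ Tendsto w atTop (𝓝[≠] 0) := by
    have hmem : ∀ᶠ w in 𝓝[≠] (0 : ℂ), z₀ + w ∈ U :=
      nhdsWithin_le_nhds ((continuous_const_add z₀).continuousAt.preimage_mem_nhds
        (by simpa using hU.mem_nhds hz₀))
    obtain ⟨w, hw⟩ := exists_seq_tendsto (𝓝[≠] (0 : ℂ))
    obtain ⟨N, hN⟩ := eventually_atTop.1 (hw.eventually hmem)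
    exact ⟨fun n => w (n + N), fun n => hN _ (by omega), (tendsto_add_atTop_iff_nat N).2 hw⟩
  refine aestronglyMeasurable_of_tendsto_ae atTop
    (f := fun n a => (w n)⁻¹ * (F (z₀ + w n) a - F z₀ a))
    (fun n => ((hmeas _ (hw n)).sub (hmeas _ hz₀)).const_mul _) ?_
  filter_upwards [hdiff] with a ha
  exact ha.hasDerivAt.tendsto_slope_zero.comp hw0

lemma differentiableOn_integral_of_dominated {bound : α → ℝ} (hU : IsOpen U)
    (hmeas : ∀ z ∈ U, AEStronglyMeasurable (F z) μ)
    (hbound : ∀ᵐ a ∂μ, ∀ z ∈ U, ‖F z a‖ ≤ bound a) (hint : Integrable bound μ)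
    (hdiff : ∀ᵐ a ∂μ, DifferentiableOn ℂ (fun z => F z a) U) :
    DifferentiableOn ℂ (fun z => ∫ a, F z a ∂μ) U := by
  intro z₀ hz₀
  obtain ⟨r, hr, hrU⟩ := Metric.isOpen_iff.1 hU z₀ hz₀
  have hsub : ∀ z ∈ Metric.ball z₀ (r / 2), Metric.closedBall z (r / 4) ⊆ U := by
    intro z hz y hy
    refine hrU ?_
    rw [Metric.mem_ball] at hz ⊢
    rw [Metric.mem_closedBall] at hy
    linarith [dist_triangle y z z₀]
  have hderiv : ∀ᵐ a ∂μ, ∀ z ∈ Metric.ball z₀ (r / 2),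
      HasDerivAt (fun z => F z a) (deriv (fun z => F z a) z) z := by
    filter_upwards [hdiff] with a ha z hz
    exact (ha.differentiableAt (hU.mem_nhds
      (hsub z hz (Metric.mem_closedBall_self (by positivity))))).hasDerivAt
  have hcauchy : ∀ᵐ a ∂μ, ∀ z ∈ Metric.ball z₀ (r / 2),
      ‖deriv (fun z => F z a) z‖ ≤ bound a / (r / 4) := by
    filter_upwards [hdiff, hbound] with a ha hb z hz
    refine Complex.norm_deriv_le_of_forall_mem_sphere_norm_le (by positivity) ?_ fun y hy =>
      hb y (hsub z hz (Metric.sphere_subset_closedBall hy))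
    refine DifferentiableOn.diffContOnCl ?_
    rw [closure_ball z (by positivity)]
    exact ha.mono (hsub z hz)
  exact (hasDerivAt_integral_of_dominated_loc_of_deriv_le (Metric.ball_mem_nhds z₀ (half_pos hr))
    (eventually_of_mem (hU.mem_nhds hz₀) hmeas)
    (hint.mono' (hmeas z₀ hz₀) (hbound.mono fun a ha => ha z₀ hz₀))
    (aestronglyMeasurable_deriv_param hU hmeas hz₀
      (hdiff.mono fun a ha => ha.differentiableAt (hU.mem_nhds hz₀)))
    hcauchy (hint.div_const _) hderiv).2.differentiableAt.differentiableWithinAt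

end ParametricIntegral

section Tails

variable {E : Type*} [NormedAddCommGroup E] {g : ℝ → E} {a x : ℝ}

lemma intervalIntegrable_of_integrableOn_Ioi (hg : IntegrableOn g (Ioi a)) (hx : a ≤ x) :
    IntervalIntegrable g volume a x :=
  (intervalIntegrable_iff_integrableOn_Ioc_of_le hx).2 (hg.mono_set Ioc_subset_Ioi_self)

lemma integrable_prod_indicator_Ioi (hg : IntegrableOn g (Ioi 0))
    (hg₁ : IntegrableOn (fun t => t * ‖g t‖) (Ioi 0)) :
    Integrable (fun p : ℝ × ℝ => (Ioi p.1).indicator g p.2)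
      ((volume.restrict (Ioi 0)).prod (volume.restrict (Ioi 0))) := by
  have hswap : ∀ s t : ℝ, (Ioi s).indicator g t = (Iio t).indicator (fun _ => g t) s :=
    fun s t => by simp [indicator]
  have hmeas : AEStronglyMeasurable (fun p : ℝ × ℝ => (Ioi p.1).indicator g p.2)
      ((volume.restrict (Ioi 0)).prod (volume.restrict (Ioi 0))) :=
    AEStronglyMeasurable.indicator (s := {p : ℝ × ℝ | p.1 < p.2}) hg.aestronglyMeasurable.comp_snd
      (measurableSet_lt measurable_fst measurable_snd)
  refine (integrable_prod_iff' hmeas).2 ⟨ae_of_all _ fun t => ?_, hg₁.congr ?_⟩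
  · simp only [hswap]
    rw [integrable_indicator_iff measurableSet_Iio, IntegrableOn,
      Measure.restrict_restrict measurableSet_Iio, Iio_inter_Ioi]
    exact integrableOn_const (by simp)
  · filter_upwards [ae_restrict_mem measurableSet_Ioi] with t (ht : 0 < t)
    simp only [hswap, norm_indicator_eq_indicator_norm]
    rw [integral_indicator measurableSet_Iio, Measure.restrict_restrict measurableSet_Iio,
      Iio_inter_Ioi, setIntegral_const]
    simp [ht.le]

variable [NormedSpace ℝ E]

lemma integral_Ioi_eq_sub (hg : IntegrableOn g (Ioi a)) (hx : a ≤ x) :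
    ∫ t in Ioi x, g t = (∫ t in Ioi a, g t) - ∫ t in a..x, g t := by
  rw [← intervalIntegral.integral_Ioi_sub_Ioi hg hx, sub_sub_cancel]

lemma tendsto_integral_Ioi_atTop_zero (hg : IntegrableOn g (Ioi a)) :
    Tendsto (fun x => ∫ t in Ioi x, g t) atTop (𝓝 0) := by
  have h := (intervalIntegral_tendsto_integral_Ioi a hg tendsto_id).const_sub (∫ t in Ioi a, g t)
  rw [sub_self] at h
  refine h.congr' ?_
  filter_upwards [eventually_ge_atTop a] with x hx using (integral_Ioi_eq_sub hg hx).symm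

lemma hasDerivWithinAt_integral_Ioi [CompleteSpace E] (hg : IntegrableOn g (Ioi a))
    (hc : ContinuousOn g (Ici a)) (hx : a ≤ x) :
    HasDerivWithinAt (fun x => ∫ t in Ioi x, g t) (-g x) (Ici a) x := by
  have hmem : x ∈ Icc a (x + 1) := ⟨hx, (lt_add_one x).le⟩
  have hc' : ContinuousOn g (Icc a (x + 1)) := hc.mono Icc_subset_Ici_self
  have : Fact (x ∈ Icc a (x + 1)) := ⟨hmem⟩
  have hprim := intervalIntegral.integral_hasDerivWithinAt_right (s := Icc a (x + 1))
    (t := Icc a (x + 1)) (intervalIntegrable_of_integrableOn_Ioi hg hx)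
    (hc'.stronglyMeasurableAtFilter_nhdsWithin measurableSet_Icc x) (hc' x hmem)
  exact ((hprim.const_sub (∫ t in Ioi a, g t)).congr_of_mem
    (fun t ht => integral_Ioi_eq_sub hg ht.1) hmem).mono_of_mem_nhdsWithin
    (Icc_mem_nhdsWithin_Ici (lt_add_one x))

lemma integrableOn_integral_Ioi (hg : IntegrableOn g (Ioi 0))
    (hg₁ : IntegrableOn (fun t => t * ‖g t‖) (Ioi 0)) :
    IntegrableOn (fun s => ∫ t in Ioi s, g t) (Ioi 0) := by
  refine (integrable_prod_indicator_Ioi hg hg₁).integral_prod_left.congr ?_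
  filter_upwards [ae_restrict_mem measurableSet_Ioi] with s (hs : 0 < s)
  rw [integral_indicator measurableSet_Ioi, Measure.restrict_restrict measurableSet_Ioi,
    Ioi_inter_Ioi, sup_of_le_left hs.le]

lemma integrableOn_mul_integral_Ioi_pow {K : ℝ → ℝ} (hK : IntegrableOn K (Ioi a)) (n : ℕ) :
    IntegrableOn (fun s => K s * (∫ t in Ioi s, K t) ^ n) (Ioi a) := by
  refine Integrable.mul_bdd (c := (∫ t in Ioi a, ‖K t‖) ^ n) hK
    (((hK.continuousOn_Ici_primitive_Ioi.pow n).mono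
      Ioi_subset_Ici_self).aestronglyMeasurable measurableSet_Ioi) ?_
  filter_upwards [ae_restrict_mem measurableSet_Ioi] with s hs
  rw [norm_pow]
  refine pow_le_pow_left₀ (norm_nonneg _) ((norm_integral_le_integral_norm _).trans ?_) n
  exact setIntegral_mono_set hK.norm (ae_of_all _ fun _ => norm_nonneg _)
    (Ioi_subset_Ioi (le_of_lt hs)).eventuallyLE

lemma integral_Ioi_mul_integral_Ioi_pow {K : ℝ → ℝ} (hK : IntegrableOn K (Ioi a))
    (hc : ContinuousOn K (Ici a)) (n : ℕ) (hx : a ≤ x) :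
    ∫ s in Ioi x, K s * (∫ t in Ioi s, K t) ^ n = (∫ t in Ioi x, K t) ^ (n + 1) / (n + 1) := by
  have hderiv : ∀ s ∈ Ioi x, HasDerivAt (fun s => -((∫ t in Ioi s, K t) ^ (n + 1) / (n + 1)))
      (K s * (∫ t in Ioi s, K t) ^ n) s := by
    intro s (hs : x < s)
    have h := (hasDerivWithinAt_integral_Ioi hK hc (hx.trans hs.le)).hasDerivAt
      (Ici_mem_nhds (hx.trans_lt hs))
    refine ((h.fun_pow (n + 1)).div_const ((n : ℝ) + 1)).fun_neg.congr_deriv ?_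
    push_cast [Nat.add_sub_cancel]
    field_simp
  have hcont : ContinuousWithinAt (fun s => -((∫ t in Ioi s, K t) ^ (n + 1) / (n + 1)))
      (Ici x) x :=
    ((hK.continuousOn_Ici_primitive_Ioi.pow (n + 1)).div_const _).neg x hx
      |>.mono (Ici_subset_Ici.2 hx)
  have htend : Tendsto (fun s => -((∫ t in Ioi s, K t) ^ (n + 1) / ((n : ℝ) + 1))) atTop (𝓝 0) := by
    simpa using (((tendsto_integral_Ioi_atTop_zero hK).pow (n + 1)).div_const ((n : ℝ) + 1)).neg
  rw [integral_Ioi_of_hasDerivAt_of_tendsto hcont hderiv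
    ((integrableOn_mul_integral_Ioi_pow hK n).mono_set (Ioi_subset_Ioi hx)) htend]
  ring

end Tails

section PotentialTails

/-- The first tail `σ(x) = ∫_x^∞ |q|` of a potential, which bounds the derivative of the modified
Jost solution. -/
noncomputable def tail (q : ℝ → ℝ) (x : ℝ) : ℝ := ∫ t in Ioi x, |q t|

/-- The second tail `σ₁(x) = ∫_x^∞ σ` of a potential; it is finite exactly because of the weight
`1 + x` in `InL11`, and the Neumann series of the Jost solution converges like `exp σ₁(x)`. -/
noncomputable def tail₂ (q : ℝ → ℝ) (x : ℝ) : ℝ := ∫ s in Ioi x, tail q s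

variable {q : ℝ → ℝ} {x y : ℝ}

lemma tail_nonneg (q : ℝ → ℝ) (x : ℝ) : 0 ≤ tail q x := integral_nonneg fun _ => abs_nonneg _

lemma tail₂_nonneg (q : ℝ → ℝ) (x : ℝ) : 0 ≤ tail₂ q x := integral_nonneg fun _ => tail_nonneg _ _

lemma InL11.integrableOn_abs (hq : InL11 q) : IntegrableOn (fun t => |q t|) (Ioi 0) :=
  hq.integrableOn.abs

lemma continuousOn_tail (hq : InL11 q) : ContinuousOn (tail q) (Ici 0) :=
  hq.integrableOn_abs.continuousOn_Ici_primitive_Ioi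

lemma tail_le_tail_zero (hq : InL11 q) (hx : 0 ≤ x) : tail q x ≤ tail q 0 :=
  setIntegral_mono_set hq.integrableOn_abs (ae_of_all _ fun _ => abs_nonneg _)
    (Ioi_subset_Ioi hx).eventuallyLE

lemma integrableOn_tail (hq : InL11 q) : IntegrableOn (tail q) (Ioi 0) := by
  refine integrableOn_integral_Ioi hq.integrableOn_abs
    ((hq.abs.sub hq.integrableOn_abs).congr ?_)
  filter_upwards [ae_restrict_mem measurableSet_Ioi] with t (ht : 0 < t)
  rw [Pi.sub_apply, abs_mul, abs_of_pos (by linarith : 0 < 1 + t), Real.norm_eq_abs, abs_abs]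
  ring

lemma tail₂_anti (hq : InL11 q) (hx : 0 ≤ x) (hxy : x ≤ y) : tail₂ q y ≤ tail₂ q x :=
  setIntegral_mono_set ((integrableOn_tail hq).mono_set (Ioi_subset_Ioi hx))
    (ae_of_all _ fun _ => tail_nonneg _ _) (Ioi_subset_Ioi hxy).eventuallyLE

lemma integrableOn_tail_mul_pow (hq : InL11 q) (n : ℕ) :
    IntegrableOn (fun s => tail q s * tail₂ q s ^ n) (Ioi 0) :=
  integrableOn_mul_integral_Ioi_pow (integrableOn_tail hq) n

lemma integral_tail_mul_pow (hq : InL11 q) (n : ℕ) (hx : 0 ≤ x) :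
    ∫ s in Ioi x, tail q s * tail₂ q s ^ n = tail₂ q x ^ (n + 1) / (n + 1) :=
  integral_Ioi_mul_integral_Ioi_pow (integrableOn_tail hq) (continuousOn_tail hq) n hx

lemma tendsto_tail (hq : InL11 q) : Tendsto (tail q) atTop (𝓝 0) :=
  tendsto_integral_Ioi_atTop_zero hq.integrableOn_abs

lemma tendsto_tail₂ (hq : InL11 q) : Tendsto (tail₂ q) atTop (𝓝 0) :=
  tendsto_integral_Ioi_atTop_zero (integrableOn_tail hq)

end PotentialTails

section Exponential

variable {k : ℂ} {x : ℝ}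

lemma hasDerivAt_cexp_mul_ofReal (c : ℂ) (x : ℝ) :
    HasDerivAt (fun t : ℝ => Complex.exp (c * t)) (c * Complex.exp (c * x)) x := by
  simpa [mul_comm] using (((hasDerivAt_id (x : ℂ)).const_mul c).cexp).comp_ofReal

lemma cexp_mul_ofReal_eq_add_integral (c : ℂ) (x : ℝ) :
    Complex.exp (c * x) =
      Complex.exp (c * (0 : ℝ)) + ∫ t in (0 : ℝ)..x, c * Complex.exp (c * t) := by
  have hcont : Continuous fun t : ℝ => c * Complex.exp (c * t) := by fun_prop
  rw [intervalIntegral.integral_eq_sub_of_hasDerivAt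
    (fun t _ => hasDerivAt_cexp_mul_ofReal c t) (hcont.intervalIntegrable 0 x), add_sub_cancel]

lemma cexp_mul_primitive_eq_add_integral (c : ℂ) {G g : ℝ → ℂ} (hx : 0 ≤ x)
    (hg : IntervalIntegrable g volume 0 x)
    (hG : ∀ t ∈ Icc 0 x, G t = G 0 + ∫ s in (0 : ℝ)..t, g s) :
    Complex.exp (c * x) * G x =
      G 0 + ∫ t in (0 : ℝ)..x, Complex.exp (c * t) * (c * G t + g t) := by
  have hcont : Continuous fun t : ℝ => c * Complex.exp (c * t) := by fun_prop
  rw [mul_eq_add_integral (F := fun t : ℝ => Complex.exp (c * t)) hx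
    (hcont.intervalIntegrable 0 x) hg (fun t _ => cexp_mul_ofReal_eq_add_integral c t) hG]
  simp only [Complex.ofReal_zero, mul_zero, Complex.exp_zero, one_mul]
  congr 1
  exact intervalIntegral.integral_congr fun t _ => by ring

lemma norm_cexp_I_mul (k : ℂ) (x : ℝ) :
    ‖Complex.exp (Complex.I * k * x)‖ = Real.exp (-(k.im * x)) := by
  simp [Complex.norm_exp]

lemma norm_cexp_I_mul_le_one (hk : 0 ≤ k.im) (hx : 0 ≤ x) :
    ‖Complex.exp (Complex.I * k * x)‖ ≤ 1 := by
  rw [norm_cexp_I_mul, Real.exp_le_one_iff, neg_nonpos]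
  exact mul_nonneg hk hx

end Exponential

section VolterraOperator

/-- The integrand `e^{2ik(t-s)} q(t) m(t)` of `jostIntegral`. -/
noncomputable def jostIntegrand (q : ℝ → ℝ) (k : ℂ) (m : ℝ → ℂ) (s t : ℝ) : ℂ :=
  Complex.exp (2 * Complex.I * k * ((t : ℂ) - s)) * ((q t : ℂ) * m t)

/-- The inner integral `p(s) = ∫_s^∞ e^{2ik(t-s)} q(t) m(t) dt` of the Volterra equation
`m(x) = 1 + ∫_x^∞ p` for the modified Jost solution `m = e^{-ikx} f(x, k)`. -/
noncomputable def jostIntegral (q : ℝ → ℝ) (k : ℂ) (m : ℝ → ℂ) (s : ℝ) : ℂ :=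
  ∫ t in Ioi s, jostIntegrand q k m s t

variable {q : ℝ → ℝ} {k : ℂ} {m : ℝ → ℂ} {C s t : ℝ}

lemma norm_jostIntegrand_le (hk : 0 ≤ k.im) (hst : s ≤ t) (hm : ‖m t‖ ≤ C) :
    ‖jostIntegrand q k m s t‖ ≤ |q t| * C := by
  have hexp : ‖Complex.exp (2 * Complex.I * k * ((t : ℂ) - s))‖ ≤ 1 := by
    convert norm_cexp_I_mul_le_one hk (mul_nonneg zero_le_two (sub_nonneg.2 hst)) using 3
    push_cast
    ring
  rw [jostIntegrand, norm_mul, norm_mul, Complex.norm_real, Real.norm_eq_abs]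
  calc _ ≤ 1 * (|q t| * ‖m t‖) := by gcongr
    _ ≤ _ := by rw [one_mul]; gcongr

lemma aestronglyMeasurable_jostIntegrand (hq : InL11 q) (hm : ContinuousOn m (Ici 0)) (k : ℂ)
    (hs : 0 ≤ s) : AEStronglyMeasurable (jostIntegrand q k m s) (volume.restrict (Ioi s)) :=
  AEStronglyMeasurable.mul (by fun_prop) (AEStronglyMeasurable.mul
    (hq.integrableOn.mono_set (Ioi_subset_Ioi hs)).ofReal.aestronglyMeasurable
    ((hm.mono (Ioi_subset_Ici hs)).aestronglyMeasurable measurableSet_Ioi))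

lemma InL11.integrableOn_abs_mul_const (hq : InL11 q) (hs : 0 ≤ s) (C : ℝ) :
    IntegrableOn (fun t => |q t| * C) (Ioi s) :=
  (hq.integrableOn_abs.mono_set (Ioi_subset_Ioi hs)).mul_const C

lemma integrableOn_tail_mul_const (hq : InL11 q) (hs : 0 ≤ s) (C : ℝ) :
    IntegrableOn (fun t => tail q t * C) (Ioi s) :=
  ((integrableOn_tail hq).mono_set (Ioi_subset_Ioi hs)).mul_const C

lemma integrableOn_jostIntegrand (hq : InL11 q) (hk : 0 ≤ k.im) (hm : ContinuousOn m (Ici 0))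
    (hC : ∀ t, 0 ≤ t → ‖m t‖ ≤ C) (hs : 0 ≤ s) :
    IntegrableOn (jostIntegrand q k m s) (Ioi s) := by
  refine (hq.integrableOn_abs_mul_const hs C).mono'
    (aestronglyMeasurable_jostIntegrand hq hm k hs) ?_
  filter_upwards [ae_restrict_mem measurableSet_Ioi] with t (ht : s < t)
  exact norm_jostIntegrand_le hk ht.le (hC t (hs.trans ht.le))

lemma norm_jostIntegral_le (hq : InL11 q) (hk : 0 ≤ k.im) (hs : 0 ≤ s)
    (hC : ∀ t, s ≤ t → ‖m t‖ ≤ C) : ‖jostIntegral q k m s‖ ≤ tail q s * C := by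
  rw [jostIntegral, tail, ← integral_mul_const]
  refine norm_integral_le_of_norm_le (hq.integrableOn_abs_mul_const hs C) ?_
  filter_upwards [ae_restrict_mem measurableSet_Ioi] with t (ht : s < t)
  exact norm_jostIntegrand_le hk ht.le (hC t ht.le)

lemma jostIntegral_eq_cexp_mul_integral (q : ℝ → ℝ) (k : ℂ) (m : ℝ → ℂ) (s : ℝ) :
    jostIntegral q k m s =
      Complex.exp (-(2 * Complex.I * k) * s) * ∫ t in Ioi s, jostIntegrand q k m 0 t := by
  rw [jostIntegral, ← integral_const_mul]
  congr 1 with t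
  rw [jostIntegrand, jostIntegrand]
  conv_rhs => rw [← mul_assoc, ← Complex.exp_add]
  congr 2
  push_cast
  ring

lemma continuousOn_jostIntegral (hq : InL11 q) (hk : 0 ≤ k.im) (hm : ContinuousOn m (Ici 0))
    (hC : ∀ t, 0 ≤ t → ‖m t‖ ≤ C) : ContinuousOn (jostIntegral q k m) (Ici 0) := by
  simp_rw [funext (jostIntegral_eq_cexp_mul_integral q k m)]
  exact ContinuousOn.mul (by fun_prop)
    (integrableOn_jostIntegrand hq hk hm hC le_rfl).continuousOn_Ici_primitive_Ioi

lemma integrableOn_jostIntegral (hq : InL11 q) (hk : 0 ≤ k.im) (hm : ContinuousOn m (Ici 0))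
    (hC : ∀ t, 0 ≤ t → ‖m t‖ ≤ C) : IntegrableOn (jostIntegral q k m) (Ioi 0) := by
  refine (integrableOn_tail_mul_const hq le_rfl C).mono'
    (((continuousOn_jostIntegral hq hk hm hC).mono Ioi_subset_Ici_self).aestronglyMeasurable
      measurableSet_Ioi) ?_
  filter_upwards [ae_restrict_mem measurableSet_Ioi] with s (hs : 0 < s)
  exact norm_jostIntegral_le hq hk hs.le fun t ht => hC t (hs.le.trans ht)

lemma jostIntegral_eq_add_integral (hq : InL11 q) (hk : 0 ≤ k.im) (hm : ContinuousOn m (Ici 0))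
    (hC : ∀ t, 0 ≤ t → ‖m t‖ ≤ C) {x : ℝ} (hx : 0 ≤ x) :
    jostIntegral q k m x = jostIntegral q k m 0 +
      ∫ t in (0 : ℝ)..x, (-(2 * Complex.I * k) * jostIntegral q k m t - (q t : ℂ) * m t) := by
  have hint : IntegrableOn (jostIntegrand q k m 0) (Ioi 0) :=
    integrableOn_jostIntegrand hq hk hm hC le_rfl
  rw [jostIntegral_eq_cexp_mul_integral q k m x, cexp_mul_primitive_eq_add_integral _ hx
    (G := fun x => ∫ t in Ioi x, jostIntegrand q k m 0 t)
    (intervalIntegrable_of_integrableOn_Ioi hint hx).neg fun t ht => ?_]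
  · refine congrArg (jostIntegral q k m 0 + ·) (intervalIntegral.integral_congr fun t _ => ?_)
    have hcancel : Complex.exp (-(2 * Complex.I * k) * t) * jostIntegrand q k m 0 t =
        (q t : ℂ) * m t := by
      rw [jostIntegrand, ← mul_assoc, ← Complex.exp_add]
      simp
    simp only [jostIntegral_eq_cexp_mul_integral q k m t, Pi.neg_apply]
    linear_combination -hcancel
  · simp only [Pi.neg_apply, intervalIntegral.integral_neg]
    rw [integral_Ioi_eq_sub hint ht.1, sub_eq_add_neg]

end VolterraOperator

section BoundedHolomorphicFamily

lemma isOpen_upperHalf : IsOpen upperHalf := isOpen_lt continuous_const Complex.continuous_im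

/-- A family `m k` of continuous functions on `[0, ∞)`, uniformly bounded by `C`, that depends
continuously on `k` in the closed upper half-plane and holomorphically in the open one: the class
in which the Volterra equation for the modified Jost solutions is solved. -/
structure IsBoundedHolomorphicFamily (m : ℂ → ℝ → ℂ) (C : ℝ) : Prop where
  continuousOn : ∀ k : ℂ, 0 ≤ k.im → ContinuousOn (m k) (Ici 0)
  norm_le : ∀ k : ℂ, 0 ≤ k.im → ∀ t, 0 ≤ t → ‖m k t‖ ≤ C
  continuousOn_param : ∀ t, 0 ≤ t → ContinuousOn (fun k => m k t) {k : ℂ | 0 ≤ k.im}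
  differentiableOn_param : ∀ t, 0 ≤ t → DifferentiableOn ℂ (fun k => m k t) upperHalf

namespace IsBoundedHolomorphicFamily

variable {q : ℝ → ℝ} {m : ℂ → ℝ → ℂ} {k : ℂ} {C C' s t : ℝ}

lemma norm_jostIntegral_le (h : IsBoundedHolomorphicFamily m C) (hq : InL11 q) (hk : 0 ≤ k.im)
    (hs : 0 ≤ s) : ‖jostIntegral q k (m k) s‖ ≤ tail q s * C :=
  Schrodinger.norm_jostIntegral_le hq hk hs fun t ht => h.norm_le k hk t (hs.trans ht)

lemma integrableOn_jostIntegral (h : IsBoundedHolomorphicFamily m C) (hq : InL11 q)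
    (hk : 0 ≤ k.im) : IntegrableOn (jostIntegral q k (m k)) (Ioi 0) :=
  Schrodinger.integrableOn_jostIntegral hq hk (h.continuousOn k hk) (h.norm_le k hk)

lemma continuousOn_jostIntegral_param (h : IsBoundedHolomorphicFamily m C) (hq : InL11 q)
    (hs : 0 ≤ s) : ContinuousOn (fun k => jostIntegral q k (m k) s) {k : ℂ | 0 ≤ k.im} := by
  refine continuousOn_of_dominated (bound := fun t => |q t| * C)
    (fun k hk => aestronglyMeasurable_jostIntegrand hq (h.continuousOn k hk) k hs)
    (fun k hk => ?_) (hq.integrableOn_abs_mul_const hs C) ?_ <;>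
  filter_upwards [ae_restrict_mem measurableSet_Ioi] with t (ht : s < t)
  · exact norm_jostIntegrand_le hk ht.le (h.norm_le k hk t (hs.trans ht.le))
  · exact ContinuousOn.mul (by fun_prop)
      (continuousOn_const.mul (h.continuousOn_param t (hs.trans ht.le)))

lemma differentiableOn_jostIntegral_param (h : IsBoundedHolomorphicFamily m C) (hq : InL11 q)
    (hs : 0 ≤ s) : DifferentiableOn ℂ (fun k => jostIntegral q k (m k) s) upperHalf := by
  refine differentiableOn_integral_of_dominated isOpen_upperHalf (bound := fun t => |q t| * C)
    (fun k hk => aestronglyMeasurable_jostIntegrand hq (h.continuousOn k (le_of_lt hk)) k hs)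
    ?_ (hq.integrableOn_abs_mul_const hs C) ?_ <;>
  filter_upwards [ae_restrict_mem measurableSet_Ioi] with t (ht : s < t)
  · intro k (hk : 0 < k.im)
    exact norm_jostIntegrand_le hk.le ht.le (h.norm_le k hk.le t (hs.trans ht.le))
  · exact DifferentiableOn.mul (by fun_prop)
      ((differentiableOn_const _).mul (h.differentiableOn_param t (hs.trans ht.le)))

lemma integral_jostIntegral (h : IsBoundedHolomorphicFamily m C) (hq : InL11 q)
    (hC' : ∀ k : ℂ, 0 ≤ k.im → ∀ t, 0 ≤ t → ‖∫ s in Ioi t, jostIntegral q k (m k) s‖ ≤ C') :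
    IsBoundedHolomorphicFamily (fun k x => ∫ s in Ioi x, jostIntegral q k (m k) s) C' := by
  have hmeas : ∀ (k : ℂ) (x : ℝ), 0 ≤ k.im → 0 ≤ x →
      AEStronglyMeasurable (jostIntegral q k (m k)) (volume.restrict (Ioi x)) := fun k x hk hx =>
    ((h.integrableOn_jostIntegral hq hk).mono_set (Ioi_subset_Ioi hx)).aestronglyMeasurable
  refine ⟨fun k hk => (h.integrableOn_jostIntegral hq hk).continuousOn_Ici_primitive_Ioi, hC',
    fun t ht => ?_, fun t ht => ?_⟩
  · refine continuousOn_of_dominated (bound := fun s => tail q s * C)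
      (fun k hk => hmeas k t hk ht) (fun k hk => ?_) (integrableOn_tail_mul_const hq ht C) ?_ <;>
    filter_upwards [ae_restrict_mem measurableSet_Ioi] with s (hs : t < s)
    · exact h.norm_jostIntegral_le hq hk (ht.trans hs.le)
    · exact h.continuousOn_jostIntegral_param hq (ht.trans hs.le)
  · refine differentiableOn_integral_of_dominated isOpen_upperHalf
      (bound := fun s => tail q s * C) (fun k hk => hmeas k t (le_of_lt hk) ht) ?_
      (integrableOn_tail_mul_const hq ht C) ?_ <;>
    filter_upwards [ae_restrict_mem measurableSet_Ioi] with s (hs : t < s)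
    · exact fun k hk => h.norm_jostIntegral_le hq (le_of_lt hk) (ht.trans hs.le)
    · exact h.differentiableOn_jostIntegral_param hq (ht.trans hs.le)

end IsBoundedHolomorphicFamily

end BoundedHolomorphicFamily

section NeumannSeries

/-- The terms of the Neumann series of the Volterra equation `m(x) = 1 + ∫_x^∞ jostIntegral q k m`
for the modified Jost solution. -/
noncomputable def jostIter (q : ℝ → ℝ) : ℕ → ℂ → ℝ → ℂ
  | 0 => fun _ _ => 1
  | n + 1 => fun k x => ∫ s in Ioi x, jostIntegral q k (jostIter q n k) s

/-- The modified Jost solution `e^{-ikx} f(x, k)`, as the sum of the Neumann series. -/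
noncomputable def jostM (q : ℝ → ℝ) (k : ℂ) (x : ℝ) : ℂ := ∑' n, jostIter q n k x

variable {q : ℝ → ℝ} {k : ℂ} {x : ℝ}

lemma norm_jostIter_succ_le (hq : InL11 q) {n : ℕ} (hk : 0 ≤ k.im)
    (h : ∀ x, 0 ≤ x → ‖jostIter q n k x‖ ≤ tail₂ q x ^ n / n.factorial) (hx : 0 ≤ x) :
    ‖jostIter q (n + 1) k x‖ ≤ tail₂ q x ^ (n + 1) / (n + 1).factorial := by
  have hint : ∫ s in Ioi x, tail q s * tail₂ q s ^ n / n.factorial =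
      tail₂ q x ^ (n + 1) / (n + 1).factorial := by
    rw [integral_div, integral_tail_mul_pow hq n hx, Nat.factorial_succ]
    push_cast
    field_simp
  rw [← hint, jostIter]
  refine norm_integral_le_of_norm_le
    (((integrableOn_tail_mul_pow hq n).mono_set (Ioi_subset_Ioi hx)).div_const _) ?_
  filter_upwards [ae_restrict_mem measurableSet_Ioi] with s (hs : x < s)
  have hs0 : 0 ≤ s := hx.trans hs.le
  rw [mul_div_assoc]
  refine norm_jostIntegral_le hq hk hs0 fun t ht => (h t (hs0.trans ht)).trans ?_
  gcongr
  · exact tail₂_nonneg q t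
  · exact tail₂_anti hq hs0 ht

lemma norm_jostIter_le (hq : InL11 q) (n : ℕ) (hk : 0 ≤ k.im) (hx : 0 ≤ x) :
    ‖jostIter q n k x‖ ≤ tail₂ q x ^ n / n.factorial := by
  induction n generalizing x with
  | zero => simp [jostIter]
  | succ n ih => exact norm_jostIter_succ_le hq hk (fun _ => ih) hx

lemma isBoundedHolomorphicFamily_jostIter (hq : InL11 q) (n : ℕ) :
    IsBoundedHolomorphicFamily (jostIter q n) (tail₂ q 0 ^ n / n.factorial) := by
  have hle : ∀ (n : ℕ) (k : ℂ), 0 ≤ k.im → ∀ t, 0 ≤ t →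
      ‖jostIter q n k t‖ ≤ tail₂ q 0 ^ n / n.factorial := fun n k hk t ht => by
    refine (norm_jostIter_le hq n hk ht).trans ?_
    gcongr
    · exact tail₂_nonneg q t
    · exact tail₂_anti hq le_rfl ht
  induction n with
  | zero => exact ⟨fun k _ => continuousOn_const, hle 0, fun t _ => continuousOn_const,
      fun t _ => differentiableOn_const _⟩
  | succ n ih => exact ih.integral_jostIntegral hq (hle (n + 1))

lemma hasSum_jostIter (hq : InL11 q) (hk : 0 ≤ k.im) (hx : 0 ≤ x) :
    HasSum (fun n => jostIter q n k x) (jostM q k x) :=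
  (Summable.of_norm_bounded (Real.summable_pow_div_factorial (tail₂ q x))
    fun n => norm_jostIter_le hq n hk hx).hasSum

lemma isBoundedHolomorphicFamily_jostM (hq : InL11 q) :
    IsBoundedHolomorphicFamily (jostM q) (Real.exp (tail₂ q 0)) := by
  have hsum := Real.summable_pow_div_factorial (tail₂ q 0)
  have hiter := isBoundedHolomorphicFamily_jostIter hq
  refine ⟨fun k hk => ?_, fun k hk t ht => ?_, fun t ht => ?_, fun t ht => ?_⟩
  · exact continuousOn_tsum (fun n => (hiter n).continuousOn k hk) hsum
      fun n t ht => (hiter n).norm_le k hk t ht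
  · rw [Real.exp_eq_exp_ℝ, NormedSpace.exp_eq_tsum_div]
    exact tsum_of_norm_bounded hsum.hasSum fun n => (hiter n).norm_le k hk t ht
  · exact continuousOn_tsum (fun n => (hiter n).continuousOn_param t ht) hsum
      fun n k hk => (hiter n).norm_le k hk t ht
  · exact Complex.differentiableOn_tsum_of_summable_norm hsum
      (fun n => (hiter n).differentiableOn_param t ht) isOpen_upperHalf
      fun n k hk => (hiter n).norm_le k (le_of_lt hk) t ht

lemma hasSum_jostIntegral_jostIter (hq : InL11 q) (hk : 0 ≤ k.im) (hx : 0 ≤ x) :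
    HasSum (fun n => jostIntegral q k (jostIter q n k) x) (jostIntegral q k (jostM q k) x) := by
  have hiter := isBoundedHolomorphicFamily_jostIter hq
  refine hasSum_integral_of_dominated_convergence
    (fun n t => |q t| * (tail₂ q 0 ^ n / n.factorial))
    (fun n => aestronglyMeasurable_jostIntegrand hq ((hiter n).continuousOn k hk) k hx)
    (fun n => ?_) (ae_of_all _ fun t => (Real.summable_pow_div_factorial _).mul_left _) ?_ ?_
  · filter_upwards [ae_restrict_mem measurableSet_Ioi] with t (ht : x < t)
    exact norm_jostIntegrand_le hk ht.le ((hiter n).norm_le k hk t (hx.trans ht.le))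
  · simp_rw [tsum_mul_left]
    exact hq.integrableOn_abs_mul_const hx _
  · filter_upwards [ae_restrict_mem measurableSet_Ioi] with t (ht : x < t)
    exact ((hasSum_jostIter hq hk (hx.trans ht.le)).mul_left _).mul_left _

lemma hasSum_jostIter_succ (hq : InL11 q) (hk : 0 ≤ k.im) (hx : 0 ≤ x) :
    HasSum (fun n => jostIter q (n + 1) k x) (∫ s in Ioi x, jostIntegral q k (jostM q k) s) := by
  have hiter := isBoundedHolomorphicFamily_jostIter hq
  refine hasSum_integral_of_dominated_convergence
    (fun n s => tail q s * (tail₂ q 0 ^ n / n.factorial))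
    (fun n => (((hiter n).integrableOn_jostIntegral hq hk).mono_set
      (Ioi_subset_Ioi hx)).aestronglyMeasurable)
    (fun n => ?_) (ae_of_all _ fun t => (Real.summable_pow_div_factorial _).mul_left _) ?_ ?_
  · filter_upwards [ae_restrict_mem measurableSet_Ioi] with s (hs : x < s)
    exact (hiter n).norm_jostIntegral_le hq hk (hx.trans hs.le)
  · simp_rw [tsum_mul_left]
    exact integrableOn_tail_mul_const hq hx _
  · filter_upwards [ae_restrict_mem measurableSet_Ioi] with s (hs : x < s)
    exact hasSum_jostIntegral_jostIter hq hk (hx.trans hs.le)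

lemma jostM_eq_one_add_integral (hq : InL11 q) (hk : 0 ≤ k.im) (hx : 0 ≤ x) :
    jostM q k x = 1 + ∫ s in Ioi x, jostIntegral q k (jostM q k) s := by
  have hsum := (hasSum_jostIter hq hk hx).summable.sum_add_tsum_nat_add 1
  rw [(hasSum_jostIter_succ hq hk hx).tsum_eq] at hsum
  simpa [jostIter, jostM] using hsum.symm

end NeumannSeries

section JostSolution

/-- `p(x, k) = -∂ₓ m(x, k)`, where `m(x, k) = e^{-ikx} f(x, k)` is the modified Jost solution. -/
noncomputable def jostP (q : ℝ → ℝ) (k : ℂ) (x : ℝ) : ℂ := jostIntegral q k (jostM q k) x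

/-- The Jost solution `f(x, k)`, constructed from the modified one. It agrees with the
choice `jostPair` by uniqueness. -/
noncomputable def jostSol (q : ℝ → ℝ) (k : ℂ) (x : ℝ) : ℂ :=
  Complex.exp (Complex.I * k * x) * jostM q k x

/-- The derivative `∂ₓ f(x, k)` of the Jost solution. -/
noncomputable def jostSolDeriv (q : ℝ → ℝ) (k : ℂ) (x : ℝ) : ℂ :=
  Complex.exp (Complex.I * k * x) * (Complex.I * k * jostM q k x - jostP q k x)

/-- The bound `exp σ₁(0)` for the modified Jost solutions, uniform in `x ≥ 0` and `Im k ≥ 0`. -/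
noncomputable def jostBound (q : ℝ → ℝ) : ℝ := Real.exp (tail₂ q 0)

variable {q : ℝ → ℝ} {k : ℂ} {x : ℝ}

lemma jostBound_pos (q : ℝ → ℝ) : 0 < jostBound q := Real.exp_pos _

lemma norm_jostM_le (hq : InL11 q) (hk : 0 ≤ k.im) (hx : 0 ≤ x) : ‖jostM q k x‖ ≤ jostBound q :=
  (isBoundedHolomorphicFamily_jostM hq).norm_le k hk x hx

lemma norm_jostP_le (hq : InL11 q) (hk : 0 ≤ k.im) (hx : 0 ≤ x) :
    ‖jostP q k x‖ ≤ tail q x * jostBound q :=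
  (isBoundedHolomorphicFamily_jostM hq).norm_jostIntegral_le hq hk hx

lemma continuousOn_jostM (hq : InL11 q) (hk : 0 ≤ k.im) : ContinuousOn (jostM q k) (Ici 0) :=
  (isBoundedHolomorphicFamily_jostM hq).continuousOn k hk

lemma continuousOn_jostP (hq : InL11 q) (hk : 0 ≤ k.im) : ContinuousOn (jostP q k) (Ici 0) :=
  continuousOn_jostIntegral hq hk (continuousOn_jostM hq hk) fun _ ht => norm_jostM_le hq hk ht

lemma integrableOn_jostP (hq : InL11 q) (hk : 0 ≤ k.im) : IntegrableOn (jostP q k) (Ioi 0) :=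
  (isBoundedHolomorphicFamily_jostM hq).integrableOn_jostIntegral hq hk

lemma jostM_sub_one (hq : InL11 q) (hk : 0 ≤ k.im) (hx : 0 ≤ x) :
    jostM q k x - 1 = ∫ s in Ioi x, jostP q k s := by
  rw [jostM_eq_one_add_integral hq hk hx, add_sub_cancel_left]
  rfl

lemma norm_jostM_sub_one_le (hq : InL11 q) (hk : 0 ≤ k.im) (hx : 0 ≤ x) :
    ‖jostM q k x - 1‖ ≤ tail₂ q x * jostBound q := by
  rw [jostM_sub_one hq hk hx, tail₂, ← integral_mul_const]
  refine norm_integral_le_of_norm_le (integrableOn_tail_mul_const hq hx _) ?_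
  filter_upwards [ae_restrict_mem measurableSet_Ioi] with s (hs : x < s)
  exact norm_jostP_le hq hk (hx.trans hs.le)

lemma tendsto_jostM (hq : InL11 q) (hk : 0 ≤ k.im) : Tendsto (jostM q k) atTop (𝓝 1) := by
  rw [tendsto_iff_norm_sub_tendsto_zero]
  refine squeeze_zero' (Eventually.of_forall fun _ => norm_nonneg _) ?_
    (by simpa using (tendsto_tail₂ hq).mul_const (jostBound q))
  filter_upwards [eventually_ge_atTop 0] with x hx using norm_jostM_sub_one_le hq hk hx

lemma tendsto_jostP (hq : InL11 q) (hk : 0 ≤ k.im) : Tendsto (jostP q k) atTop (𝓝 0) := by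
  rw [tendsto_zero_iff_norm_tendsto_zero]
  refine squeeze_zero' (Eventually.of_forall fun _ => norm_nonneg _) ?_
    (by simpa using (tendsto_tail hq).mul_const (jostBound q))
  filter_upwards [eventually_ge_atTop 0] with x hx using norm_jostP_le hq hk hx

lemma hasDerivWithinAt_jostM (hq : InL11 q) (hk : 0 ≤ k.im) (hx : 0 ≤ x) :
    HasDerivWithinAt (jostM q k) (-jostP q k x) (Ici 0) x :=
  ((hasDerivWithinAt_integral_Ioi (integrableOn_jostP hq hk) (continuousOn_jostP hq hk)
    hx).const_add 1).congr_of_mem (fun _ ht => jostM_eq_one_add_integral hq hk ht) hx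

lemma jostM_eq_sub_integral (hq : InL11 q) (hk : 0 ≤ k.im) (hx : 0 ≤ x) :
    jostM q k x = jostM q k 0 - ∫ t in (0 : ℝ)..x, jostP q k t := by
  linear_combination jostM_sub_one hq hk hx - jostM_sub_one hq hk le_rfl +
    integral_Ioi_eq_sub (integrableOn_jostP hq hk) hx

lemma jostP_eq_add_integral (hq : InL11 q) (hk : 0 ≤ k.im) (hx : 0 ≤ x) :
    jostP q k x = jostP q k 0 +
      ∫ t in (0 : ℝ)..x, (-(2 * Complex.I * k) * jostP q k t - (q t : ℂ) * jostM q k t) :=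
  jostIntegral_eq_add_integral hq hk (continuousOn_jostM hq hk)
    (fun _ ht => norm_jostM_le hq hk ht) hx

lemma integrableOn_mul_jostM (hq : InL11 q) (hk : 0 ≤ k.im) :
    IntegrableOn (fun t => (q t : ℂ) * jostM q k t) (Ioi 0) := by
  refine Integrable.mul_bdd (c := jostBound q) hq.integrableOn.ofReal
    (((continuousOn_jostM hq hk).mono Ioi_subset_Ici_self).aestronglyMeasurable
      measurableSet_Ioi) ?_
  filter_upwards [ae_restrict_mem measurableSet_Ioi] with s (hs : 0 < s)
  exact norm_jostM_le hq hk hs.le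

lemma I_mul_jostM_sub_jostP_eq_add_integral (hq : InL11 q) (hk : 0 ≤ k.im) (hx : 0 ≤ x) :
    Complex.I * k * jostM q k x - jostP q k x = Complex.I * k * jostM q k 0 - jostP q k 0 +
      ∫ t in (0 : ℝ)..x, (Complex.I * k * jostP q k t + (q t : ℂ) * jostM q k t) := by
  have hp := intervalIntegrable_of_integrableOn_Ioi (integrableOn_jostP hq hk) hx
  have hqm := intervalIntegrable_of_integrableOn_Ioi (integrableOn_mul_jostM hq hk) hx
  rw [jostM_eq_sub_integral hq hk hx, jostP_eq_add_integral hq hk hx,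
    intervalIntegral.integral_sub (hp.const_mul _) hqm,
    intervalIntegral.integral_add (hp.const_mul _) hqm,
    intervalIntegral.integral_const_mul, intervalIntegral.integral_const_mul]
  ring

lemma isSolution_jostSol (hq : InL11 q) (hk : 0 ≤ k.im) :
    IsSolution q (k ^ 2) (jostSol q k) (jostSolDeriv q k) where
  hasDeriv x hx := by
    refine ((hasDerivAt_cexp_mul_ofReal (Complex.I * k) x).hasDerivWithinAt.mul
      (hasDerivWithinAt_jostM hq hk hx)).congr_deriv ?_
    rw [jostSolDeriv]
    ring
  deriv_eq x hx := by
    have hp := intervalIntegrable_of_integrableOn_Ioi (integrableOn_jostP hq hk) hx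
    have hqm := intervalIntegrable_of_integrableOn_Ioi (integrableOn_mul_jostM hq hk) hx
    rw [jostSolDeriv, cexp_mul_primitive_eq_add_integral (Complex.I * k)
      (G := fun x => Complex.I * k * jostM q k x - jostP q k x) hx ((hp.const_mul _).add hqm)
      fun t ht => I_mul_jostM_sub_jostP_eq_add_integral hq hk ht.1]
    congr 1
    · simp [jostSolDeriv]
    · refine intervalIntegral.integral_congr fun t _ => ?_
      simp only [jostSol]
      linear_combination (k ^ 2 * Complex.exp (Complex.I * k * t) * jostM q k t) * Complex.I_sq

lemma isJostSolution_jostSol (hq : InL11 q) (hk : 0 ≤ k.im) :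
    IsJostSolution q k (jostSol q k) (jostSolDeriv q k) where
  isSolution := isSolution_jostSol hq hk
  asymptotics := (tendsto_jostM hq hk).congr fun x => by
    rw [jostSol, ← mul_assoc, ← Complex.exp_add, neg_add_cancel, Complex.exp_zero, one_mul]

lemma norm_jostSol_le (hq : InL11 q) (hk : 0 ≤ k.im) (hx : 0 ≤ x) :
    ‖jostSol q k x‖ ≤ jostBound q * Real.exp (-(k.im * x)) := by
  rw [jostSol, norm_mul, norm_cexp_I_mul, mul_comm]
  gcongr
  exact norm_jostM_le hq hk hx

lemma norm_jostSolDeriv_le (hq : InL11 q) (hk : 0 ≤ k.im) (hx : 0 ≤ x) :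
    ‖jostSolDeriv q k x‖ ≤ (‖k‖ + tail q 0) * jostBound q * Real.exp (-(k.im * x)) := by
  rw [jostSolDeriv, norm_mul, norm_cexp_I_mul, mul_comm]
  gcongr
  calc _ ≤ ‖Complex.I * k * jostM q k x‖ + ‖jostP q k x‖ := norm_sub_le _ _
    _ ≤ ‖k‖ * jostBound q + tail q 0 * jostBound q := by
      gcongr
      · rw [norm_mul, norm_mul, Complex.norm_I, one_mul]
        gcongr
        exact norm_jostM_le hq hk hx
      · refine (norm_jostP_le hq hk hx).trans ?_
        gcongr
        · exact (jostBound_pos q).le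
        · exact tail_le_tail_zero hq hx
    _ = _ := by ring

lemma jostSol_zero_ne_zero_or (hq : InL11 q) (hk : 0 ≤ k.im) :
    jostSol q k 0 ≠ 0 ∨ jostSolDeriv q k 0 ≠ 0 := by
  by_contra! h
  have hf := isJostSolution_jostSol hq hk
  have hzero : Tendsto (fun _ : ℝ => (0 : ℂ)) atTop (𝓝 1) := by
    refine hf.asymptotics.congr' ?_
    filter_upwards [eventually_ge_atTop 0] with x hx
    rw [(hf.isSolution.eq_zero_of_initial hq.locallyIntegrableOn h.1 h.2 hx).1, mul_zero]
  exact zero_ne_one (tendsto_nhds_unique tendsto_const_nhds hzero)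

end JostSolution

section Uniqueness

lemma tendsto_integral_add_one_of_tendsto_zero {E : Type*} [NormedAddCommGroup E] [NormedSpace ℝ E]
    {h : ℝ → E} (hh : Tendsto h atTop (𝓝 0)) :
    Tendsto (fun x => ∫ t in x..x + 1, h t) atTop (𝓝 0) := by
  refine Metric.tendsto_atTop'.2 fun ε hε => ?_
  obtain ⟨N, hN⟩ := Metric.tendsto_atTop.1 hh (ε / 2) (half_pos hε)
  refine ⟨N, fun x hx => ?_⟩
  have hle : ‖∫ t in x..x + 1, h t‖ ≤ ε / 2 * |x + 1 - x| := by
    refine intervalIntegral.norm_integral_le_of_norm_le_const fun t ht => ?_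
    rw [uIoc_of_le (by linarith)] at ht
    simpa using (hN t (hx.trans ht.1).le).le
  rw [add_sub_cancel_left, abs_one, mul_one] at hle
  rw [dist_zero_right]
  linarith

namespace IsSolution

variable {q : ℝ → ℝ} {E : ℂ} {u v f g : ℝ → ℂ}

lemma mul_sub_mul_eq_wronskian_add_integral (h₁ : IsSolution q E u v) (h₂ : IsSolution q E f g)
    (hq : LocallyIntegrableOn q (Ici 0)) {a b : ℝ} (ha : 0 ≤ a) (hab : a ≤ b) :
    u b * f b - u a * f a =
      (b - a) * (v 0 * f 0 - u 0 * g 0) + 2 * ∫ t in a..b, u t * g t := by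
  have hsub : Icc a b ⊆ Ici 0 := fun t ht => ha.trans ht.1
  have hug : IntervalIntegrable (fun t => 2 * (u t * g t)) volume a b :=
    ContinuousOn.intervalIntegrable_of_Icc hab
      (continuousOn_const.mul ((h₁.continuousOn.mul (h₂.continuousOn_deriv hq)).mono hsub))
  have hderiv : ∀ t ∈ Ioo a b, HasDerivWithinAt (fun t => u t * f t)
      (v 0 * f 0 - u 0 * g 0 + 2 * (u t * g t)) (Ioi t) t := fun t ht => by
    have ht0 : 0 ≤ t := ha.trans ht.1.le
    refine (((h₁.hasDeriv t ht0).mul (h₂.hasDeriv t ht0)).congr_deriv ?_).mono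
      fun s hs => ht0.trans (le_of_lt hs)
    linear_combination h₁.wronskian_eq_of_energy_eq h₂ hq ht0
  rw [← intervalIntegral.integral_eq_sub_of_hasDeriv_right_of_le (f := fun t => u t * f t) hab
    ((h₁.continuousOn.mul h₂.continuousOn).mono hsub) hderiv (intervalIntegrable_const.add hug),
    intervalIntegral.integral_add intervalIntegrable_const hug, intervalIntegral.integral_const,
    intervalIntegral.integral_const_mul, Complex.real_smul, Complex.ofReal_sub]

/-- Integrating the Wronskian over `[x, x + 1]` by parts trades `u'` for boundary terms, so that
no control of `u'` at infinity is needed. -/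
lemma wronskian_eq_zero_of_tendsto (h₁ : IsSolution q E u v) (h₂ : IsSolution q E f g)
    (hq : LocallyIntegrableOn q (Ici 0)) (hu : Tendsto u atTop (𝓝 0))
    (hf : IsBoundedUnder (· ≤ ·) atTop fun x => ‖f x‖)
    (hg : IsBoundedUnder (· ≤ ·) atTop fun x => ‖g x‖) : v 0 * f 0 - u 0 * g 0 = 0 := by
  have huf : Tendsto (fun x => u x * f x) atTop (𝓝 0) := hu.zero_mul_isBoundedUnder_le hf
  have hug : Tendsto (fun x => u x * g x) atTop (𝓝 0) := hu.zero_mul_isBoundedUnder_le hg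
  have hlim := ((huf.comp (tendsto_atTop_add_const_right atTop 1 tendsto_id)).sub huf).sub
    ((tendsto_integral_add_one_of_tendsto_zero hug).const_mul 2)
  rw [sub_zero, mul_zero, sub_zero] at hlim
  refine tendsto_nhds_unique (tendsto_const_nhds.congr' ?_) hlim
  filter_upwards [eventually_ge_atTop 0] with x hx
  have h := h₁.mul_sub_mul_eq_wronskian_add_integral h₂ hq hx (le_add_of_nonneg_right zero_le_one)
  push_cast at h
  simp only [Function.comp_apply, id]
  linear_combination -h

lemma exists_eq_const_mul_of_wronskian_eq_zero (h₁ : IsSolution q E u v) (h₂ : IsSolution q E f g)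
    (hq : LocallyIntegrableOn q (Ici 0)) (hW : v 0 * f 0 - u 0 * g 0 = 0)
    (h0 : f 0 ≠ 0 ∨ g 0 ≠ 0) :
    ∃ c : ℂ, ∀ x, 0 ≤ x → u x = c * f x ∧ v x = c * g x := by
  obtain ⟨c, hu, hv⟩ : ∃ c : ℂ, u 0 = c * f 0 ∧ v 0 = c * g 0 := by
    rcases h0 with hf | hg
    · exact ⟨u 0 / f 0, by field_simp, by field_simp; linear_combination hW⟩
    · exact ⟨v 0 / g 0, by field_simp; linear_combination -hW, by field_simp⟩
  refine ⟨c, fun x hx => ?_⟩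
  have h := (h₁.linear_combination h₂ hq 1 (-c)).eq_zero_of_initial hq
    (by linear_combination hu) (by linear_combination hv) hx
  exact ⟨by linear_combination h.1, by linear_combination h.2⟩

end IsSolution

variable {q : ℝ → ℝ} {k : ℂ}

lemma isBoundedUnder_norm_jostSol (hq : InL11 q) (hk : 0 ≤ k.im) :
    IsBoundedUnder (· ≤ ·) atTop fun x => ‖jostSol q k x‖ := by
  refine ⟨jostBound q, eventually_map.2 ?_⟩
  filter_upwards [eventually_ge_atTop 0] with x hx
  refine (norm_jostSol_le hq hk hx).trans (mul_le_of_le_one_right (jostBound_pos q).le ?_)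
  exact Real.exp_le_one_iff.2 (neg_nonpos.2 (mul_nonneg hk hx))

lemma isBoundedUnder_norm_jostSolDeriv (hq : InL11 q) (hk : 0 ≤ k.im) :
    IsBoundedUnder (· ≤ ·) atTop fun x => ‖jostSolDeriv q k x‖ := by
  refine ⟨(‖k‖ + tail q 0) * jostBound q, eventually_map.2 ?_⟩
  filter_upwards [eventually_ge_atTop 0] with x hx
  refine (norm_jostSolDeriv_le hq hk hx).trans (mul_le_of_le_one_right ?_ ?_)
  · exact mul_nonneg (add_nonneg (norm_nonneg k) (tail_nonneg q 0)) (jostBound_pos q).le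
  · exact Real.exp_le_one_iff.2 (neg_nonpos.2 (mul_nonneg hk hx))

lemma tendsto_zero_of_tendsto_cexp_neg_mul {d : ℝ → ℂ} (hk : 0 ≤ k.im)
    (hd : Tendsto (fun x : ℝ => Complex.exp (-(Complex.I * k * x)) * d x) atTop (𝓝 0)) :
    Tendsto d atTop (𝓝 0) := by
  refine (hd.zero_mul_isBoundedUnder_le
    (g := fun x : ℝ => Complex.exp (Complex.I * k * x)) ⟨1, eventually_map.2 ?_⟩).congr fun x => ?_
  · filter_upwards [eventually_ge_atTop 0] with x hx using norm_cexp_I_mul_le_one hk hx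
  · rw [mul_right_comm, ← Complex.exp_add, neg_add_cancel, Complex.exp_zero, one_mul]

lemma IsJostSolution.eqOn_jostSol {u v : ℝ → ℂ} (h : IsJostSolution q k u v) (hq : InL11 q)
    (hk : 0 ≤ k.im) : EqOn u (jostSol q k) (Ici 0) ∧ EqOn v (jostSolDeriv q k) (Ici 0) := by
  have hf := isJostSolution_jostSol hq hk
  have hq' := hq.locallyIntegrableOn
  have hdiff := h.isSolution.linear_combination hf.isSolution hq' 1 (-1)
  have hlim : Tendsto (fun x : ℝ => Complex.exp (-(Complex.I * k * x)) *
      (1 * u x + -1 * jostSol q k x)) atTop (𝓝 0) := by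
    simpa using (h.asymptotics.sub hf.asymptotics).congr fun x => by ring
  obtain ⟨c, hc⟩ := hdiff.exists_eq_const_mul_of_wronskian_eq_zero hf.isSolution hq'
    (hdiff.wronskian_eq_zero_of_tendsto hf.isSolution hq'
      (tendsto_zero_of_tendsto_cexp_neg_mul hk hlim)
      (isBoundedUnder_norm_jostSol hq hk) (isBoundedUnder_norm_jostSolDeriv hq hk))
    (jostSol_zero_ne_zero_or hq hk)
  obtain rfl : c = 0 := by
    refine tendsto_nhds_unique ?_ hlim
    refine (by simpa using hf.asymptotics.const_mul c : Tendsto _ _ (𝓝 c)).congr' ?_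
    filter_upwards [eventually_ge_atTop 0] with x hx
    rw [(hc x hx).1]
    ring
  exact ⟨fun x hx => by linear_combination (hc x hx).1,
    fun x hx => by linear_combination (hc x hx).2⟩

lemma isJostSolution_jostPair (hq : InL11 q) (hk : 0 ≤ k.im) :
    IsJostSolution q k (jostPair q k).1 (jostPair q k).2 :=
  Classical.epsilon_spec (p := fun p : (ℝ → ℂ) × (ℝ → ℂ) => IsJostSolution q k p.1 p.2)
    ⟨(jostSol q k, jostSolDeriv q k), isJostSolution_jostSol hq hk⟩

lemma jostFunction_eq_jostSol (hq : InL11 q) (hk : 0 ≤ k.im) :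
    jostFunction q k = jostSol q k 0 :=
  ((isJostSolution_jostPair hq hk).eqOn_jostSol hq hk).1 self_mem_Ici

/-- The derivative `f'(0, k)` of the Jost solution at the origin, so that `I(k) = f'(0, k) / f(k)`
(the counterpart of `jostFunction`). -/
noncomputable def jostDeriv (q : ℝ → ℝ) (k : ℂ) : ℂ := (jostPair q k).2 0

lemma iFunction_eq_div (q : ℝ → ℝ) (k : ℂ) : iFunction q k = jostDeriv q k / jostFunction q k := rfl

lemma jostDeriv_eq_jostSolDeriv (hq : InL11 q) (hk : 0 ≤ k.im) :
    jostDeriv q k = jostSolDeriv q k 0 :=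
  ((isJostSolution_jostPair hq hk).eqOn_jostSol hq hk).2 self_mem_Ici

lemma jostFunction_eq_jostM (hq : InL11 q) (hk : 0 ≤ k.im) : jostFunction q k = jostM q k 0 := by
  simp [jostFunction_eq_jostSol hq hk, jostSol]

lemma jostSolDeriv_zero (q : ℝ → ℝ) (k : ℂ) :
    jostSolDeriv q k 0 = Complex.I * k * jostM q k 0 - jostP q k 0 := by
  simp [jostSolDeriv]

end Uniqueness

section LargeEnergy

variable {q : ℝ → ℝ} {k : ℂ}

lemma norm_integral_mul_jostM_le (hq : InL11 q) (hk : 0 ≤ k.im) :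
    ‖∫ t in Ioi 0, (q t : ℂ) * jostM q k t‖ ≤ tail q 0 * jostBound q := by
  rw [tail, ← integral_mul_const]
  refine norm_integral_le_of_norm_le (hq.integrableOn_abs.mul_const _) ?_
  filter_upwards [ae_restrict_mem measurableSet_Ioi] with s (hs : 0 < s)
  rw [norm_mul, Complex.norm_real, Real.norm_eq_abs]
  gcongr
  exact norm_jostM_le hq hk hs.le

lemma two_I_mul_jostM_zero_sub_one (hq : InL11 q) (hk : 0 ≤ k.im) :
    2 * Complex.I * k * (jostM q k 0 - 1) =
      jostP q k 0 - ∫ t in Ioi 0, (q t : ℂ) * jostM q k t := by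
  have hp := integrableOn_jostP hq hk
  have hqm := integrableOn_mul_jostM hq hk
  have hlim := intervalIntegral_tendsto_integral_Ioi 0
    ((hp.const_mul (-(2 * Complex.I * k))).sub hqm) tendsto_id
  have hint := tendsto_nhds_unique (hlim.congr' (by
    filter_upwards [eventually_ge_atTop 0] with x hx
    rw [jostP_eq_add_integral hq hk hx, add_sub_cancel_left]
    rfl)) ((tendsto_jostP hq hk).sub_const (jostP q k 0))
  simp only [Pi.sub_apply] at hint
  rw [integral_sub (hp.const_mul _) hqm, integral_const_mul, ← jostM_sub_one hq hk le_rfl] at hint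
  linear_combination -hint

lemma norm_mul_jostM_zero_sub_one_le (hq : InL11 q) (hk : 0 ≤ k.im) :
    ‖k‖ * ‖jostM q k 0 - 1‖ ≤ tail q 0 * jostBound q := by
  have hnorm : 2 * (‖k‖ * ‖jostM q k 0 - 1‖) =
      ‖jostP q k 0 - ∫ t in Ioi 0, (q t : ℂ) * jostM q k t‖ := by
    rw [← two_I_mul_jostM_zero_sub_one hq hk]
    simp [mul_assoc]
  linarith [norm_sub_le (jostP q k 0) (∫ t in Ioi 0, (q t : ℂ) * jostM q k t),
    norm_jostP_le hq hk le_rfl, norm_integral_mul_jostM_le hq hk]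

end LargeEnergy

section JostFunction

variable {q : ℝ → ℝ} {k : ℂ}

lemma continuousOn_jostFunction (hq : InL11 q) :
    ContinuousOn (jostFunction q) {k : ℂ | 0 ≤ k.im} :=
  ((isBoundedHolomorphicFamily_jostM hq).continuousOn_param 0 le_rfl).congr fun _ hk =>
    jostFunction_eq_jostM hq hk

lemma differentiableOn_jostFunction (hq : InL11 q) :
    DifferentiableOn ℂ (jostFunction q) upperHalf :=
  ((isBoundedHolomorphicFamily_jostM hq).differentiableOn_param 0 le_rfl).congr fun _ hk =>
    jostFunction_eq_jostM hq (le_of_lt hk)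

lemma jostDeriv_eq_sub (hq : InL11 q) (hk : 0 ≤ k.im) :
    jostDeriv q k = Complex.I * k * jostFunction q k - jostIntegral q k (jostM q k) 0 := by
  rw [jostDeriv_eq_jostSolDeriv hq hk, jostSolDeriv_zero, jostFunction_eq_jostM hq hk, jostP]

lemma continuousOn_jostDeriv (hq : InL11 q) : ContinuousOn (jostDeriv q) {k : ℂ | 0 ≤ k.im} :=
  ((((continuousOn_const (c := Complex.I)).mul continuousOn_id).mul
    (continuousOn_jostFunction hq)).sub
      ((isBoundedHolomorphicFamily_jostM hq).continuousOn_jostIntegral_param hq le_rfl)).congr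
    fun _ hk => jostDeriv_eq_sub hq hk

lemma differentiableOn_jostDeriv (hq : InL11 q) : DifferentiableOn ℂ (jostDeriv q) upperHalf :=
  ((((differentiableOn_const Complex.I).mul differentiableOn_id).mul
    (differentiableOn_jostFunction hq)).sub
      ((isBoundedHolomorphicFamily_jostM hq).differentiableOn_jostIntegral_param hq le_rfl)).congr
    fun _ hk => jostDeriv_eq_sub hq (le_of_lt hk)

lemma norm_jostFunction_le (hq : InL11 q) (hk : 0 ≤ k.im) : ‖jostFunction q k‖ ≤ jostBound q := by
  rw [jostFunction_eq_jostM hq hk]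
  exact norm_jostM_le hq hk le_rfl

lemma norm_jostDeriv_le (hq : InL11 q) (hk : 0 ≤ k.im) :
    ‖jostDeriv q k‖ ≤ (‖k‖ + tail q 0) * jostBound q := by
  rw [jostDeriv_eq_jostSolDeriv hq hk]
  simpa using norm_jostSolDeriv_le hq hk (le_refl (0 : ℝ))

lemma norm_mul_jostFunction_sub_one_le (hq : InL11 q) (hk : 0 ≤ k.im) :
    ‖k‖ * ‖jostFunction q k - 1‖ ≤ tail q 0 * jostBound q := by
  rw [jostFunction_eq_jostM hq hk]
  exact norm_mul_jostM_zero_sub_one_le hq hk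

lemma jostDeriv_ne_zero_of_jostFunction_eq_zero (hq : InL11 q) (hk : 0 ≤ k.im)
    (h : jostFunction q k = 0) : jostDeriv q k ≠ 0 := by
  rw [jostDeriv_eq_jostSolDeriv hq hk]
  rw [jostFunction_eq_jostSol hq hk] at h
  exact (jostSol_zero_ne_zero_or hq hk).resolve_left (not_not.2 h)

lemma zero_le_im_neg_conj (hk : 0 ≤ k.im) : 0 ≤ (-starRingEnd ℂ k).im := by simpa using hk

lemma IsJostSolution.neg_conj {u v : ℝ → ℂ} (h : IsJostSolution q k u v) :
    IsJostSolution q (-starRingEnd ℂ k) (fun x => starRingEnd ℂ (u x))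
      fun x => starRingEnd ℂ (v x) where
  isSolution := by simpa using h.isSolution.conj
  asymptotics := by
    have hlim := (Complex.continuous_conj.tendsto 1).comp h.asymptotics
    rw [map_one] at hlim
    refine hlim.congr fun x => ?_
    simp [← Complex.exp_conj]

lemma jostSol_neg_conj (hq : InL11 q) (hk : 0 ≤ k.im) {x : ℝ} (hx : 0 ≤ x) :
    jostSol q (-starRingEnd ℂ k) x = starRingEnd ℂ (jostSol q k x) :=
  (((isJostSolution_jostSol hq hk).neg_conj.eqOn_jostSol hq (zero_le_im_neg_conj hk)).1 hx).symm

lemma jostFunction_neg_conj (hq : InL11 q) (hk : 0 ≤ k.im) :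
    jostFunction q (-starRingEnd ℂ k) = starRingEnd ℂ (jostFunction q k) := by
  rw [jostFunction_eq_jostSol hq (zero_le_im_neg_conj hk), jostFunction_eq_jostSol hq hk,
    jostSol_neg_conj hq hk le_rfl]

lemma jostDeriv_neg_conj (hq : InL11 q) (hk : 0 ≤ k.im) :
    jostDeriv q (-starRingEnd ℂ k) = starRingEnd ℂ (jostDeriv q k) := by
  rw [jostDeriv_eq_jostSolDeriv hq (zero_le_im_neg_conj hk)]
  exact (((isJostSolution_jostPair hq hk).neg_conj.eqOn_jostSol hq
    (zero_le_im_neg_conj hk)).2 self_mem_Ici).symm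

lemma iFunction_neg_ofReal (hq : InL11 q) (s : ℝ) :
    iFunction q ((-s : ℝ) : ℂ) = starRingEnd ℂ (iFunction q s) := by
  have hs : ((-s : ℝ) : ℂ) = -starRingEnd ℂ (s : ℂ) := by simp
  have him : 0 ≤ (s : ℂ).im := (Complex.ofReal_im s).ge
  rw [iFunction_eq_div, iFunction_eq_div, hs, jostFunction_neg_conj hq him,
    jostDeriv_neg_conj hq him, map_div₀]

lemma im_jostDeriv_mul_conj_of_real (hq : InL11 q) (s : ℝ) :
    (jostDeriv q s * starRingEnd ℂ (jostFunction q s)).im = s := by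
  have hk : 0 ≤ (s : ℂ).im := (Complex.ofReal_im s).ge
  have hS := (isJostSolution_jostSol hq hk).isSolution
  have hS' : IsSolution q ((s : ℂ) ^ 2) (fun x => starRingEnd ℂ (jostSol q s x))
      fun x => starRingEnd ℂ (jostSolDeriv q s x) := by simpa using hS.conj
  have hm := tendsto_jostM hq hk
  have hconj := (Complex.continuous_conj.tendsto 1).comp hm
  have hlim := (Complex.continuous_im.tendsto _).comp
    (((hm.const_mul (Complex.I * s)).sub (tendsto_jostP hq hk)).mul hconj)
  simp only [map_one, mul_one, sub_zero, Complex.mul_im, Complex.I_re, Complex.I_im,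
    Complex.ofReal_re, Complex.ofReal_im, zero_mul, one_mul, zero_add] at hlim
  refine tendsto_nhds_unique (tendsto_const_nhds.congr' ?_) hlim
  filter_upwards [eventually_ge_atTop 0] with x hx
  have hexp : Complex.exp (Complex.I * s * x) * starRingEnd ℂ (Complex.exp (Complex.I * s * x)) =
      1 := by
    rw [Complex.mul_conj, Complex.normSq_eq_norm_sq, norm_cexp_I_mul]
    simp
  have hmod : jostSolDeriv q s x * starRingEnd ℂ (jostSol q s x) =
      (Complex.I * s * jostM q s x - jostP q s x) * starRingEnd ℂ (jostM q s x) := by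
    rw [jostSol, jostSolDeriv, map_mul]
    linear_combination ((Complex.I * s * jostM q s x - jostP q s x) *
      starRingEnd ℂ (jostM q s x)) * hexp
  have hW := congrArg Complex.im (hS.wronskian_eq_of_energy_eq hS' hq.locallyIntegrableOn hx)
  rw [← jostFunction_eq_jostSol hq hk, ← jostDeriv_eq_jostSolDeriv hq hk] at hW
  simp only [Function.comp_apply]
  rw [← hmod]
  simp only [Complex.sub_im, Complex.mul_im, Complex.conj_re, Complex.conj_im] at hW ⊢
  linarith

end JostFunction

section DecayingSolutions

variable {q : ℝ → ℝ} {k : ℂ} {u : ℝ → ℂ} {C b : ℝ}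

lemma tendsto_exp_neg_mul_atTop (hb : 0 < b) :
    Tendsto (fun x : ℝ => Real.exp (-(b * x))) atTop (𝓝 0) :=
  Real.tendsto_exp_neg_atTop_nhds_zero.comp (tendsto_id.const_mul_atTop hb)

lemma tendsto_zero_of_norm_le_mul_exp (hb : 0 < b)
    (h : ∀ x, 0 ≤ x → ‖u x‖ ≤ C * Real.exp (-(b * x))) : Tendsto u atTop (𝓝 0) := by
  refine squeeze_zero_norm' ?_ (by simpa using (tendsto_exp_neg_mul_atTop hb).const_mul C)
  filter_upwards [eventually_ge_atTop 0] with x hx using h x hx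

lemma memLp_two_of_norm_le_mul_exp (hu : ContinuousOn u (Ici 0)) (hb : 0 < b)
    (h : ∀ x, 0 ≤ x → ‖u x‖ ≤ C * Real.exp (-(b * x))) :
    MemLp u 2 (volume.restrict (Ioi (0 : ℝ))) := by
  have hm : AEStronglyMeasurable u (volume.restrict (Ioi (0 : ℝ))) :=
    (hu.mono Ioi_subset_Ici_self).aestronglyMeasurable measurableSet_Ioi
  refine (memLp_two_iff_integrable_sq_norm hm).2 ?_
  have hi : IntegrableOn (fun x : ℝ => C ^ 2 * Real.exp (-(2 * b) * x)) (Ioi 0) :=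
    (integrableOn_exp_mul_Ioi (by linarith) 0).const_mul _
  refine hi.mono' (hm.norm.pow 2) ?_
  filter_upwards [ae_restrict_mem measurableSet_Ioi] with x (hx : 0 < x)
  calc ‖‖u x‖ ^ 2‖ = ‖u x‖ ^ 2 := by rw [norm_pow, norm_norm]
    _ ≤ (C * Real.exp (-(b * x))) ^ 2 := by gcongr; exact h x hx.le
    _ = C ^ 2 * Real.exp (-(2 * b) * x) := by
      rw [mul_pow, ← Real.exp_nat_mul]
      congr 2
      push_cast
      ring

lemma tendsto_jostSol (hq : InL11 q) (hk : 0 < k.im) : Tendsto (jostSol q k) atTop (𝓝 0) :=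
  tendsto_zero_of_norm_le_mul_exp hk fun _ => norm_jostSol_le hq hk.le

lemma tendsto_jostSolDeriv (hq : InL11 q) (hk : 0 < k.im) :
    Tendsto (jostSolDeriv q k) atTop (𝓝 0) :=
  tendsto_zero_of_norm_le_mul_exp hk fun _ => norm_jostSolDeriv_le hq hk.le

lemma memLp_two_jostSol (hq : InL11 q) (hk : 0 < k.im) :
    MemLp (jostSol q k) 2 (volume.restrict (Ioi (0 : ℝ))) :=
  memLp_two_of_norm_le_mul_exp (isJostSolution_jostSol hq hk.le).isSolution.continuousOn hk
    fun _ => norm_jostSol_le hq hk.le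

lemma memLp_two_jostSolDeriv (hq : InL11 q) (hk : 0 < k.im) :
    MemLp (jostSolDeriv q k) 2 (volume.restrict (Ioi (0 : ℝ))) :=
  memLp_two_of_norm_le_mul_exp
    ((isJostSolution_jostSol hq hk.le).isSolution.continuousOn_deriv hq.locallyIntegrableOn) hk
    fun _ => norm_jostSolDeriv_le hq hk.le

end DecayingSolutions

section LowerBound

variable {q : ℝ → ℝ} {k k₁ k₂ : ℂ}

lemma integrableOn_jostSol_mul_jostSol (hq : InL11 q) (hk₁ : 0 < k₁.im) (hk₂ : 0 < k₂.im) :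
    IntegrableOn (fun t => jostSol q k₁ t * jostSol q k₂ t) (Ioi 0) :=
  (memLp_two_jostSol hq hk₁).integrable_mul (memLp_two_jostSol hq hk₂)

lemma jostDeriv_mul_jostFunction_sub (hq : InL11 q) (hk₁ : 0 < k₁.im) (hk₂ : 0 < k₂.im) :
    jostDeriv q k₁ * jostFunction q k₂ - jostFunction q k₁ * jostDeriv q k₂ =
      (k₁ ^ 2 - k₂ ^ 2) * ∫ t in Ioi 0, jostSol q k₁ t * jostSol q k₂ t := by
  have hlim := (((tendsto_jostSolDeriv hq hk₁).mul (tendsto_jostSol hq hk₂)).sub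
    ((tendsto_jostSol hq hk₁).mul (tendsto_jostSolDeriv hq hk₂))).add
    ((intervalIntegral_tendsto_integral_Ioi 0 (integrableOn_jostSol_mul_jostSol hq hk₁ hk₂)
      tendsto_id).const_mul (k₁ ^ 2 - k₂ ^ 2))
  rw [mul_zero, sub_zero, zero_add] at hlim
  refine tendsto_nhds_unique (tendsto_const_nhds.congr' ?_) hlim
  filter_upwards [eventually_ge_atTop 0] with x hx
  rw [(isJostSolution_jostSol hq hk₁.le).isSolution.wronskian_eq
    (isJostSolution_jostSol hq hk₂.le).isSolution hq.locallyIntegrableOn hx,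
    jostFunction_eq_jostSol hq hk₁.le, jostFunction_eq_jostSol hq hk₂.le,
    jostDeriv_eq_jostSolDeriv hq hk₁.le, jostDeriv_eq_jostSolDeriv hq hk₂.le, id]
  ring

lemma exists_norm_jostM_sub_one_le (hq : InL11 q) {ε : ℝ} (hε : 0 < ε) :
    ∃ X : ℝ, 0 ≤ X ∧ ∀ k : ℂ, 0 ≤ k.im → ∀ x, X ≤ x → ‖jostM q k x - 1‖ ≤ ε := by
  have h : Tendsto (fun x => tail₂ q x * jostBound q) atTop (𝓝 0) := by
    simpa using (tendsto_tail₂ hq).mul_const (jostBound q)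
  obtain ⟨X, hX⟩ := eventually_atTop.1 ((eventually_ge_atTop 0).and (h.eventually_le_const hε))
  exact ⟨X, (hX X le_rfl).1, fun k hk x hx =>
    (norm_jostM_sub_one_le hq hk (hX x hx).1).trans (hX x hx).2⟩

lemma half_le_re_mul_of_norm_sub_one_le {a b : ℂ} (ha : ‖a - 1‖ ≤ 1 / 8) (hb : ‖b - 1‖ ≤ 1 / 8) :
    1 / 2 ≤ (a * b).re := by
  have hsub : ‖a * b - 1‖ ≤ 1 / 2 :=
    calc ‖a * b - 1‖ = ‖(a - 1) * (b - 1) + (a - 1) + (b - 1)‖ := by congr 1; ring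
      _ ≤ ‖a - 1‖ * ‖b - 1‖ + ‖a - 1‖ + ‖b - 1‖ :=
        norm_add₃_le.trans (by rw [norm_mul])
      _ ≤ 1 / 8 * (1 / 8) + 1 / 8 + 1 / 8 := by gcongr
      _ ≤ 1 / 2 := by norm_num
  have hre := (abs_le.1 ((Complex.abs_re_le_norm _).trans hsub)).1
  rw [Complex.sub_re, Complex.one_re] at hre
  linarith

/-- If `k₁ + k₂ = iσ`, the exponentials in `f(t, k₁) f(t, k₂)` combine to the positive function
`e^{-σt}`. -/
lemma exp_div_le_re_integral_jostSol_mul_jostSol (hq : InL11 q) (hk₁ : 0 < k₁.im)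
    (hk₂ : 0 < k₂.im) {σ X : ℝ} (hσ : k₁ + k₂ = Complex.I * σ) (hX : 0 ≤ X)
    (h₁ : ∀ t, X ≤ t → ‖jostM q k₁ t - 1‖ ≤ 1 / 8)
    (h₂ : ∀ t, X ≤ t → ‖jostM q k₂ t - 1‖ ≤ 1 / 8) :
    Real.exp (-(σ * X)) / (2 * σ) ≤ (∫ t in Ioi X, jostSol q k₁ t * jostSol q k₂ t).re := by
  have hσ0 : 0 < σ := by
    have him := congrArg Complex.im hσ
    rw [Complex.add_im, Complex.I_mul_im, Complex.ofReal_re] at him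
    linarith
  have hint := (integrableOn_jostSol_mul_jostSol hq hk₁ hk₂).mono_set (Ioi_subset_Ioi hX)
  have hexp : IntegrableOn (fun t => Real.exp (-σ * t)) (Ioi X) :=
    integrableOn_exp_mul_Ioi (neg_lt_zero.2 hσ0) X
  have hmono : ∀ t ∈ Ioi X, 1 / 2 * Real.exp (-σ * t) ≤ (jostSol q k₁ t * jostSol q k₂ t).re := by
    intro t ht
    have hprod : jostSol q k₁ t * jostSol q k₂ t =
        (Real.exp (-σ * t) : ℂ) * (jostM q k₁ t * jostM q k₂ t) := by
      have hexponent : Complex.I * k₁ * t + Complex.I * k₂ * t = ((-σ * t : ℝ) : ℂ) := by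
        push_cast
        linear_combination Complex.I * t * hσ + σ * t * Complex.I_sq
      rw [Complex.ofReal_exp, ← hexponent, Complex.exp_add, jostSol, jostSol]
      ring
    rw [hprod, Complex.re_ofReal_mul, mul_comm]
    gcongr
    exact half_le_re_mul_of_norm_sub_one_le (h₁ t (le_of_lt ht)) (h₂ t (le_of_lt ht))
  calc Real.exp (-(σ * X)) / (2 * σ) = ∫ t in Ioi X, 1 / 2 * Real.exp (-σ * t) := by
        rw [integral_const_mul, integral_exp_mul_Ioi (neg_lt_zero.2 hσ0), neg_mul]
        field_simp
    _ ≤ ∫ t in Ioi X, (jostSol q k₁ t * jostSol q k₂ t).re :=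
      setIntegral_mono_on (hexp.const_mul _) hint.re measurableSet_Ioi hmono
    _ = (∫ t in Ioi X, jostSol q k₁ t * jostSol q k₂ t).re := integral_re hint

lemma exp_div_le_norm_integral_jostSol_mul_jostSol_neg_conj (hq : InL11 q) (hk : 0 < k.im) {X : ℝ}
    (hX0 : 0 ≤ X) (hX : ∀ k : ℂ, 0 ≤ k.im → ∀ x, X ≤ x → ‖jostM q k x - 1‖ ≤ 1 / 8) :
    Real.exp (-(2 * k.im * X)) / (4 * k.im) ≤
      ‖∫ t in Ioi 0, jostSol q k t * jostSol q (-starRingEnd ℂ k) t‖ := by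
  have hk' : 0 < (-starRingEnd ℂ k).im := by simpa using hk
  have hadd : k + -starRingEnd ℂ k = Complex.I * ((2 * k.im : ℝ) : ℂ) := by
    rw [← sub_eq_add_neg, Complex.sub_conj, mul_comm]
  have hint := integrableOn_jostSol_mul_jostSol hq hk hk'
  have hnonneg : ∀ t ∈ Ioi (0 : ℝ), 0 ≤ (jostSol q k t * jostSol q (-starRingEnd ℂ k) t).re :=
    fun t ht => by
      rw [jostSol_neg_conj hq hk.le (le_of_lt ht), Complex.mul_conj, Complex.ofReal_re]
      exact Complex.normSq_nonneg _
  calc Real.exp (-(2 * k.im * X)) / (4 * k.im)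
      = Real.exp (-(2 * k.im * X)) / (2 * (2 * k.im)) := by ring
    _ ≤ (∫ t in Ioi X, jostSol q k t * jostSol q (-starRingEnd ℂ k) t).re :=
      exp_div_le_re_integral_jostSol_mul_jostSol hq hk hk' hadd hX0 (hX k hk.le) (hX _ hk'.le)
    _ = ∫ t in Ioi X, (jostSol q k t * jostSol q (-starRingEnd ℂ k) t).re :=
      (integral_re (hint.mono_set (Ioi_subset_Ioi hX0))).symm
    _ ≤ ∫ t in Ioi 0, (jostSol q k t * jostSol q (-starRingEnd ℂ k) t).re :=
      setIntegral_mono_set hint.re (ae_restrict_of_forall_mem measurableSet_Ioi hnonneg)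
        (Ioi_subset_Ioi hX0).eventuallyLE
    _ = (∫ t in Ioi 0, jostSol q k t * jostSol q (-starRingEnd ℂ k) t).re := integral_re hint
    _ ≤ _ := Complex.re_le_norm _

/-- For `Im k > 0` this follows from the Wronskian of `f(·, k)` and its complex conjugate
`f(·, -k̄)`, whose integral term is `∫ |f(t, k)|² dt`. -/
lemma exists_mul_exp_le_norm_jostDeriv_mul_norm_jostFunction (hq : InL11 q) :
    ∃ X : ℝ, 0 ≤ X ∧ ∀ k : ℂ, 0 ≤ k.im →
      |k.re| / 2 * Real.exp (-(2 * k.im * X)) ≤ ‖jostDeriv q k‖ * ‖jostFunction q k‖ := by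
  obtain ⟨X, hX0, hX⟩ := exists_norm_jostM_sub_one_le hq (by norm_num : (0 : ℝ) < 1 / 8)
  refine ⟨X, hX0, fun k hk => ?_⟩
  rcases hk.eq_or_lt with hk0 | hkpos
  · lift k to ℝ using hk0.symm
    have hle := Complex.abs_im_le_norm (jostDeriv q k * starRingEnd ℂ (jostFunction q k))
    rw [im_jostDeriv_mul_conj_of_real hq, norm_mul, RCLike.norm_conj] at hle
    simp only [Complex.ofReal_re, Complex.ofReal_im, mul_zero, zero_mul, neg_zero, Real.exp_zero]
    linarith [abs_nonneg k]
  · have hk' : 0 < (-starRingEnd ℂ k).im := by simpa using hkpos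
    have hW := jostDeriv_mul_jostFunction_sub hq hkpos hk'
    rw [jostFunction_neg_conj hq hk, jostDeriv_neg_conj hq hk] at hW
    have hnorm : ‖k ^ 2 - (-starRingEnd ℂ k) ^ 2‖ = 4 * |k.re| * k.im := by
      have hfac : k ^ 2 - (-starRingEnd ℂ k) ^ 2 = ((4 * k.re * k.im : ℝ) : ℂ) * Complex.I := by
        rw [neg_sq, sq_sub_sq, Complex.add_conj, Complex.sub_conj]
        push_cast
        ring
      rw [hfac, norm_mul, Complex.norm_I, mul_one, Complex.norm_real, Real.norm_eq_abs, abs_mul,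
        abs_mul, abs_of_pos hkpos, abs_of_pos (by norm_num : (0 : ℝ) < 4)]
    have hle := norm_sub_le (jostDeriv q k * starRingEnd ℂ (jostFunction q k))
      (jostFunction q k * starRingEnd ℂ (jostDeriv q k))
    rw [hW, norm_mul, norm_mul, norm_mul, RCLike.norm_conj, RCLike.norm_conj, hnorm] at hle
    have hint : |k.re| * Real.exp (-(2 * k.im * X)) ≤ 4 * |k.re| * k.im *
        ‖∫ t in Ioi 0, jostSol q k t * jostSol q (-starRingEnd ℂ k) t‖ :=
      calc |k.re| * Real.exp (-(2 * k.im * X))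
          = 4 * |k.re| * k.im * (Real.exp (-(2 * k.im * X)) / (4 * k.im)) := by field_simp
        _ ≤ _ := by
          gcongr
          exact exp_div_le_norm_integral_jostSol_mul_jostSol_neg_conj hq hkpos hX0 hX
    linarith

lemma exists_mul_abs_re_le_norm_jostFunction (hq : InL11 q) (R : ℝ) :
    ∃ c : ℝ, 0 < c ∧ ∀ k : ℂ, 0 ≤ k.im → ‖k‖ ≤ R → c * |k.re| ≤ ‖jostFunction q k‖ := by
  obtain ⟨X, hX0, hX⟩ := exists_mul_exp_le_norm_jostDeriv_mul_norm_jostFunction hq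
  have hB := jostBound_pos q
  have hσ := tail_nonneg q 0
  set D := (|R| + tail q 0) * jostBound q + 1
  have : 0 < D := by positivity
  refine ⟨Real.exp (-(2 * |R| * X)) / (2 * D), by positivity, fun k hk hkR => ?_⟩
  have hkR' : ‖k‖ ≤ |R| := hkR.trans (le_abs_self R)
  have him : k.im ≤ |R| := (le_abs_self _).trans ((Complex.abs_im_le_norm k).trans hkR')
  have hderiv : ‖jostDeriv q k‖ ≤ D :=
    calc ‖jostDeriv q k‖ ≤ (‖k‖ + tail q 0) * jostBound q := norm_jostDeriv_le hq hk
      _ ≤ (|R| + tail q 0) * jostBound q := by gcongr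
      _ ≤ D := le_add_of_nonneg_right zero_le_one
  have hmul : |k.re| / 2 * Real.exp (-(2 * |R| * X)) ≤ D * ‖jostFunction q k‖ :=
    calc |k.re| / 2 * Real.exp (-(2 * |R| * X)) ≤ |k.re| / 2 * Real.exp (-(2 * k.im * X)) := by
          gcongr
      _ ≤ ‖jostDeriv q k‖ * ‖jostFunction q k‖ := hX k hk
      _ ≤ D * ‖jostFunction q k‖ := by gcongr
  rw [div_mul_eq_mul_div, div_le_iff₀ (by positivity)]
  linarith

lemma jostFunction_ne_zero_of_re_ne_zero (hq : InL11 q) (hk : 0 ≤ k.im) (hre : k.re ≠ 0) :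
    jostFunction q k ≠ 0 := by
  obtain ⟨c, hc, hlow⟩ := exists_mul_abs_re_le_norm_jostFunction hq ‖k‖
  exact norm_pos_iff.1 ((mul_pos hc (abs_pos.2 hre)).trans_le (hlow k hk le_rfl))

lemma deriv_jostFunction_ne_zero (hq : InL11 q) (hk : 0 < k.im) (h : jostFunction q k = 0) :
    deriv (jostFunction q) k ≠ 0 := by
  obtain ⟨c, hc, hlow⟩ := exists_mul_abs_re_le_norm_jostFunction hq (‖k‖ + 1)
  have hre : k.re = 0 :=
    by_contra fun hre => jostFunction_ne_zero_of_re_ne_zero hq hk.le hre h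
  have hderiv : HasDerivAt (fun a : ℝ => jostFunction q (k + a)) (deriv (jostFunction q) k) 0 := by
    have hF : HasDerivAt (jostFunction q) (deriv (jostFunction q) k) (k + ((0 : ℝ) : ℂ)) := by
      rw [Complex.ofReal_zero, add_zero]
      exact ((differentiableOn_jostFunction hq).differentiableAt
        (isOpen_upperHalf.mem_nhds hk)).hasDerivAt
    exact (hF.comp_const_add k ((0 : ℝ) : ℂ)).comp_ofReal
  have hslope : c ≤ ‖deriv (jostFunction q) k‖ := by
    refine ge_of_tendsto hderiv.tendsto_slope_zero_right.norm ?_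
    filter_upwards [Ioo_mem_nhdsGT (zero_lt_one' ℝ)] with a ⟨ha0, ha1⟩
    have hbound := hlow (k + a) (by simpa using hk.le) (norm_add_le_of_le le_rfl
      (by rw [Complex.norm_real, Real.norm_of_nonneg ha0.le]; exact ha1.le))
    rw [Complex.add_re, hre, zero_add, Complex.ofReal_re, abs_of_pos ha0] at hbound
    rw [zero_add, Complex.ofReal_zero, add_zero, h, sub_zero, norm_smul, norm_inv,
      Real.norm_of_nonneg ha0.le, ← div_eq_inv_mul, le_div_iff₀ ha0]
    exact hbound
  exact norm_pos_iff.1 (hc.trans_le hslope)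

end LowerBound

section BoundStates

variable {q : ℝ → ℝ}

lemma eq_zero_of_norm_mul_sub_le {w : ℂ} {h : ℝ → ℂ} {C : ℝ} (hint : IntegrableOn h (Ioi 0))
    (hC : ∀ x, 0 ≤ x → ‖w * x - h x‖ ≤ C) : w = 0 := by
  by_contra hw
  have hw0 : 0 < ‖w‖ := norm_pos_iff.2 hw
  set X := max 0 ((C + 1) / ‖w‖)
  have hconst : IntegrableOn (fun _ : ℝ => (1 : ℝ)) (Ioi X) := by
    refine (hint.mono_set (Ioi_subset_Ioi (le_max_left _ _))).norm.mono'
      aestronglyMeasurable_const ?_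
    filter_upwards [ae_restrict_mem measurableSet_Ioi] with x (hx : X < x)
    have hx0 : 0 ≤ x := (le_max_left _ _).trans hx.le
    have hxC : C + 1 ≤ x * ‖w‖ := (div_le_iff₀ hw0).1 ((le_max_right _ _).trans hx.le)
    have hsub := norm_sub_norm_le (w * x) (h x)
    rw [norm_mul, Complex.norm_real, Real.norm_of_nonneg hx0] at hsub
    rw [norm_one]
    linarith [hC x hx0]
  simp [integrableOn_const_iff] at hconst

lemma IsSolution.wronskian_eq_zero_of_memLp {E : ℂ} {u v f g : ℝ → ℂ} (h₁ : IsSolution q E u v)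
    (h₂ : IsSolution q E f g) (hq : LocallyIntegrableOn q (Ici 0))
    (hu : MemLp u 2 (volume.restrict (Ioi (0 : ℝ))))
    (hf : MemLp f 2 (volume.restrict (Ioi (0 : ℝ))))
    (hg : MemLp g 2 (volume.restrict (Ioi (0 : ℝ)))) : v 0 * f 0 - u 0 * g 0 = 0 := by
  have huf : IntegrableOn (fun t => u t * f t) (Ioi 0) := hu.integrable_mul hf
  have hug : IntegrableOn (fun t => u t * g t) (Ioi 0) := hu.integrable_mul hg
  refine eq_zero_of_norm_mul_sub_le (h := fun t => u t * f t)
    (C := ‖u 0 * f 0‖ + 2 * ∫ t in Ioi 0, ‖u t * g t‖) huf fun x hx => ?_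
  have hparts := h₁.mul_sub_mul_eq_wronskian_add_integral h₂ hq le_rfl hx
  have hle : ‖∫ t in (0 : ℝ)..x, u t * g t‖ ≤ ∫ t in Ioi 0, ‖u t * g t‖ := by
    refine (intervalIntegral.norm_integral_le_integral_norm hx).trans ?_
    rw [intervalIntegral.integral_of_le hx]
    exact setIntegral_mono_set hug.norm (ae_of_all _ fun _ => norm_nonneg _)
      Ioc_subset_Ioi_self.eventuallyLE
  calc ‖(v 0 * f 0 - u 0 * g 0) * x - u x * f x‖
      = ‖-(u 0 * f 0) - 2 * ∫ t in (0 : ℝ)..x, u t * g t‖ := by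
        congr 1
        rw [Complex.ofReal_zero, sub_zero] at hparts
        linear_combination -hparts
    _ ≤ ‖u 0 * f 0‖ + 2 * ‖∫ t in (0 : ℝ)..x, u t * g t‖ := by
        refine (norm_sub_le _ _).trans_eq ?_
        rw [norm_neg, norm_mul (2 : ℂ), Complex.norm_two]
    _ ≤ ‖u 0 * f 0‖ + 2 * ∫ t in Ioi 0, ‖u t * g t‖ := by gcongr

lemma ofReal_neg_sq (κ : ℝ) : ((-κ ^ 2 : ℝ) : ℂ) = (Complex.I * κ) ^ 2 := by
  rw [mul_pow, Complex.I_sq, neg_one_mul, Complex.ofReal_neg, Complex.ofReal_pow]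

lemma isDirichletEigenvalue_iff (hq : InL11 q) {κ : ℝ} (hκ : 0 < κ) :
    IsDirichletEigenvalue q (-κ ^ 2) ↔ jostFunction q (Complex.I * κ) = 0 := by
  have hk : 0 < (Complex.I * (κ : ℂ)).im := by simpa using hκ
  have hJ := isJostSolution_jostSol hq hk.le
  rw [IsDirichletEigenvalue, ofReal_neg_sq, jostFunction_eq_jostSol hq hk.le]
  constructor
  · rintro ⟨u, v, hS, hu0, huL, x, hx, hux⟩
    by_contra hf
    have hW := hS.wronskian_eq_zero_of_memLp hJ.isSolution hq.locallyIntegrableOn huL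
      (memLp_two_jostSol hq hk) (memLp_two_jostSolDeriv hq hk)
    rw [hu0, zero_mul, sub_zero] at hW
    have hv0 : v 0 = 0 := (mul_eq_zero.1 hW).resolve_right hf
    exact hux (hS.eq_zero_of_initial hq.locallyIntegrableOn hu0 hv0 hx.le).1
  · intro hf
    obtain ⟨x, hm, hx⟩ := (((tendsto_jostM hq hk.le).eventually_ne one_ne_zero).and
      (eventually_gt_atTop 0)).exists
    exact ⟨_, _, hJ.isSolution, hf, memLp_two_jostSol hq hk, x, hx,
      mul_ne_zero (Complex.exp_ne_zero _) hm⟩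

lemma mem_boundStates_iff (hq : InL11 q) {κ : ℝ} :
    κ ∈ boundStates q ↔ 0 < κ ∧ jostFunction q (Complex.I * κ) = 0 :=
  and_congr_right fun hκ => isDirichletEigenvalue_iff hq hκ

lemma integral_jostSol_mul_jostSol_eq_zero (hq : InL11 q) {κ₁ κ₂ : ℝ} (h₁ : κ₁ ∈ boundStates q)
    (h₂ : κ₂ ∈ boundStates q) (hne : κ₁ ≠ κ₂) :
    ∫ t in Ioi 0, jostSol q (Complex.I * κ₁) t * jostSol q (Complex.I * κ₂) t = 0 := by
  obtain ⟨hκ₁, hf₁⟩ := (mem_boundStates_iff hq).1 h₁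
  obtain ⟨hκ₂, hf₂⟩ := (mem_boundStates_iff hq).1 h₂
  have hW := jostDeriv_mul_jostFunction_sub hq (k₁ := Complex.I * κ₁) (k₂ := Complex.I * κ₂)
    (by simpa using hκ₁) (by simpa using hκ₂)
  rw [hf₁, hf₂, mul_zero, zero_mul, sub_zero] at hW
  refine (mul_eq_zero.1 hW.symm).resolve_left fun hsq => hne ?_
  rw [← ofReal_neg_sq, ← ofReal_neg_sq, ← Complex.ofReal_sub, Complex.ofReal_eq_zero] at hsq
  exact (pow_left_inj₀ hκ₁.le hκ₂.le two_ne_zero).1 (by linarith)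

/-- The eigenfunctions of two bound states are orthogonal; on `[X, ∞)`, where both are close to
exponentials, their inner product is about `e^{-σX} / σ`, which `[0, X]` must compensate. -/
lemma exp_neg_mul_le_of_mem_boundStates (hq : InL11 q) {κ₁ κ₂ X : ℝ} (h₁ : κ₁ ∈ boundStates q)
    (h₂ : κ₂ ∈ boundStates q) (hne : κ₁ ≠ κ₂) (hX0 : 0 ≤ X)
    (hX : ∀ k : ℂ, 0 ≤ k.im → ∀ x, X ≤ x → ‖jostM q k x - 1‖ ≤ 1 / 8) :
    Real.exp (-((κ₁ + κ₂) * X)) ≤ 2 * (κ₁ + κ₂) * (jostBound q ^ 2 * X) := by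
  have hk₁ : 0 < (Complex.I * (κ₁ : ℂ)).im := by simpa using h₁.1
  have hk₂ : 0 < (Complex.I * (κ₂ : ℂ)).im := by simpa using h₂.1
  have hint := integrableOn_jostSol_mul_jostSol hq hk₁ hk₂
  have hbound : ∀ {k : ℂ}, 0 < k.im → ∀ t, 0 ≤ t → ‖jostSol q k t‖ ≤ jostBound q :=
    fun hk t ht => (norm_jostSol_le hq hk.le ht).trans (mul_le_of_le_one_right (jostBound_pos q).le
      (Real.exp_le_one_iff.2 (neg_nonpos.2 (mul_nonneg hk.le ht))))
  have hnear : ‖∫ t in (0 : ℝ)..X, jostSol q (Complex.I * κ₁) t * jostSol q (Complex.I * κ₂) t‖ ≤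
      jostBound q ^ 2 * X := by
    refine (intervalIntegral.norm_integral_le_of_norm_le_const fun t ht => ?_).trans_eq
      (by rw [sub_zero, abs_of_nonneg hX0])
    have ht0 : 0 ≤ t := (uIoc_of_le hX0 ▸ ht).1.le
    rw [norm_mul, pow_two]
    exact mul_le_mul (hbound hk₁ t ht0) (hbound hk₂ t ht0) (norm_nonneg _) (jostBound_pos q).le
  have hfar := exp_div_le_re_integral_jostSol_mul_jostSol hq hk₁ hk₂ (σ := κ₁ + κ₂)
    (by push_cast; ring) hX0 (hX _ hk₁.le) (hX _ hk₂.le)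
  rw [integral_Ioi_eq_sub hint hX0, integral_jostSol_mul_jostSol_eq_zero hq h₁ h₂ hne,
    zero_sub] at hfar
  have hle := hfar.trans ((Complex.re_le_norm _).trans ((norm_neg _).trans_le hnear))
  rw [div_le_iff₀ (by linarith [h₁.1, h₂.1])] at hle
  exact hle.trans_eq (mul_comm _ _)

lemma exists_boundStates_separation (hq : InL11 q) :
    ∃ δ : ℝ, 0 < δ ∧ ∀ κ₁ ∈ boundStates q, ∀ κ₂ ∈ boundStates q, κ₁ < δ → κ₂ < δ → κ₁ = κ₂ := by
  obtain ⟨X, hX0, hX⟩ := exists_norm_jostM_sub_one_le hq (by norm_num : (0 : ℝ) < 1 / 8)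
  have hev : ∀ᶠ σ in 𝓝 (0 : ℝ), 2 * σ * (jostBound q ^ 2 * X) < Real.exp (-(σ * X)) :=
    ContinuousAt.eventually_lt (by fun_prop) (by fun_prop) (by simp)
  obtain ⟨ε, hε, hlt⟩ := Metric.eventually_nhds_iff.1 hev
  refine ⟨ε / 2, half_pos hε, fun κ₁ h₁ κ₂ h₂ hκ₁ hκ₂ => by_contra fun hne => ?_⟩
  refine (exp_neg_mul_le_of_mem_boundStates hq h₁ h₂ hne hX0 hX).not_gt (hlt ?_)
  rw [Real.dist_eq, sub_zero, abs_of_pos (add_pos h₁.1 h₂.1)]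
  linarith

lemma boundStates_subset_Iic (hq : InL11 q) : boundStates q ⊆ Iic (tail q 0 * jostBound q) := by
  intro κ hκ
  obtain ⟨hκ0, hf⟩ := (mem_boundStates_iff hq).1 hκ
  have hle := norm_mul_jostFunction_sub_one_le hq (k := Complex.I * κ) (by simpa using hκ0.le)
  simpa [hf, abs_of_pos hκ0] using hle

lemma eventually_jostFunction_ne_zero (hq : InL11 q) {k : ℂ} (hk : 0 < k.im) :
    ∀ᶠ z in 𝓝[≠] k, jostFunction q z ≠ 0 := by
  by_cases hf : jostFunction q k = 0
  · exact ((differentiableOn_jostFunction hq).differentiableAt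
      (isOpen_upperHalf.mem_nhds hk)).hasDerivAt.eventually_ne (deriv_jostFunction_ne_zero hq hk hf)
  · exact (((differentiableOn_jostFunction hq).differentiableAt
      (isOpen_upperHalf.mem_nhds hk)).continuousAt.eventually_ne hf).filter_mono inf_le_left

lemma finite_boundStates_inter_Icc (hq : InL11 q) {a b : ℝ} (ha : 0 < a) :
    (boundStates q ∩ Icc a b).Finite := by
  by_contra hinf
  obtain ⟨κ, hκ, hacc⟩ := (Set.not_finite.1 hinf).exists_accPt_of_subset_isCompact isCompact_Icc
    inter_subset_right
  have hκ0 : 0 < κ := ha.trans_le hκ.1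
  have htend : Tendsto (fun t : ℝ => Complex.I * (t : ℂ)) (𝓝[≠] κ) (𝓝[≠] (Complex.I * κ)) :=
    tendsto_nhdsWithin_of_tendsto_nhds_of_eventually_within _
      (Continuous.tendsto' (by fun_prop) _ _ rfl |>.mono_left inf_le_left)
      (eventually_mem_nhdsWithin.mono fun t ht => by simpa using ht)
  refine accPt_iff_frequently_nhdsNE.1 hacc ((htend.eventually
    (eventually_jostFunction_ne_zero hq (by simpa using hκ0))).mono fun t ht hmem => ht ?_)
  exact ((mem_boundStates_iff hq).1 hmem.1).2

lemma finite_boundStates (hq : InL11 q) : (boundStates q).Finite := by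
  obtain ⟨δ, hδ0, hδ⟩ := exists_boundStates_separation hq
  have hsmall : (boundStates q ∩ Iio δ).Subsingleton := fun κ₁ h₁ κ₂ h₂ =>
    hδ κ₁ h₁.1 κ₂ h₂.1 h₁.2 h₂.2
  have hlarge := finite_boundStates_inter_Icc hq (b := tail q 0 * jostBound q) hδ0
  refine (hsmall.finite.union hlarge).subset fun κ hκ => ?_
  rcases lt_or_ge κ δ with hlt | hge
  · exact Or.inl ⟨hκ, hlt⟩
  · exact Or.inr ⟨hκ, hge, boundStates_subset_Iic hq hκ⟩

end BoundStates

section DecayAtInfinity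

open Asymptotics Bornology

/-- The neighbourhoods of `∞` in `S`, as a filter. Decay conditions in a half-plane are stated as
`=O[atInfty S]` relations. -/
noncomputable def atInfty (S : Set ℂ) : Filter ℂ := cobounded ℂ ⊓ 𝓟 S

variable {S : Set ℂ}

lemma eventually_atInfty {p : ℂ → Prop} :
    (∀ᶠ z in atInfty S, p z) ↔ ∃ R : ℝ, ∀ z ∈ S, R ≤ ‖z‖ → p z := by
  rw [atInfty, eventually_inf_principal, hasBasis_cobounded_norm.eventually_iff]
  simp only [true_and]
  exact exists_congr fun R => forall_congr' fun z => Imp.swap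

lemma mem_atInfty_self : S ∈ atInfty S := mem_inf_of_right (mem_principal_self S)

lemma tendsto_inv_atInfty : Tendsto (fun z : ℂ => z⁻¹) (atInfty S) (𝓝 0) :=
  tendsto_inv₀_cobounded.mono_left inf_le_left

lemma isBigO_inv_add_const (a : ℂ) :
    (fun z => (z + a)⁻¹) =O[cobounded ℂ] fun z : ℂ => z⁻¹ := by
  refine IsBigO.inv_rev (.of_bound 2 ?_) ?_
  · filter_upwards [eventually_cobounded_le_norm (2 * ‖a‖)] with z hz
    have hsub := norm_sub_le (z + a) a
    rw [add_sub_cancel_right] at hsub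
    linarith
  · filter_upwards [eventually_cobounded_le_norm 1] with z hz hz0
    rw [hz0, norm_zero] at hz
    linarith

lemma isBigO_inv_sub_const (a : ℂ) :
    (fun z => (z - a)⁻¹) =O[cobounded ℂ] fun z : ℂ => z⁻¹ := by
  simpa only [sub_eq_add_neg] using isBigO_inv_add_const (-a)

lemma tendsto_ofReal_cocompact_atInfty :
    Tendsto (fun s : ℝ => (s : ℂ)) (cocompact ℝ) (atInfty {z | 0 ≤ z.im}) := by
  refine tendsto_inf.2 ⟨?_, tendsto_principal.2 (.of_forall fun s => (Complex.ofReal_im s).ge)⟩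
  rw [← Metric.cobounded_eq_cocompact, ← tendsto_norm_atTop_iff_cobounded]
  simpa only [Complex.norm_real] using tendsto_norm_cobounded_atTop

lemma integrable_of_continuous_of_isBigO {g : ℝ → ℂ} (hg : Continuous g)
    (hO : g =O[cocompact ℝ] fun s => (s : ℂ)⁻¹ * (s : ℂ)⁻¹) : Integrable g := by
  refine hg.locallyIntegrable.integrable_of_isBigO_cocompact
    (g := fun s => (1 + s ^ 2)⁻¹) (hO.trans (.of_bound 2 ?_))
    (integrable_inv_one_add_sq.integrableAtFilter _)
  rw [← Metric.cobounded_eq_cocompact]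
  filter_upwards [eventually_cobounded_le_norm 1] with s hs
  have hs2 : 1 ≤ s ^ 2 := one_le_sq_iff_one_le_abs s |>.2 hs
  rw [← mul_inv, norm_inv, norm_mul, Complex.norm_real, ← pow_two, Real.norm_eq_abs, sq_abs,
    Real.norm_of_nonneg (by positivity), ← div_eq_mul_inv,
    inv_le_comm₀ (by positivity) (by positivity), inv_div, div_le_iff₀ two_pos]
  linarith

end DecayAtInfinity

section CauchyIntegral

open Asymptotics Bornology

lemma ofReal_sub_ne_zero {z : ℂ} (hz : z.im ≠ 0) (s : ℝ) : (s : ℂ) - z ≠ 0 :=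
  fun h => hz (by simpa using congrArg Complex.im h)

lemma integrable_div_sub {g : ℝ → ℂ} (hg : Continuous g)
    (hO : g =O[cocompact ℝ] fun s => (s : ℂ)⁻¹) {z : ℂ} (hz : z.im ≠ 0) :
    Integrable fun s : ℝ => g s / ((s : ℂ) - z) := by
  refine integrable_of_continuous_of_isBigO
    (hg.div (by fun_prop) (ofReal_sub_ne_zero hz)) (hO.mul ?_)
  exact ((isBigO_inv_sub_const z).mono inf_le_left).comp_tendsto tendsto_ofReal_cocompact_atInfty

lemma continuous_comp_ofReal {G : ℂ → ℂ} (hG : ContinuousOn G {z | 0 ≤ z.im}) :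
    Continuous fun s : ℝ => G s :=
  hG.comp_continuous Complex.continuous_ofReal fun s => (Complex.ofReal_im s).ge

lemma norm_intervalIntegral_ofReal_le {G : ℂ → ℂ} (hG : DifferentiableOn ℂ G {z | 0 ≤ z.im})
    {T B : ℝ} (hT : 0 ≤ T) (hB : ∀ z : ℂ, 0 ≤ z.im → T ≤ ‖z‖ → ‖G z‖ ≤ B) :
    ‖∫ s in (-T)..T, G s‖ ≤ 4 * B * T := by
  have hrect := Complex.integral_boundary_rect_eq_zero_of_differentiableOn G (-T : ℝ)
    (T + T * Complex.I) (hG.mono fun z hz => by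
      have him := hz.2
      simp only [Complex.ofReal_im, Complex.add_im, Complex.mul_im, Complex.I_im, Complex.I_re,
        Complex.ofReal_re, mem_preimage, mul_one, mul_zero, add_zero, zero_add,
        uIcc_of_le hT] at him
      exact him.1)
  simp only [Complex.ofReal_im, Complex.ofReal_re, Complex.add_im, Complex.add_re, Complex.mul_im,
    Complex.mul_re, Complex.I_im, Complex.I_re, mul_one, mul_zero, add_zero, zero_add,
    Complex.ofReal_zero, zero_mul, sub_self] at hrect
  have htop : ‖∫ x in (-T)..T, G (x + T * Complex.I)‖ ≤ B * (2 * T) := by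
    refine (intervalIntegral.norm_integral_le_of_norm_le_const fun x _ => hB _ ?_ ?_).trans_eq
      (by rw [abs_of_nonneg (by linarith)]; ring)
    · simpa using hT
    · simpa [abs_of_nonneg hT] using Complex.abs_im_le_norm ((x : ℂ) + T * Complex.I)
  have hside : ∀ a : ℝ, |a| = T → ‖∫ y in (0 : ℝ)..T, G (a + y * Complex.I)‖ ≤ B * T := by
    intro a ha
    refine (intervalIntegral.norm_integral_le_of_norm_le_const fun y hy => hB _ ?_ ?_).trans_eq
      (by rw [sub_zero, abs_of_nonneg hT])
    · simpa using (uIoc_of_le hT ▸ hy).1.le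
    · simpa [ha] using Complex.abs_re_le_norm ((a : ℂ) + y * Complex.I)
  calc ‖∫ s in (-T)..T, G s‖
      = ‖(∫ x in (-T)..T, G (x + T * Complex.I)) -
          Complex.I • (∫ y in (0 : ℝ)..T, G (T + y * Complex.I)) +
          Complex.I • ∫ y in (0 : ℝ)..T, G ((-T : ℝ) + y * Complex.I)‖ := by
        congr 1
        linear_combination hrect
    _ ≤ B * (2 * T) + B * T + B * T := by
        refine (norm_add_le _ _).trans (add_le_add ((norm_sub_le _ _).trans
          (add_le_add htop ?_)) ?_)
        · simpa [norm_smul] using hside T (abs_of_nonneg hT)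
        · simpa [norm_smul] using hside (-T) (by rw [abs_neg, abs_of_nonneg hT])
    _ = 4 * B * T := by ring

lemma integral_ofReal_eq_zero {G : ℂ → ℂ} (hG : DifferentiableOn ℂ G {z | 0 ≤ z.im})
    (hO : G =O[atInfty {z | 0 ≤ z.im}] fun z => z⁻¹ * z⁻¹) : ∫ s : ℝ, G s = 0 := by
  have hint : Integrable fun s : ℝ => G s := integrable_of_continuous_of_isBigO
    (continuous_comp_ofReal hG.continuousOn) (hO.comp_tendsto tendsto_ofReal_cocompact_atInfty)
  refine tendsto_nhds_unique
    (intervalIntegral_tendsto_integral hint tendsto_neg_atTop_atBot tendsto_id) ?_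
  obtain ⟨C, hC0, hC⟩ := hO.exists_nonneg
  obtain ⟨R, hR⟩ := eventually_atInfty.1 hC.bound
  have hlim : Tendsto (fun T : ℝ => 4 * C * T⁻¹) atTop (𝓝 0) := by
    simpa using tendsto_inv_atTop_zero.const_mul (4 * C)
  refine squeeze_zero_norm' ?_ hlim
  filter_upwards [eventually_ge_atTop R, eventually_gt_atTop 0] with T hTR hT0
  refine (norm_intervalIntegral_ofReal_le hG (B := C * (T⁻¹ * T⁻¹)) hT0.le
    fun z hz hTz => ?_).trans_eq (by field_simp)
  refine (hR z hz (hTR.trans hTz)).trans ?_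
  rw [norm_mul, norm_inv]
  gcongr

lemma integral_div_sub_of_im_neg {h : ℂ → ℂ} (hh : DifferentiableOn ℂ h {z | 0 ≤ z.im})
    (hO : h =O[atInfty {z | 0 ≤ z.im}] fun z => z⁻¹) {z : ℂ} (hz : z.im < 0) :
    ∫ s : ℝ, h s / ((s : ℂ) - z) = 0 := by
  refine integral_ofReal_eq_zero (G := fun w => h w / (w - z)) (hh.div (by fun_prop) ?_)
    (hO.mul ((isBigO_inv_sub_const z).mono inf_le_left))
  rintro w hw h0
  rw [sub_eq_zero.1 h0] at hw
  exact hz.not_ge hw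

lemma integral_div_sub_of_eq_zero {h : ℂ → ℂ} (hh : DifferentiableOn ℂ h {z | 0 ≤ z.im})
    (hO : h =O[atInfty {z | 0 ≤ z.im}] fun z => z⁻¹) {z : ℂ} (hz : 0 < z.im) (h0 : h z = 0) :
    ∫ s : ℝ, h s / ((s : ℂ) - z) = 0 := by
  have hslope : ∀ w, w ≠ z → dslope h z w = h w * (w - z)⁻¹ := fun w hw => by
    rw [dslope_of_ne _ hw, slope_def_field, h0, sub_zero, div_eq_mul_inv]
  have hnhds : {w : ℂ | 0 ≤ w.im} ∈ 𝓝 z :=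
    mem_of_superset (isOpen_upperHalf.mem_nhds hz) fun w (hw : 0 < w.im) => hw.le
  have hev : ∀ᶠ w in atInfty {w : ℂ | 0 ≤ w.im}, w ≠ z :=
    ((eventually_cobounded_le_norm (‖z‖ + 1)).mono fun w hw hwz => by
      rw [hwz] at hw; linarith).filter_mono inf_le_left
  have hzero := integral_ofReal_eq_zero ((Complex.differentiableOn_dslope hnhds).2 hh)
    ((hO.mul ((isBigO_inv_sub_const z).mono inf_le_left)).congr'
      (hev.mono fun w hw => (hslope w hw).symm) .rfl)
  rw [← hzero]
  exact integral_congr_ae (.of_forall fun s =>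
    ((hslope s (sub_ne_zero.1 (ofReal_sub_ne_zero hz.ne' s))).trans (div_eq_mul_inv _ _).symm).symm)

lemma sub_mul_sub_conj (s : ℝ) (z : ℂ) :
    ((s : ℂ) - z) * (s - starRingEnd ℂ z) = (((s - z.re) ^ 2 + z.im ^ 2 : ℝ) : ℂ) := by
  have hconj : (s : ℂ) - starRingEnd ℂ z = starRingEnd ℂ ((s : ℂ) - z) := by simp
  rw [hconj, Complex.mul_conj, Complex.normSq_apply]
  simp only [Complex.sub_re, Complex.sub_im, Complex.ofReal_re, Complex.ofReal_im]
  congr 1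
  ring

lemma integral_poissonKernel {y : ℝ} (hy : 0 < y) (x : ℝ) :
    ∫ s : ℝ, y / ((s - x) ^ 2 + y ^ 2) = Real.pi := by
  have hscale : ∀ s : ℝ, y / ((s - x) ^ 2 + y ^ 2) = y⁻¹ * (1 + ((s - x) / y) ^ 2)⁻¹ := fun s => by
    have : (s - x) ^ 2 + y ^ 2 ≠ 0 := by positivity
    field_simp
    ring
  simp_rw [hscale]
  rw [integral_const_mul, integral_sub_right_eq_self (fun s : ℝ => (1 + (s / y) ^ 2)⁻¹) x,
    Measure.integral_comp_div (fun s : ℝ => (1 + s ^ 2)⁻¹), integral_univ_inv_one_add_sq,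
    abs_of_pos hy, smul_eq_mul, inv_mul_cancel_left₀ hy.ne']

lemma integral_sub_conj_div {z : ℂ} (hz : 0 < z.im) :
    ∫ s : ℝ, (z - starRingEnd ℂ z) / ((s - starRingEnd ℂ z) * (s - z)) =
      2 * Real.pi * Complex.I := by
  have hkernel : ∀ s : ℝ, (z - starRingEnd ℂ z) / ((s - starRingEnd ℂ z) * (s - z)) =
      2 * Complex.I * ((z.im / ((s - z.re) ^ 2 + z.im ^ 2) : ℝ) : ℂ) := fun s => by
    rw [mul_comm ((s : ℂ) - _), sub_mul_sub_conj, Complex.sub_conj]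
    push_cast
    ring
  simp_rw [hkernel]
  rw [integral_const_mul, integral_complex_ofReal, integral_poissonKernel hz]
  ring

/-- The function `h - h(z) (z - z̄) / (· - z̄)` vanishes at `z` and still decays, which reduces the
Cauchy formula to the Poisson kernel. -/
lemma integral_div_sub {h : ℂ → ℂ} (hh : DifferentiableOn ℂ h {z | 0 ≤ z.im})
    (hO : h =O[atInfty {z | 0 ≤ z.im}] fun z => z⁻¹) {z : ℂ} (hz : 0 < z.im) :
    ∫ s : ℝ, h s / ((s : ℂ) - z) = 2 * Real.pi * Complex.I * h z := by
  set z' := starRingEnd ℂ z with hz'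
  have him : z'.im < 0 := by rw [hz', Complex.conj_im]; linarith
  have hne : ∀ w : ℂ, 0 ≤ w.im → w - z' ≠ 0 := fun w hw h0 => by
    rw [sub_eq_zero.1 h0] at hw; linarith
  set p : ℂ → ℂ := fun w => h z * (z - z') * (w - z')⁻¹
  have hp : DifferentiableOn ℂ p {w | 0 ≤ w.im} :=
    (DifferentiableOn.inv (by fun_prop) hne).const_mul _
  have hpO : p =O[atInfty {w | 0 ≤ w.im}] fun w => w⁻¹ :=
    ((isBigO_inv_sub_const z').mono inf_le_left).const_mul_left _
  have hpz : h z - p z = 0 := by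
    change h z - h z * (z - z') * (z - z')⁻¹ = 0
    rw [mul_assoc, mul_inv_cancel₀ (hne z hz.le), mul_one, sub_self]
  have hint : ∀ {g : ℂ → ℂ}, DifferentiableOn ℂ g {w | 0 ≤ w.im} →
      g =O[atInfty {w | 0 ≤ w.im}] (fun w => w⁻¹) → Integrable fun s : ℝ => g s / ((s : ℂ) - z) :=
    fun hg hgO => integrable_div_sub (continuous_comp_ofReal hg.continuousOn)
      (hgO.comp_tendsto tendsto_ofReal_cocompact_atInfty) hz.ne'
  have hzero := integral_div_sub_of_eq_zero (hh.sub hp) (hO.sub hpO) hz hpz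
  simp_rw [Pi.sub_apply, sub_div] at hzero
  rw [integral_sub (hint hh hO) (hint hp hpO), sub_eq_zero] at hzero
  have hkernel : ∀ s : ℝ, p s / ((s : ℂ) - z) = h z * ((z - z') / ((s - z') * (s - z))) :=
    fun s => by
      rw [div_mul_eq_div_div, mul_div_assoc', mul_div_assoc']
      rfl
  rw [hzero, integral_congr_ae (.of_forall hkernel), integral_const_mul, integral_sub_conj_div hz]
  ring

lemma integral_conj_div_sub {h : ℂ → ℂ} (hh : DifferentiableOn ℂ h {z | 0 ≤ z.im})
    (hO : h =O[atInfty {z | 0 ≤ z.im}] fun z => z⁻¹) {z : ℂ} (hz : 0 < z.im) :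
    ∫ s : ℝ, starRingEnd ℂ (h s) / ((s : ℂ) - z) = 0 := by
  have hconj : ∀ s : ℝ, starRingEnd ℂ (h s) / ((s : ℂ) - z) =
      starRingEnd ℂ (h s / ((s : ℂ) - starRingEnd ℂ z)) := fun s => by simp
  simp_rw [hconj]
  rw [integral_conj, integral_div_sub_of_im_neg hh hO (by simpa using hz), map_zero]

lemma integral_two_re_div_sub {h : ℂ → ℂ} (hh : DifferentiableOn ℂ h {z | 0 ≤ z.im})
    (hO : h =O[atInfty {z | 0 ≤ z.im}] fun z => z⁻¹) {z : ℂ} (hz : 0 < z.im) :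
    ∫ s : ℝ, ((2 * (h s).re : ℝ) : ℂ) / ((s : ℂ) - z) = 2 * Real.pi * Complex.I * h z := by
  have hcont : Continuous fun s : ℝ => h s := continuous_comp_ofReal hh.continuousOn
  have hOreal : (fun s : ℝ => h s) =O[cocompact ℝ] fun s => (s : ℂ)⁻¹ :=
    hO.comp_tendsto tendsto_ofReal_cocompact_atInfty
  have hconj : Integrable fun s : ℝ => starRingEnd ℂ (h s) / ((s : ℂ) - z) :=
    integrable_div_sub (Complex.continuous_conj.comp hcont)
      ((IsBigO.of_norm_left (by simpa using hOreal.norm_left))) hz.ne'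
  have hsum : ∀ s : ℝ, ((2 * (h s).re : ℝ) : ℂ) / ((s : ℂ) - z) =
      h s / ((s : ℂ) - z) + starRingEnd ℂ (h s) / ((s : ℂ) - z) := fun s => by
    rw [← add_div, Complex.add_conj]
  simp_rw [hsum]
  rw [integral_add (integrable_div_sub hcont hOreal hz.ne') hconj, integral_div_sub hh hO hz,
    integral_conj_div_sub hh hO hz, add_zero]

end CauchyIntegral

section Logarithm

open Asymptotics Bornology

lemma convex_upperHalf : Convex ℝ upperHalf := convex_halfSpace_im_gt 0

lemma isSimplyConnected_upperHalf : IsSimplyConnected upperHalf := by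
  have : ContractibleSpace upperHalf :=
    convex_upperHalf.contractibleSpace ⟨Complex.I, by simp [upperHalf]⟩
  exact SimplyConnectedSpace.ofContractible upperHalf

lemma differentiableAt_of_eventuallyEq_exp {g h : ℂ → ℂ} {z : ℂ} (hh : ContinuousAt h z)
    (hg : DifferentiableAt ℂ g z) (he : ∀ᶠ w in 𝓝 z, Complex.exp (h w) = g w) :
    DifferentiableAt ℂ h z := by
  have hnear : ∀ᶠ w in 𝓝 z, ‖h w - h z‖ < Real.pi :=
    (hh.sub continuousAt_const).norm.eventually (gt_mem_nhds (by simp [Real.pi_pos]))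
  have hlog : h =ᶠ[𝓝 z] fun w => Complex.log (g w / g z) + h z := by
    filter_upwards [he, hnear] with w hw hwz
    have him := abs_lt.1 ((Complex.abs_im_le_norm _).trans_lt hwz)
    rw [← hw, ← he.self_of_nhds, ← Complex.exp_sub, Complex.log_exp him.1 him.2.le,
      sub_add_cancel]
  refine (((hg.div_const _).clog ?_).add_const _).congr_of_eventuallyEq hlog
  rw [div_self (he.self_of_nhds ▸ Complex.exp_ne_zero _)]
  exact Complex.one_mem_slitPlane

lemma exists_differentiableOn_log {U : Set ℂ} (hUo : IsOpen U) (hU : IsSimplyConnected U)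
    {g : ℂ → ℂ} (hg : DifferentiableOn ℂ g U) (hg0 : ∀ z ∈ U, g z ≠ 0) :
    ∃ h : ℂ → ℂ, DifferentiableOn ℂ h U ∧ ∀ z ∈ U, Complex.exp (h z) = g z := by
  obtain ⟨h, hc, he⟩ := Complex.exists_continuousOn_eqOn_exp_comp hU hUo hg.continuousOn
    (fun ⟨z, hz, h0⟩ => hg0 z hz h0)
  refine ⟨h, fun z hz => ?_, fun z hz => he hz⟩
  have hzU := hUo.mem_nhds hz
  exact (differentiableAt_of_eventuallyEq_exp (hc.continuousAt hzU) (hg.differentiableAt hzU)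
    (mem_of_superset hzU he)).differentiableWithinAt

/-- The inversion `z ↦ -z⁻¹` maps the set onto a convex half-disc. -/
lemma isPreconnected_upperHalf_inter_lt_norm {R : ℝ} (hR : 0 < R) :
    IsPreconnected {z ∈ upperHalf | R < ‖z‖} := by
  have himage : {z ∈ upperHalf | R < ‖z‖} =
      (fun z : ℂ => -z⁻¹) '' (upperHalf ∩ Metric.ball 0 R⁻¹) := by
    have hpos : ∀ {z : ℂ}, z ∈ upperHalf → 0 < ‖z‖ ∧ -z⁻¹ ∈ upperHalf := fun {z} hz => by
      have hz0 : z ≠ 0 := fun h => by simp [upperHalf, h] at hz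
      refine ⟨norm_pos_iff.2 hz0, ?_⟩
      have : 0 < z.im / Complex.normSq z := div_pos hz (Complex.normSq_pos.2 hz0)
      simpa [upperHalf, Complex.inv_im, neg_div] using this
    ext z
    constructor
    · rintro ⟨hz, hRz⟩
      refine ⟨-z⁻¹, ⟨(hpos hz).2, ?_⟩, by simp⟩
      simpa using inv_strictAnti₀ hR hRz
    · rintro ⟨z, ⟨hz, hzR⟩, rfl⟩
      refine ⟨(hpos hz).2, ?_⟩
      rw [mem_ball_zero_iff] at hzR
      simpa using (lt_inv_comm₀ (hpos hz).1 hR).1 hzR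
  rw [himage]
  refine (convex_upperHalf.inter (convex_ball 0 R⁻¹)).isPreconnected.image _ ?_
  refine (continuousOn_inv₀.mono fun z hz => ?_).neg
  rintro rfl
  simpa [upperHalf] using hz.1

lemma norm_log_le_of_norm_sub_one_le {u : ℂ} (hu : ‖u - 1‖ ≤ 1 / 2) :
    ‖Complex.log u‖ ≤ 3 / 2 * ‖u - 1‖ := by
  simpa using Complex.norm_log_one_add_half_le_self hu

lemma mem_slitPlane_of_norm_sub_one_le {u : ℂ} (hu : ‖u - 1‖ ≤ 1 / 2) :
    u ∈ Complex.slitPlane := by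
  have := Complex.mem_slitPlane_of_norm_lt_one (z := u - 1) (by linarith)
  rwa [add_sub_cancel] at this

lemma exists_log_isBigO_inv {g : ℂ → ℂ} (hg : DifferentiableOn ℂ g upperHalf)
    (hg0 : ∀ z ∈ upperHalf, g z ≠ 0)
    (hO : (fun z => g z - 1) =O[atInfty upperHalf] fun z => z⁻¹) :
    ∃ h : ℂ → ℂ, DifferentiableOn ℂ h upperHalf ∧ (∀ z ∈ upperHalf, Complex.exp (h z) = g z) ∧
      h =O[atInfty upperHalf] fun z => z⁻¹ := by
  obtain ⟨h, hd, he⟩ := exists_differentiableOn_log isOpen_upperHalf isSimplyConnected_upperHalf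
    hg hg0
  have hhalf : ∀ᶠ z in atInfty upperHalf, ‖g z - 1‖ ≤ 1 / 2 :=
    (hO.trans_tendsto tendsto_inv_atInfty).norm.eventually_le_const (by norm_num)
  obtain ⟨R, hR⟩ := eventually_atInfty.1 hhalf
  set S := {z ∈ upperHalf | max R 1 < ‖z‖}
  have hSU : S ⊆ upperHalf := sep_subset _ _
  have hgS : ∀ z ∈ S, ‖g z - 1‖ ≤ 1 / 2 := fun z hz =>
    hR z hz.1 ((le_max_left _ _).trans hz.2.le)
  set z₁ : ℂ := (max R 1 + 1 : ℝ) * Complex.I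
  have hz₁ : z₁ ∈ S := by
    have : (0 : ℝ) < max R 1 + 1 := by positivity
    refine ⟨by simpa [z₁, upperHalf] using this, ?_⟩
    rw [norm_mul, Complex.norm_real, Complex.norm_I, mul_one, Real.norm_of_nonneg this.le]
    exact lt_add_one _
  set a := h z₁ - Complex.log (g z₁)
  have hea : Complex.exp a = 1 := by
    rw [Complex.exp_sub, he _ hz₁.1, Complex.exp_log (hg0 _ hz₁.1), div_self (hg0 _ hz₁.1)]
  have hexp : ∀ z ∈ upperHalf, Complex.exp (h z - a) = g z := fun z hz => by
    rw [Complex.exp_sub, hea, div_one, he z hz]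
  have hlog : EqOn (fun z => h z - a) (fun z => Complex.log (g z)) S :=
    Complex.isCoveringMap_exp.eqOn_of_comp_eqOn
      (isPreconnected_upperHalf_inter_lt_norm (by positivity))
      ((hd.continuousOn.mono hSU).sub continuousOn_const)
      ((hg.continuousOn.mono hSU).clog fun z hz => mem_slitPlane_of_norm_sub_one_le (hgS z hz))
      (fun z hz => Subtype.ext ((hexp z hz.1).trans (Complex.exp_log (hg0 z hz.1)).symm))
      hz₁ (sub_sub_cancel _ _)
  refine ⟨fun z => h z - a, hd.sub_const _, hexp, IsBigO.trans (.of_bound (3 / 2) ?_) hO⟩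
  refine eventually_atInfty.2 ⟨max R 1 + 1, fun z hz hzR => ?_⟩
  have hzS : z ∈ S := ⟨hz, (lt_add_one _).trans_le hzR⟩
  have hlogz : h z - a = Complex.log (g z) := hlog hzS
  rw [hlogz]
  exact norm_log_le_of_norm_sub_one_le (hgS z hzS)

end Logarithm

section TameOuter

open Asymptotics

lemma integrable_abs_rpow_mul_inv_norm_sub {a : ℝ} (ha : -1 < a) (ha0 : a < 0) {z : ℂ}
    (hz : 0 < z.im) : Integrable fun s : ℝ => |s| ^ a * ‖(s : ℂ) - z‖⁻¹ := by
  have hloc : LocallyIntegrable fun s : ℝ => |s| ^ a * ‖(s : ℂ) - z‖⁻¹ := by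
    refine locallyIntegrable_of_norm_le_rpow (C := z.im⁻¹) (α := -a) (Module.finrank_self ℝ).ge
      (by rw [Module.finrank_self, Nat.cast_one]; linarith) (ae_of_all _ fun s => ?_)
      (by fun_prop)
    have him : z.im ≤ ‖(s : ℂ) - z‖ := by
      simpa [abs_of_pos hz] using Complex.abs_im_le_norm ((s : ℂ) - z)
    rw [Real.norm_of_nonneg (by positivity), neg_neg, Real.norm_eq_abs, mul_comm]
    gcongr
  have hinv : (fun s : ℝ => ‖(s : ℂ) - z‖⁻¹) =O[cocompact ℝ] fun s => |s|⁻¹ := by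
    simpa only [Function.comp_def, norm_inv, Complex.norm_real, Real.norm_eq_abs] using
      (((isBigO_inv_sub_const z).mono inf_le_left).comp_tendsto
        tendsto_ofReal_cocompact_atInfty).norm_norm
  have hpow : (fun s : ℝ => |s| ^ a * |s|⁻¹) =O[cocompact ℝ] fun s => (1 + ‖s‖) ^ (-(1 - a)) := by
    refine .of_bound (2 ^ (1 - a)) ?_
    rw [← Metric.cobounded_eq_cocompact]
    filter_upwards [eventually_cobounded_le_norm 1] with s hs
    rw [Real.norm_eq_abs] at hs
    have hs0 : 0 < |s| := one_pos.trans_le hs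
    have hsum : |s| ^ a * |s|⁻¹ = |s| ^ (-(1 - a)) := by
      rw [← Real.rpow_neg_one, ← Real.rpow_add hs0, neg_sub, sub_eq_add_neg]
    calc ‖|s| ^ a * |s|⁻¹‖ = |s| ^ (-(1 - a)) := by
          rw [Real.norm_of_nonneg (by positivity), hsum]
      _ ≤ ((1 + |s|) / 2) ^ (-(1 - a)) :=
        Real.rpow_le_rpow_of_nonpos (by positivity) (by linarith) (by linarith)
      _ = 2 ^ (1 - a) * ‖(1 + ‖s‖) ^ (-(1 - a))‖ := by
        rw [Real.norm_of_nonneg (by positivity), Real.div_rpow (by positivity) two_pos.le,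
          Real.rpow_neg two_pos.le, div_inv_eq_mul, mul_comm, Real.norm_eq_abs]
  exact hloc.integrable_of_isBigO_cocompact (((isBigO_refl _ _).mul hinv).trans hpow)
    ((integrable_one_add_norm (by rw [Module.finrank_self, Nat.cast_one]; linarith)
      ).integrableAtFilter _)

/-- Functions `g` on the upper half-plane that are determined by the modulus of their boundary
values: `g` is holomorphic and nonvanishing, `g = 1 + O(1 / z)` at infinity, and near the real
line `‖g‖` lies between multiples of `|re z|` and `1 / |re z|`, locally uniformly. -/
structure IsTameOuter (g : ℂ → ℂ) : Prop where
  differentiableOn : DifferentiableOn ℂ g upperHalf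
  ne_zero : ∀ z ∈ upperHalf, g z ≠ 0
  sub_one_isBigO : (fun z => g z - 1) =O[atInfty upperHalf] fun z => z⁻¹
  exists_norm_bounds : ∀ T : ℝ, ∃ c M ε : ℝ, 0 < c ∧ 0 < M ∧ 0 < ε ∧
    ∀ z : ℂ, 0 < z.im → z.im < ε → |z.re| ≤ T → z.re ≠ 0 →
      c * |z.re| ≤ ‖g z‖ ∧ |z.re| * ‖g z‖ ≤ M

lemma log_le_sqrt_mul_rpow {s x M : ℝ} (hs : 0 < s) (hx : 0 < x) (h : s * x ≤ M) :
    Real.log x ≤ 2 * √M * s ^ (-(1 / 2) : ℝ) := by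
  have hM : 0 < M := (mul_pos hs hx).trans_le h
  calc Real.log x ≤ x ^ (1 / 2 : ℝ) / (1 / 2) := Real.log_le_rpow_div hx.le (by norm_num)
    _ ≤ (M / s) ^ (1 / 2 : ℝ) / (1 / 2) := by
      gcongr
      rwa [le_div_iff₀' hs]
    _ = 2 * √M * s ^ (-(1 / 2) : ℝ) := by
      rw [Real.div_rpow hM.le hs.le, Real.rpow_neg hs.le, Real.sqrt_eq_rpow]
      field_simp

lemma abs_log_le_sqrt_mul_rpow {c s x M : ℝ} (hc : 0 < c) (hs : 0 < s) (hcx : c * s ≤ x)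
    (hM : s * x ≤ M) : |Real.log x| ≤ (2 * √M + 2 * √c⁻¹) * s ^ (-(1 / 2) : ℝ) := by
  have hx : 0 < x := (mul_pos hc hs).trans_le hcx
  have hup := log_le_sqrt_mul_rpow hs hx hM
  have hlow : Real.log x⁻¹ ≤ 2 * √c⁻¹ * s ^ (-(1 / 2) : ℝ) := by
    refine log_le_sqrt_mul_rpow hs (inv_pos.2 hx) ?_
    rw [← div_eq_mul_inv, div_le_iff₀ hx, ← div_eq_inv_mul, le_div_iff₀' hc]
    exact hcx
  rw [Real.log_inv] at hlow
  have : 0 ≤ 2 * √M * s ^ (-(1 / 2) : ℝ) := by positivity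
  have : 0 ≤ 2 * √c⁻¹ * s ^ (-(1 / 2) : ℝ) := by positivity
  rw [add_mul, abs_le]
  constructor <;> linarith

lemma log_norm_isBigO_inv {g : ℂ → ℂ}
    (hg : (fun z => g z - 1) =O[atInfty upperHalf] fun z => z⁻¹) :
    (fun z => Real.log ‖g z‖) =O[atInfty upperHalf] fun z => z⁻¹ := by
  have hsmall := (hg.trans_tendsto tendsto_inv_atInfty).norm.eventually_le_const
    (by rw [norm_zero]; exact one_half_pos)
  refine IsBigO.trans (.of_bound (3 / 2) ?_) hg
  filter_upwards [hsmall] with z hz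
  rw [← Complex.log_re, Real.norm_eq_abs]
  exact (Complex.abs_re_le_norm _).trans (norm_log_le_of_norm_sub_one_le hz)

lemma IsTameOuter.exists_abs_log_norm_le {g : ℂ → ℂ} (hg : IsTameOuter g) :
    ∃ K ε : ℝ, 0 < ε ∧ ∀ z : ℂ, 0 < z.im → z.im < ε → z.re ≠ 0 →
      |Real.log ‖g z‖| ≤ K * |z.re| ^ (-(1 / 2) : ℝ) := by
  obtain ⟨C, hC, hO⟩ := (log_norm_isBigO_inv hg.sub_one_isBigO).exists_pos
  obtain ⟨R, hR⟩ := eventually_atInfty.1 hO.bound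
  obtain ⟨c, M, ε, hc, hM, hε, hbd⟩ := hg.exists_norm_bounds (max R 1)
  refine ⟨max (2 * √M + 2 * √c⁻¹) C, ε, hε, fun z hz hzε hre => ?_⟩
  have hs : 0 < |z.re| := abs_pos.2 hre
  have hre_le : |z.re| ≤ ‖z‖ := Complex.abs_re_le_norm z
  rcases le_or_gt |z.re| (max R 1) with hzT | hzT
  · obtain ⟨hlow, hup⟩ := hbd z hz hzε hzT hre
    refine (abs_log_le_sqrt_mul_rpow hc hs hlow hup).trans ?_
    gcongr
    exact le_max_left _ _
  · obtain ⟨hRz, h1z⟩ := max_lt_iff.1 hzT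
    calc |Real.log ‖g z‖| ≤ C * ‖z‖⁻¹ := by
          simpa only [norm_inv, Real.norm_eq_abs] using hR z hz (hRz.le.trans hre_le)
      _ ≤ C * |z.re| ^ (-1 : ℝ) := by
        rw [Real.rpow_neg_one]
        gcongr
      _ ≤ max (2 * √M + 2 * √c⁻¹) C * |z.re| ^ (-(1 / 2) : ℝ) := by
        gcongr
        · exact le_max_right _ _
        · exact h1z.le
        · norm_num

lemma tendsto_add_mul_I_atInfty {ε : ℝ} (hε : 0 < ε) :
    Tendsto (fun z : ℂ => z + ε * Complex.I) (atInfty {z | 0 ≤ z.im}) (atInfty upperHalf) := by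
  refine tendsto_inf.2 ⟨?_, tendsto_principal.2 ?_⟩
  · exact (tendsto_add_const_cobounded _).mono_left inf_le_left
  · filter_upwards [mem_atInfty_self] with z hz
    change 0 < (z + ε * Complex.I).im
    rw [Complex.add_im, Complex.im_ofReal_mul, Complex.I_im, mul_one]
    exact add_pos_of_nonneg_of_pos hz hε

lemma integral_two_re_shift_div_sub {h : ℂ → ℂ} (hh : DifferentiableOn ℂ h upperHalf)
    (hO : h =O[atInfty upperHalf] fun z => z⁻¹) {ε : ℝ} (hε : 0 < ε) {z : ℂ} (hz : 0 < z.im) :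
    ∫ s : ℝ, ((2 * (h (s + ε * Complex.I)).re : ℝ) : ℂ) / ((s : ℂ) - z) =
      2 * Real.pi * Complex.I * h (z + ε * Complex.I) := by
  refine integral_two_re_div_sub (h := fun w => h (w + ε * Complex.I))
    (hh.comp (by fun_prop) fun w hw => ?_)
    ((hO.comp_tendsto (tendsto_add_mul_I_atInfty hε)).trans
      ((isBigO_inv_add_const _).mono inf_le_left)) hz
  change 0 < (w + ε * Complex.I).im
  rw [Complex.add_im, Complex.im_ofReal_mul, Complex.I_im, mul_one]
  exact add_pos_of_nonneg_of_pos hw hε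

lemma integrable_of_tendsto_of_dominated {α ι E : Type*} [MeasurableSpace α] {μ : Measure α}
    [NormedAddCommGroup E] {l : Filter ι} [l.NeBot] [l.IsCountablyGenerated] {F : ι → α → E}
    {f : α → E} {bound : α → ℝ} (hF : ∀ᶠ i in l, AEStronglyMeasurable (F i) μ)
    (hbd : ∀ᶠ i in l, ∀ᵐ a ∂μ, ‖F i a‖ ≤ bound a) (hbound : Integrable bound μ)
    (hlim : ∀ᵐ a ∂μ, Tendsto (fun i => F i a) l (𝓝 (f a))) : Integrable f μ := by
  obtain ⟨u, hu⟩ := l.exists_seq_tendsto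
  obtain ⟨N, hN⟩ := eventually_atTop.1 (hu.eventually (hF.and hbd))
  have hlimN : ∀ᵐ a ∂μ, Tendsto (fun n => F (u (n + N)) a) atTop (𝓝 (f a)) :=
    hlim.mono fun a ha => ha.comp (hu.comp (tendsto_add_atTop_nat N))
  have hbdN : ∀ᵐ a ∂μ, ∀ n, ‖F (u (n + N)) a‖ ≤ bound a :=
    ae_all_iff.2 fun n => (hN _ (Nat.le_add_left N n)).2
  refine hbound.mono' (aestronglyMeasurable_of_tendsto_ae atTop
    (fun n => (hN _ (Nat.le_add_left N n)).1) hlimN) ?_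
  filter_upwards [hlimN, hbdN] with a ha hba
  exact le_of_tendsto' ha.norm hba

lemma tendsto_add_mul_I (z : ℂ) :
    Tendsto (fun ε : ℝ => z + ε * Complex.I) (𝓝[>] 0) (𝓝 z) := by
  have hcont : Continuous fun ε : ℝ => z + ε * Complex.I := by fun_prop
  exact (hcont.tendsto' 0 z (by simp)).mono_left nhdsWithin_le_nhds

lemma ofReal_add_mul_I_mem_upperHalf (s : ℝ) {ε : ℝ} (hε : 0 < ε) :
    (s : ℂ) + ε * Complex.I ∈ upperHalf := by
  change 0 < ((s : ℂ) + ε * Complex.I).im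
  simpa using hε

lemma ae_ne (a : ℝ) : ∀ᵐ s : ℝ, s ≠ a := by simp [ae_iff, measure_singleton]

section IsTameOuter

variable {g : ℂ → ℂ}

lemma IsTameOuter.eq_exp_integral_shift (hg : IsTameOuter g) {ε : ℝ} (hε : 0 < ε) {z : ℂ}
    (hz : 0 < z.im) :
    g (z + ε * Complex.I) = Complex.exp (1 / (2 * Real.pi * Complex.I) *
      ∫ s : ℝ, ((2 * Real.log ‖g (s + ε * Complex.I)‖ : ℝ) : ℂ) / ((s : ℂ) - z)) := by
  obtain ⟨h, hd, hexp, hO⟩ :=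
    exists_log_isBigO_inv hg.differentiableOn hg.ne_zero hg.sub_one_isBigO
  have hre : ∀ s : ℝ, Real.log ‖g (s + ε * Complex.I)‖ = (h (s + ε * Complex.I)).re := fun s => by
    rw [← hexp _ (ofReal_add_mul_I_mem_upperHalf s hε), Complex.norm_exp, Real.log_exp]
  have hzε : z + ε * Complex.I ∈ upperHalf := by
    change 0 < (z + ε * Complex.I).im
    rw [Complex.add_im, Complex.im_ofReal_mul, Complex.I_im, mul_one]
    exact add_pos hz hε
  simp_rw [hre]
  rw [integral_two_re_shift_div_sub hd hO hε hz, one_div,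
    inv_mul_cancel_left₀ Complex.two_pi_I_ne_zero, hexp _ hzε]

lemma IsTameOuter.continuous_log_norm_shift (hg : IsTameOuter g) {ε : ℝ} (hε : 0 < ε) :
    Continuous fun s : ℝ => Real.log ‖g (s + ε * Complex.I)‖ := by
  have hmem := fun s : ℝ => ofReal_add_mul_I_mem_upperHalf s hε
  exact (hg.differentiableOn.continuousOn.comp_continuous (by fun_prop) hmem).norm.log
    fun s => norm_ne_zero_iff.2 (hg.ne_zero _ (hmem s))

lemma IsTameOuter.exists_norm_shift_div_sub_le (hg : IsTameOuter g) (z : ℂ) :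
    ∃ K : ℝ, ∀ᶠ ε : ℝ in 𝓝[>] 0, ∀ s : ℝ, s ≠ 0 →
      ‖((2 * Real.log ‖g (s + ε * Complex.I)‖ : ℝ) : ℂ) / ((s : ℂ) - z)‖ ≤
        K * (|s| ^ (-(1 / 2) : ℝ) * ‖(s : ℂ) - z‖⁻¹) := by
  obtain ⟨K, ε₀, hε₀, hK⟩ := hg.exists_abs_log_norm_le
  refine ⟨2 * K, ?_⟩
  filter_upwards [Ioo_mem_nhdsGT hε₀] with ε hε s hs
  have hlog := hK (s + ε * Complex.I) (by simpa using hε.1) (by simpa using hε.2)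
    (by simpa using hs)
  have hre : ((s : ℂ) + ε * Complex.I).re = s := by simp
  rw [hre] at hlog
  rw [norm_div, Complex.norm_real, norm_mul, Real.norm_eq_abs, Real.norm_eq_abs, abs_two,
    div_eq_mul_inv, mul_assoc 2 K, ← mul_assoc K, ← mul_assoc 2 (K * _)]
  gcongr

theorem IsTameOuter.eq_exp_integral (hg : IsTameOuter g) {L : ℝ → ℝ}
    (hL : ∀ s : ℝ, s ≠ 0 →
      Tendsto (fun ε : ℝ => Real.log ‖g (s + ε * Complex.I)‖) (𝓝[>] 0) (𝓝 (L s)))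
    {z : ℂ} (hz : 0 < z.im) :
    Integrable (fun s : ℝ => ((2 * L s : ℝ) : ℂ) / ((s : ℂ) - z)) ∧
      g z = Complex.exp (1 / (2 * Real.pi * Complex.I) *
        ∫ s : ℝ, ((2 * L s : ℝ) : ℂ) / ((s : ℂ) - z)) := by
  obtain ⟨K, hK⟩ := hg.exists_norm_shift_div_sub_le z
  have hbound : Integrable fun s : ℝ => K * (|s| ^ (-(1 / 2) : ℝ) * ‖(s : ℂ) - z‖⁻¹) :=
    (integrable_abs_rpow_mul_inv_norm_sub (by norm_num) (by norm_num) hz).const_mul K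
  have hmeas : ∀ᶠ ε : ℝ in 𝓝[>] 0, AEStronglyMeasurable fun s : ℝ =>
      ((2 * Real.log ‖g (s + ε * Complex.I)‖ : ℝ) : ℂ) / ((s : ℂ) - z) := by
    filter_upwards [self_mem_nhdsWithin] with ε hε
    have hcont := hg.continuous_log_norm_shift hε
    exact (Continuous.div (by fun_prop) (by fun_prop)
      (ofReal_sub_ne_zero hz.ne')).aestronglyMeasurable
  have hdom := hK.mono fun ε hε => (ae_ne 0).mono hε
  have hlim := (ae_ne 0).mono fun s hs =>
    ((Complex.continuous_ofReal.tendsto _).comp ((hL s hs).const_mul 2)).div_const ((s : ℂ) - z)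
  refine ⟨integrable_of_tendsto_of_dominated hmeas hdom hbound hlim, ?_⟩
  have hint := tendsto_integral_filter_of_dominated_convergence _ hmeas hdom hbound hlim
  have hgz : Tendsto (fun ε : ℝ => g (z + ε * Complex.I)) (𝓝[>] 0) (𝓝 (g z)) :=
    (hg.differentiableOn.continuousOn.continuousAt
      (isOpen_upperHalf.mem_nhds hz)).tendsto.comp (tendsto_add_mul_I z)
  refine tendsto_nhds_unique hgz (((Complex.continuous_exp.tendsto _).comp
    (hint.const_mul (1 / (2 * Real.pi * Complex.I)))).congr' ?_)
  filter_upwards [self_mem_nhdsWithin] with ε hε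
  exact (hg.eq_exp_integral_shift hε hz).symm

end IsTameOuter

end TameOuter

section SimpleZeros

lemma eq_sub_mul_dslope {f : ℂ → ℂ} {p : ℂ} (hp : f p = 0) (z : ℂ) :
    f z = (z - p) * dslope f p z := by
  rw [← smul_eq_mul, sub_smul_dslope, hp, sub_zero]

lemma deriv_eq_sub_mul_deriv_dslope {f : ℂ → ℂ} {p z : ℂ} (hp : f p = 0) (hz : f z = 0)
    (hne : z ≠ p) (hd : DifferentiableAt ℂ (dslope f p) z) :
    deriv f z = (z - p) * deriv (dslope f p) z := by
  have hdz : dslope f p z = 0 :=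
    (mul_eq_zero.1 ((eq_sub_mul_dslope hp z).symm.trans hz)).resolve_left (sub_ne_zero.2 hne)
  have hf : HasDerivAt f _ z :=
    (((hasDerivAt_id z).sub_const p).mul hd.hasDerivAt).congr_of_eventuallyEq
      (.of_forall (eq_sub_mul_dslope hp))
  rw [hf.deriv, hdz, mul_zero, zero_add, id]

lemma exists_eq_prod_mul {U : Set ℂ} (hU : IsOpen U) (S : Finset ℂ) {f : ℂ → ℂ}
    (hf : DifferentiableOn ℂ f U) (hmem : ∀ z ∈ U, f z = 0 → z ∈ S)
    (hS : ∀ p ∈ S, p ∈ U ∧ f p = 0 ∧ deriv f p ≠ 0) :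
    ∃ g : ℂ → ℂ, DifferentiableOn ℂ g U ∧ (∀ z ∈ U, g z ≠ 0) ∧
      ∀ z ∈ U, f z = (∏ p ∈ S, (z - p)) * g z := by
  classical
  induction S using Finset.induction_on generalizing f with
  | empty =>
    exact ⟨f, hf, fun z hz h => Finset.notMem_empty z (hmem z hz h), fun z _ => by
      rw [Finset.prod_empty, one_mul]⟩
  | insert p S hpS ih =>
    obtain ⟨hpU, hfp, hdp⟩ := hS p (Finset.mem_insert_self p S)
    have hd : DifferentiableOn ℂ (dslope f p) U :=
      (Complex.differentiableOn_dslope (hU.mem_nhds hpU)).2 hf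
    have hmem' : ∀ z ∈ U, dslope f p z = 0 → z ∈ S := fun z hz hz0 => by
      have hfz : f z = 0 := by rw [eq_sub_mul_dslope hfp z, hz0, mul_zero]
      refine (Finset.mem_insert.1 (hmem z hz hfz)).resolve_left ?_
      rintro rfl
      exact hdp (by rwa [← dslope_same])
    have hS' : ∀ z ∈ S, z ∈ U ∧ dslope f p z = 0 ∧ deriv (dslope f p) z ≠ 0 := fun z hz => by
      obtain ⟨hzU, hfz, hdz⟩ := hS z (Finset.mem_insert_of_mem hz)
      have hne : z ≠ p := by
        rintro rfl
        exact hpS hz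
      rw [deriv_eq_sub_mul_deriv_dslope hfp hfz hne
        (hd.differentiableAt (hU.mem_nhds hzU))] at hdz
      rw [eq_sub_mul_dslope hfp z, mul_eq_zero] at hfz
      exact ⟨hzU, hfz.resolve_left (sub_ne_zero.2 hne), right_ne_zero_of_mul hdz⟩
    obtain ⟨g, hg, hg0, hfg⟩ := ih hd hmem' hS'
    refine ⟨g, hg, hg0, fun z hz => ?_⟩
    rw [Finset.prod_insert hpS, eq_sub_mul_dslope hfp z, hfg z hz, mul_assoc]

end SimpleZeros

section Meromorphy

variable {q : ℝ → ℝ} {k : ℂ}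

lemma analyticAt_jostFunction (hq : InL11 q) (hk : 0 < k.im) : AnalyticAt ℂ (jostFunction q) k :=
  (differentiableOn_jostFunction hq).analyticAt (isOpen_upperHalf.mem_nhds hk)

lemma analyticAt_jostDeriv (hq : InL11 q) (hk : 0 < k.im) : AnalyticAt ℂ (jostDeriv q) k :=
  (differentiableOn_jostDeriv hq).analyticAt (isOpen_upperHalf.mem_nhds hk)

lemma meromorphicAt_iFunction (hq : InL11 q) (hk : 0 < k.im) : MeromorphicAt (iFunction q) k :=
  (analyticAt_jostDeriv hq hk).meromorphicAt.div (analyticAt_jostFunction hq hk).meromorphicAt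

lemma meromorphicOrderAt_iFunction_of_eq_zero (hq : InL11 q) (hk : 0 < k.im)
    (h : jostFunction q k = 0) : meromorphicOrderAt (iFunction q) k = -1 := by
  have hU := isOpen_upperHalf.mem_nhds hk
  have hd : AnalyticAt ℂ (dslope (jostFunction q) k) k :=
    ((Complex.differentiableOn_dslope hU).2 (differentiableOn_jostFunction hq)).analyticAt hU
  have hd0 : dslope (jostFunction q) k k ≠ 0 := by
    rw [dslope_same]
    exact deriv_jostFunction_ne_zero hq hk h
  refine (meromorphicOrderAt_eq_int_iff (n := -1) (meromorphicAt_iFunction hq hk)).2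
    ⟨fun z => jostDeriv q z / dslope (jostFunction q) k z,
      (analyticAt_jostDeriv hq hk).div hd hd0,
      div_ne_zero (jostDeriv_ne_zero_of_jostFunction_eq_zero hq hk.le h) hd0,
      .of_forall fun z => ?_⟩
  rw [iFunction_eq_div, eq_sub_mul_dslope h z, zpow_neg_one, smul_eq_mul,
    div_mul_eq_div_div_swap, div_eq_mul_inv, mul_comm]

lemma meromorphicOrderAt_iFunction_of_ne_zero (hq : InL11 q) (hk : 0 < k.im)
    (h : jostFunction q k ≠ 0) : 0 ≤ meromorphicOrderAt (iFunction q) k :=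
  ((analyticAt_jostDeriv hq hk).div (analyticAt_jostFunction hq hk) h).meromorphicOrderAt_nonneg

lemma mem_upperPoles_iff (hq : InL11 q) {p : ℂ} :
    p ∈ upperPoles (iFunction q) ↔ 0 < p.im ∧ jostFunction q p = 0 := by
  refine and_congr_right fun hp : 0 < p.im => ⟨fun hneg => by_contra fun h => ?_, fun h => ?_⟩
  · exact hneg.not_ge (meromorphicOrderAt_iFunction_of_ne_zero hq hp h)
  · rw [meromorphicOrderAt_iFunction_of_eq_zero hq hp h]
    exact WithTop.coe_lt_coe.2 (by norm_num : (-1 : ℤ) < 0)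

lemma re_eq_zero_of_mem_upperPoles (hq : InL11 q) {p : ℂ} (hp : p ∈ upperPoles (iFunction q)) :
    p.re = 0 := by
  obtain ⟨him, h0⟩ := (mem_upperPoles_iff hq).1 hp
  exact by_contra fun hre => jostFunction_ne_zero_of_re_ne_zero hq him.le hre h0

lemma upperPoles_iFunction (hq : InL11 q) :
    upperPoles (iFunction q) = (fun κ : ℝ => Complex.I * (κ : ℂ)) '' boundStates q := by
  ext p
  constructor
  · intro hp
    obtain ⟨him, h0⟩ := (mem_upperPoles_iff hq).1 hp
    have hpI : Complex.I * (p.im : ℂ) = p :=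
      Complex.ext (by simp [re_eq_zero_of_mem_upperPoles hq hp]) (by simp)
    exact ⟨p.im, (mem_boundStates_iff hq).2 ⟨him, by rwa [hpI]⟩, hpI⟩
  · rintro ⟨κ, hκ, rfl⟩
    obtain ⟨hpos, h0⟩ := (mem_boundStates_iff hq).1 hκ
    exact (mem_upperPoles_iff hq).2 ⟨by simpa using hpos, h0⟩

lemma finite_upperPoles_iFunction (hq : InL11 q) : (upperPoles (iFunction q)).Finite := by
  rw [upperPoles_iFunction hq]
  exact (finite_boundStates hq).image _

end Meromorphy

section Blaschke

open Asymptotics Bornology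

/-- The finite Blaschke product of the upper half-plane with zeros `S`. The products `w` are of this
form: their zeros lie on the imaginary axis, where `conj p = -p`. -/
noncomputable def blaschke (S : Finset ℂ) (z : ℂ) : ℂ :=
  ∏ p ∈ S, (z - p) / (z - starRingEnd ℂ p)

variable {S : Finset ℂ} {z p : ℂ}

lemma sub_conj_ne_zero (hz : 0 ≤ z.im) (hp : 0 < p.im) : z - starRingEnd ℂ p ≠ 0 := fun h => by
  have him := congrArg Complex.im h
  rw [Complex.sub_im, Complex.conj_im, Complex.zero_im] at him
  linarith

lemma norm_sub_conj_sq (z p : ℂ) :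
    ‖z - starRingEnd ℂ p‖ ^ 2 = ‖z - p‖ ^ 2 + 4 * z.im * p.im := by
  simp only [Complex.sq_norm, Complex.normSq_apply, Complex.sub_re, Complex.sub_im,
    Complex.conj_re, Complex.conj_im]
  ring

lemma norm_blaschke_le_one (hS : ∀ p ∈ S, 0 < p.im) (hz : 0 ≤ z.im) : ‖blaschke S z‖ ≤ 1 := by
  rw [blaschke, norm_prod]
  refine Finset.prod_le_one (fun _ _ => norm_nonneg _) fun p hp => ?_
  rw [norm_div, div_le_one (norm_pos_iff.2 (sub_conj_ne_zero hz (hS p hp))),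
    ← sq_le_sq₀ (norm_nonneg _) (norm_nonneg _), norm_sub_conj_sq]
  have := mul_nonneg hz (hS p hp).le
  linarith

lemma norm_blaschke_ofReal (hS : ∀ p ∈ S, 0 < p.im) (s : ℝ) : ‖blaschke S s‖ = 1 := by
  rw [blaschke, norm_prod]
  refine Finset.prod_eq_one fun p hp => ?_
  have hnorm : ‖(s : ℂ) - p‖ = ‖(s : ℂ) - starRingEnd ℂ p‖ := by
    rw [← sq_eq_sq₀ (norm_nonneg _) (norm_nonneg _), norm_sub_conj_sq, Complex.ofReal_im]
    ring
  rw [norm_div, hnorm, div_self]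
  exact norm_ne_zero_iff.2 (sub_conj_ne_zero (Complex.ofReal_im s).ge (hS p hp))

lemma continuousAt_blaschke (hS : ∀ p ∈ S, 0 < p.im) (hz : 0 ≤ z.im) :
    ContinuousAt (blaschke S) z :=
  tendsto_finsetProd _ fun p hp =>
    ContinuousAt.div (by fun_prop) (by fun_prop) (sub_conj_ne_zero hz (hS p hp))

lemma norm_inv_blaschke_le (hS : ∀ p ∈ S, z.im ≤ p.im / 2) (hS0 : ∀ p ∈ S, 0 < p.im) :
    ‖(blaschke S z)⁻¹‖ ≤ 5 ^ S.card := by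
  rw [blaschke, norm_inv, norm_prod, ← Finset.prod_inv_distrib, ← Finset.prod_const]
  refine Finset.prod_le_prod (fun _ _ => by positivity) fun p hp => ?_
  have hp0 := hS0 p hp
  have hzp := hS p hp
  have hlow : p.im / 2 ≤ ‖z - p‖ := by
    have him := (neg_le_abs _).trans (Complex.abs_im_le_norm (z - p))
    rw [Complex.sub_im] at him
    linarith
  rw [norm_div, inv_div, div_le_iff₀ (by linarith), ← sq_le_sq₀ (by positivity) (by positivity),
    norm_sub_conj_sq]
  nlinarith

lemma isBigO_mul_sub_one {l : Filter ℂ} {φ ψ u : ℂ → ℂ} (hφ : (fun z => φ z - 1) =O[l] u)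
    (hψ : (fun z => ψ z - 1) =O[l] u) (hu : Tendsto u l (𝓝 0)) :
    (fun z => φ z * ψ z - 1) =O[l] u := by
  have hψ1 : ψ =O[l] fun _ => (1 : ℂ) := by
    simpa only [sub_add_cancel] using
      (hψ.trans (hu.isBigO_one ℂ)).add (isBigO_refl (fun _ => (1 : ℂ)) l)
  have hsplit : ∀ z, φ z * ψ z - 1 = (φ z - 1) * ψ z + (ψ z - 1) := fun z => by ring
  simpa only [hsplit, mul_one] using (hφ.mul hψ1).add (by simpa only [mul_one] using hψ)

lemma div_sub_one_isBigO_inv (a b : ℂ) :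
    (fun z => (z - a) / (z - b) - 1) =O[cobounded ℂ] fun z => z⁻¹ := by
  refine ((isBigO_inv_sub_const b).const_mul_left (b - a)).congr' ?_ .rfl
  filter_upwards [eventually_ne_cobounded b] with z hz
  rw [div_sub_one (sub_ne_zero.2 hz), sub_sub_sub_cancel_left, div_eq_mul_inv]

lemma inv_blaschke_sub_one_isBigO_inv (S : Finset ℂ) :
    (fun z => (blaschke S z)⁻¹ - 1) =O[cobounded ℂ] fun z => z⁻¹ := by
  classical
  simp only [blaschke, ← Finset.prod_inv_distrib, inv_div]
  induction S using Finset.induction_on with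
  | empty => simpa only [Finset.prod_empty, sub_self] using isBigO_zero _ _
  | insert p S hp ih =>
    simp_rw [Finset.prod_insert hp]
    exact isBigO_mul_sub_one (div_sub_one_isBigO_inv _ _) ih tendsto_inv₀_cobounded

lemma exists_pos_forall_le_im_div_two (hS : ∀ p ∈ S, 0 < p.im) :
    ∃ ε : ℝ, 0 < ε ∧ ∀ p ∈ S, ε ≤ p.im / 2 := by
  have hev : ∀ᶠ ε : ℝ in 𝓝[>] 0, ∀ p ∈ S, ε ≤ p.im / 2 := by
    rw [eventually_all_finset]
    exact fun p hp => (eventually_le_nhds (half_pos (hS p hp))).filter_mono nhdsWithin_le_nhds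
  obtain ⟨ε, hle, hpos⟩ := (hev.and self_mem_nhdsWithin).exists
  exact ⟨ε, hpos, hle⟩

lemma norm_le_abs_add_one {T : ℝ} (hz : 0 ≤ z.im) (hz1 : z.im ≤ 1) (hT : |z.re| ≤ T) :
    ‖z‖ ≤ |T| + 1 := by
  refine (Complex.norm_le_abs_re_add_abs_im z).trans (add_le_add (hT.trans (le_abs_self T)) ?_)
  rwa [abs_of_nonneg hz]

variable {f g : ℂ → ℂ}

lemma exists_eq_blaschke_mul (hf : DifferentiableOn ℂ f upperHalf)
    (hmem : ∀ z ∈ upperHalf, f z = 0 → z ∈ S)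
    (hS : ∀ p ∈ S, p ∈ upperHalf ∧ f p = 0 ∧ deriv f p ≠ 0) :
    ∃ g : ℂ → ℂ, DifferentiableOn ℂ g upperHalf ∧ (∀ z ∈ upperHalf, g z ≠ 0) ∧
      ∀ z ∈ upperHalf, f z = blaschke S z * g z := by
  obtain ⟨g, hg, hg0, hfg⟩ := exists_eq_prod_mul isOpen_upperHalf S hf hmem hS
  have hden : ∀ z ∈ upperHalf, ∏ p ∈ S, (z - starRingEnd ℂ p) ≠ 0 := fun z hz =>
    Finset.prod_ne_zero_iff.2 fun p hp => sub_conj_ne_zero (le_of_lt hz) (hS p hp).1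
  refine ⟨fun z => (∏ p ∈ S, (z - starRingEnd ℂ p)) * g z,
    (DifferentiableOn.fun_finsetProd fun p _ => by fun_prop).mul hg,
    fun z hz => mul_ne_zero (hden z hz) (hg0 z hz), fun z hz => ?_⟩
  rw [blaschke, Finset.prod_div_distrib, ← mul_assoc, div_mul_cancel₀ _ (hden z hz), hfg z hz]

lemma eq_mul_inv_blaschke (hS : ∀ p ∈ S, 0 < p.im)
    (hfg : ∀ z ∈ upperHalf, f z = blaschke S z * g z) (hz : 0 < z.im) (hzS : z ∉ S) :
    g z = f z * (blaschke S z)⁻¹ := by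
  have hb : blaschke S z ≠ 0 := Finset.prod_ne_zero_iff.2 fun p hp =>
    div_ne_zero (sub_ne_zero.2 fun h => hzS (h ▸ hp)) (sub_conj_ne_zero hz.le (hS p hp))
  rw [hfg z hz, mul_comm, inv_mul_cancel_left₀ hb]

lemma sub_one_isBigO_of_eq_blaschke_mul (hS : ∀ p ∈ S, 0 < p.im)
    (hfg : ∀ z ∈ upperHalf, f z = blaschke S z * g z)
    (hf : (fun z => f z - 1) =O[atInfty upperHalf] fun z => z⁻¹) :
    (fun z => g z - 1) =O[atInfty upperHalf] fun z => z⁻¹ := by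
  refine (isBigO_mul_sub_one hf ((inv_blaschke_sub_one_isBigO_inv S).mono inf_le_left)
    tendsto_inv_atInfty).congr' ?_ .rfl
  have hfar : ∀ᶠ z in atInfty upperHalf, z ∉ S :=
    mem_inf_of_left (isBounded_def.1 S.finite_toSet.isBounded)
  filter_upwards [hfar, mem_atInfty_self] with z hzS hz
  rw [eq_mul_inv_blaschke hS hfg hz hzS]

theorem exists_isTameOuter_eq_blaschke_mul (hf : DifferentiableOn ℂ f upperHalf)
    (hmem : ∀ z ∈ upperHalf, f z = 0 → z ∈ S)
    (hS : ∀ p ∈ S, p ∈ upperHalf ∧ f p = 0 ∧ deriv f p ≠ 0)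
    (hinf : (fun z => f z - 1) =O[atInfty upperHalf] fun z => z⁻¹)
    (hlow : ∀ R : ℝ, ∃ c : ℝ, 0 < c ∧ ∀ z ∈ upperHalf, ‖z‖ ≤ R → c * |z.re| ≤ ‖f z‖)
    {B : ℝ} (hB : ∀ z ∈ upperHalf, ‖f z‖ ≤ B) :
    ∃ g, IsTameOuter g ∧ ∀ z ∈ upperHalf, f z = blaschke S z * g z := by
  obtain ⟨g, hg, hg0, hfg⟩ := exists_eq_blaschke_mul hf hmem hS
  have hS0 : ∀ p ∈ S, 0 < p.im := fun p hp => (hS p hp).1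
  refine ⟨g, ⟨hg, hg0, sub_one_isBigO_of_eq_blaschke_mul hS0 hfg hinf, fun T => ?_⟩, hfg⟩
  obtain ⟨c, hc, hcf⟩ := hlow (|T| + 1)
  obtain ⟨ε, hε, hεS⟩ := exists_pos_forall_le_im_div_two hS0
  refine ⟨c, (|T| + 1) * ((|B| + 1) * 5 ^ S.card), min ε 1, hc, by positivity,
    lt_min hε one_pos, fun z hz hzε hzT _ => ⟨?_, ?_⟩⟩
  · calc c * |z.re| ≤ ‖f z‖ :=
          hcf z hz (norm_le_abs_add_one hz.le (hzε.le.trans (min_le_right _ _)) hzT)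
      _ = ‖blaschke S z‖ * ‖g z‖ := by rw [hfg z hz, norm_mul]
      _ ≤ ‖g z‖ := mul_le_of_le_one_left (norm_nonneg _) (norm_blaschke_le_one hS0 hz.le)
  · have hzS : ∀ p ∈ S, z.im ≤ p.im / 2 := fun p hp =>
      (hzε.le.trans (min_le_left _ _)).trans (hεS p hp)
    have hz_notMem : z ∉ S := fun h => by linarith [hzS z h, hS0 z h]
    rw [eq_mul_inv_blaschke hS0 hfg hz hz_notMem, norm_mul]
    gcongr
    · linarith [le_abs_self T]
    · linarith [hB z hz, le_abs_self B]
    · exact norm_inv_blaschke_le hzS hS0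

lemma tendsto_log_norm_of_eq_blaschke_mul (hS : ∀ p ∈ S, 0 < p.im)
    (hfg : ∀ z ∈ upperHalf, f z = blaschke S z * g z) {s : ℝ}
    (hf : ContinuousWithinAt f {z | 0 ≤ z.im} s) (hs : f s ≠ 0) :
    Tendsto (fun ε : ℝ => Real.log ‖g (s + ε * Complex.I)‖) (𝓝[>] 0) (𝓝 (Real.log ‖f s‖)) := by
  have hpath : Tendsto (fun ε : ℝ => (s : ℂ) + ε * Complex.I) (𝓝[>] 0)
      (𝓝[{z | 0 ≤ z.im}] (s : ℂ)) := by
    refine tendsto_nhdsWithin_iff.2 ⟨tendsto_add_mul_I s, ?_⟩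
    filter_upwards [self_mem_nhdsWithin] with ε hε
    exact le_of_lt (ofReal_add_mul_I_mem_upperHalf s hε)
  have hb := ((continuousAt_blaschke hS (Complex.ofReal_im s).ge).norm.tendsto.comp
    (tendsto_add_mul_I s))
  rw [norm_blaschke_ofReal hS] at hb
  have hquot := (hf.norm.tendsto.comp hpath).div hb one_ne_zero
  rw [div_one] at hquot
  refine (hquot.log (norm_ne_zero_iff.2 hs)).congr' ?_
  filter_upwards [self_mem_nhdsWithin, hb.eventually_ne one_ne_zero] with ε hε hbε
  simp only [Function.comp_apply] at hbε
  simp only [Pi.div_apply, Function.comp_apply, hfg _ (ofReal_add_mul_I_mem_upperHalf s hε),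
    norm_mul, mul_div_cancel_left₀ _ hbε]

end Blaschke

section JostFormula

variable {q : ℝ → ℝ} {z : ℂ}

lemma jostFunction_ofReal_ne_zero (hq : InL11 q) {s : ℝ} (hs : s ≠ 0) : jostFunction q s ≠ 0 :=
  jostFunction_ne_zero_of_re_ne_zero hq (Complex.ofReal_im s).ge (by rwa [Complex.ofReal_re])

lemma im_iFunction_ofReal (hq : InL11 q) (s : ℝ) :
    (iFunction q s).im = s / ‖jostFunction q s‖ ^ 2 := by
  rw [iFunction_eq_div, div_eq_mul_inv, Complex.inv_def, ← mul_assoc, Complex.im_mul_ofReal,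
    im_jostDeriv_mul_conj_of_real hq s, Complex.normSq_eq_norm_sq, div_eq_mul_inv]

lemma div_im_iFunction (hq : InL11 q) {s : ℝ} (hs : s ≠ 0) :
    s / (iFunction q s).im = ‖jostFunction q s‖ ^ 2 := by
  rw [im_iFunction_ofReal hq, div_div_cancel₀ hs]

lemma w_iFunction_eq_blaschke (hq : InL11 q) :
    w (iFunction q) = blaschke (finite_upperPoles_iFunction hq).toFinset := by
  funext z
  rw [w, blaschke, finprod_mem_eq_finite_toFinset_prod _ (finite_upperPoles_iFunction hq)]
  refine Finset.prod_congr rfl fun p hp => ?_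
  have hconj : starRingEnd ℂ p = -p := Complex.ext
    (by simp [re_eq_zero_of_mem_upperPoles hq ((Finite.mem_toFinset _).1 hp)]) (by simp)
  rw [hconj, sub_neg_eq_add]

lemma jostFunction_sub_one_isBigO (hq : InL11 q) :
    (fun z => jostFunction q z - 1) =O[atInfty upperHalf] fun z => z⁻¹ := by
  refine .of_bound (tail q 0 * jostBound q) (eventually_atInfty.2 ⟨1, fun z hz hz1 => ?_⟩)
  rw [norm_inv, ← div_eq_mul_inv, le_div_iff₀' (one_pos.trans_le hz1)]
  exact norm_mul_jostFunction_sub_one_le hq (le_of_lt hz)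

lemma exists_isTameOuter_jostFunction_eq (hq : InL11 q) :
    ∃ g, IsTameOuter g ∧ ∀ z ∈ upperHalf, jostFunction q z = w (iFunction q) z * g z := by
  rw [w_iFunction_eq_blaschke hq]
  have hmem : ∀ p, p ∈ (finite_upperPoles_iFunction hq).toFinset ↔
      0 < p.im ∧ jostFunction q p = 0 := fun p => by
    rw [Finite.mem_toFinset, mem_upperPoles_iff hq]
  refine exists_isTameOuter_eq_blaschke_mul (differentiableOn_jostFunction hq)
    (fun z hz h0 => (hmem z).2 ⟨hz, h0⟩) (fun p hp => ?_) (jostFunction_sub_one_isBigO hq)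
    (fun R => ?_) fun z hz => norm_jostFunction_le hq (le_of_lt hz)
  · obtain ⟨him, h0⟩ := (hmem p).1 hp
    exact ⟨him, h0, deriv_jostFunction_ne_zero hq him h0⟩
  · obtain ⟨c, hc, hcf⟩ := exists_mul_abs_re_le_norm_jostFunction hq R
    exact ⟨c, hc, fun z hz => hcf z (le_of_lt hz)⟩

theorem jostFunction_eq_exp_integral_log_norm (hq : InL11 q) (hz : 0 < z.im) :
    Integrable (fun s : ℝ => ((2 * Real.log ‖jostFunction q s‖ : ℝ) : ℂ) / ((s : ℂ) - z)) ∧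
      jostFunction q z = Complex.exp (1 / (2 * Real.pi * Complex.I) *
        ∫ s : ℝ, ((2 * Real.log ‖jostFunction q s‖ : ℝ) : ℂ) / ((s : ℂ) - z)) *
        w (iFunction q) z := by
  obtain ⟨g, hg, hfg⟩ := exists_isTameOuter_jostFunction_eq hq
  have hlim : ∀ s : ℝ, s ≠ 0 → Tendsto (fun ε : ℝ => Real.log ‖g (s + ε * Complex.I)‖) (𝓝[>] 0)
      (𝓝 (Real.log ‖jostFunction q s‖)) := fun s hs => by
    refine tendsto_log_norm_of_eq_blaschke_mul (fun p hp => ?_)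
      (by rwa [← w_iFunction_eq_blaschke hq])
      (continuousOn_jostFunction hq s (Complex.ofReal_im s).ge) (jostFunction_ofReal_ne_zero hq hs)
    exact ((mem_upperPoles_iff hq).1 ((Finite.mem_toFinset _).1 hp)).1
  obtain ⟨hint, hexp⟩ := hg.eq_exp_integral hlim hz
  exact ⟨hint, by rw [← hexp, hfg z hz, mul_comm]⟩

lemma integrand_ae_eq (hq : InL11 q) (z : ℂ) :
    integrand (iFunction q) z =ᵐ[volume]
      fun s : ℝ => ((2 * Real.log ‖jostFunction q s‖ : ℝ) : ℂ) / ((s : ℂ) - z) := by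
  filter_upwards [ae_ne 0] with s hs
  rw [integrand, div_im_iFunction hq hs, Real.log_pow, Nat.cast_ofNat]

theorem jostFunction_eq_exp_integrand (hq : InL11 q) (hz : 0 < z.im) :
    Integrable (integrand (iFunction q) z) ∧
      jostFunction q z = Complex.exp (1 / (2 * Real.pi * Complex.I) *
        ∫ s : ℝ, integrand (iFunction q) z s) * w (iFunction q) z := by
  rw [integrable_congr (integrand_ae_eq hq z), integral_congr_ae (integrand_ae_eq hq z)]
  exact jostFunction_eq_exp_integral_log_norm hq hz

lemma one_le_norm_add_I (hz : 0 ≤ z.im) : 1 ≤ ‖z + Complex.I‖ := by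
  have him := (le_abs_self _).trans (Complex.abs_im_le_norm (z + Complex.I))
  rw [Complex.add_im, Complex.I_im] at him
  linarith

lemma add_I_ne_zero (hz : 0 ≤ z.im) : z + Complex.I ≠ 0 :=
  norm_pos_iff.1 (one_pos.trans_le (one_le_norm_add_I hz))

lemma norm_le_norm_add_I (hz : 0 ≤ z.im) : ‖z‖ ≤ ‖z + Complex.I‖ := by
  rw [← sq_le_sq₀ (norm_nonneg _) (norm_nonneg _), Complex.sq_norm, Complex.sq_norm,
    Complex.normSq_apply, Complex.normSq_apply, Complex.add_re, Complex.add_im, Complex.I_re,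
    Complex.I_im]
  nlinarith

lemma ne_zero_of_im_pos (hz : 0 < z.im) : z ≠ 0 := by
  rintro rfl
  exact lt_irrefl _ hz

lemma isTameOuter_add_I_div : IsTameOuter fun z => (z + Complex.I) / z where
  differentiableOn := DifferentiableOn.div (by fun_prop) (by fun_prop) fun _ => ne_zero_of_im_pos
  ne_zero z hz := div_ne_zero (add_I_ne_zero (le_of_lt hz)) (ne_zero_of_im_pos hz)
  sub_one_isBigO := by
    have hO := div_sub_one_isBigO_inv (-Complex.I) 0
    simp only [sub_neg_eq_add, sub_zero] at hO
    exact hO.mono inf_le_left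
  exists_norm_bounds T := by
    refine ⟨(|T| + 1)⁻¹, |T| + 1 + 1, 1, by positivity, by positivity, one_pos,
      fun z hz hz1 hzT _ => ?_⟩
    have hz0 : 0 < ‖z‖ := norm_pos_iff.2 (ne_zero_of_im_pos hz)
    have hzn := norm_le_abs_add_one hz.le hz1.le hzT
    have hre := Complex.abs_re_le_norm z
    rw [norm_div]
    constructor
    · calc (|T| + 1)⁻¹ * |z.re| ≤ 1 := by
            rw [inv_mul_le_iff₀ (by positivity), mul_one]
            exact hre.trans hzn
        _ ≤ ‖z + Complex.I‖ / ‖z‖ := (one_le_div₀ hz0).2 (norm_le_norm_add_I hz.le)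
    · calc |z.re| * (‖z + Complex.I‖ / ‖z‖) ≤ ‖z‖ * (‖z + Complex.I‖ / ‖z‖) := by gcongr
        _ = ‖z + Complex.I‖ := mul_div_cancel₀ _ hz0.ne'
        _ ≤ ‖z‖ + 1 := (norm_add_le _ _).trans_eq (by rw [Complex.norm_I])
        _ ≤ |T| + 1 + 1 := by gcongr

lemma exp_integral_log_norm_add_I_div (hz : 0 < z.im) :
    Integrable (fun s : ℝ =>
      ((2 * Real.log ‖((s : ℂ) + Complex.I) / s‖ : ℝ) : ℂ) / ((s : ℂ) - z)) ∧
      (z + Complex.I) / z = Complex.exp (1 / (2 * Real.pi * Complex.I) *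
        ∫ s : ℝ, ((2 * Real.log ‖((s : ℂ) + Complex.I) / s‖ : ℝ) : ℂ) / ((s : ℂ) - z)) := by
  refine isTameOuter_add_I_div.eq_exp_integral
    (L := fun s => Real.log ‖((s : ℂ) + Complex.I) / s‖) (fun s hs => ?_) hz
  have hs0 : (s : ℂ) ≠ 0 := Complex.ofReal_ne_zero.2 hs
  have hquot := (((tendsto_add_mul_I s).add_const Complex.I).div (tendsto_add_mul_I s) hs0).norm
  exact hquot.log (norm_ne_zero_iff.2 (div_ne_zero (add_I_ne_zero (Complex.ofReal_im s).ge) hs0))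

lemma norm_ofReal_add_I_div_sq (s : ℝ) :
    ‖((s : ℂ) + Complex.I) / s‖ ^ 2 = (s ^ 2 + 1) / s ^ 2 := by
  rw [norm_div, div_pow, Complex.sq_norm, Complex.sq_norm, Complex.normSq_apply,
    Complex.normSq_ofReal, Complex.add_re, Complex.add_im, Complex.ofReal_re, Complex.ofReal_im,
    Complex.I_re, Complex.I_im]
  ring

lemma log_div_mul_im_iFunction (hq : InL11 q) {s : ℝ} (hs : s ≠ 0) :
    Real.log ((s ^ 2 + 1) / (s * (iFunction q s).im)) =
      2 * Real.log ‖jostFunction q s‖ + 2 * Real.log ‖((s : ℂ) + Complex.I) / s‖ := by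
  have hf : ‖jostFunction q s‖ ≠ 0 := norm_ne_zero_iff.2 (jostFunction_ofReal_ne_zero hq hs)
  have hprod : (s ^ 2 + 1) / (s * (iFunction q s).im) =
      ‖jostFunction q s‖ ^ 2 * ‖((s : ℂ) + Complex.I) / s‖ ^ 2 := by
    rw [im_iFunction_ofReal hq, norm_ofReal_add_I_div_sq]
    field_simp
  have hne : ‖((s : ℂ) + Complex.I) / s‖ ^ 2 ≠ 0 := by
    rw [norm_ofReal_add_I_div_sq]
    positivity
  rw [hprod, Real.log_mul (pow_ne_zero 2 hf) hne, Real.log_pow, Real.log_pow, Nat.cast_ofNat]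

lemma integrand₁_ae_eq (hq : InL11 q) (z : ℂ) :
    integrand₁ (iFunction q) z =ᵐ[volume] fun s : ℝ =>
      ((2 * Real.log ‖jostFunction q s‖ : ℝ) : ℂ) / ((s : ℂ) - z) +
        ((2 * Real.log ‖((s : ℂ) + Complex.I) / s‖ : ℝ) : ℂ) / ((s : ℂ) - z) := by
  filter_upwards [ae_ne 0] with s hs
  rw [integrand₁, log_div_mul_im_iFunction hq hs, ← add_div, Complex.ofReal_add]

theorem jostFunction_eq_exp_integrand₁ (hq : InL11 q) (hz : 0 < z.im) :
    Integrable (integrand₁ (iFunction q) z) ∧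
      jostFunction q z = Complex.exp (1 / (2 * Real.pi * Complex.I) *
        ∫ s : ℝ, integrand₁ (iFunction q) z s) * w₁ (iFunction q) z := by
  obtain ⟨hint, hexp⟩ := jostFunction_eq_exp_integral_log_norm hq hz
  obtain ⟨hintI, hexpI⟩ := exp_integral_log_norm_add_I_div hz
  refine ⟨(integrable_congr (integrand₁_ae_eq hq z)).2 (hint.add hintI), ?_⟩
  have hz0 := ne_zero_of_im_pos hz
  have hzI := add_I_ne_zero hz.le
  rw [integral_congr_ae (integrand₁_ae_eq hq z), integral_add hint hintI, mul_add,
    Complex.exp_add, ← hexpI, w₁, hexp]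
  field_simp

end JostFormula

section PhragmenLindelof

open Asymptotics

variable {D : ℂ → ℂ} {K : ℝ}

lemma eq_zero_of_norm_le_of_ofReal_eq_zero (hc : ContinuousOn D {z | 0 ≤ z.im})
    (hd : DifferentiableOn ℂ D upperHalf) (hK : ∀ z : ℂ, 0 ≤ z.im → ‖D z‖ ≤ K)
    (h0 : ∀ s : ℝ, D s = 0) {z : ℂ} (hz : 0 ≤ z.im) : D z = 0 := by
  set F : ℂ → ℂ := fun ζ => D (Complex.I * ζ)
  have him : ∀ ζ : ℂ, (Complex.I * ζ).im = ζ.re := fun ζ => by simp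
  have hF : DiffContOnCl ℂ F {ζ | 0 < ζ.re} := by
    refine ⟨hd.comp (by fun_prop) fun ζ hζ => (lt_of_lt_of_eq hζ (him ζ).symm :), ?_⟩
    rw [Complex.closure_setOfPred_lt_re]
    exact hc.comp (by fun_prop) fun ζ hζ => (le_of_le_of_eq hζ (him ζ).symm :)
  have hFK : ∀ ζ : ℂ, 0 ≤ ζ.re → ‖F ζ‖ ≤ K := fun ζ hζ => hK _ (by rwa [him])
  have hFz : ‖F (-Complex.I * z)‖ ≤ 0 := by
    refine PhragmenLindelof.right_half_plane_of_bounded_on_real hF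
      ⟨1, one_lt_two, 0, .of_bound K ?_⟩ ⟨K, eventually_map.2 ?_⟩ (fun x => ?_) (by simpa using hz)
    · refine eventually_inf_principal.2 (.of_forall fun ζ hζ => ?_)
      simpa using hFK ζ (le_of_lt hζ)
    · filter_upwards [eventually_ge_atTop 0] with x hx using hFK x (by simpa using hx)
    · have hx : Complex.I * ((x : ℂ) * Complex.I) = ((-x : ℝ) : ℂ) := by
        push_cast
        linear_combination (x : ℂ) * Complex.I_sq
      exact (congrArg norm ((congrArg D hx).trans (h0 _))).trans_le norm_zero.le
  have hz' : Complex.I * (-Complex.I * z) = z := by linear_combination (-z) * Complex.I_sq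
  exact (congrArg D hz').symm.trans (norm_le_zero_iff.1 hFz)

lemma eq_zero_of_norm_le_mul_of_ofReal_eq_zero (hc : ContinuousOn D {z | 0 ≤ z.im})
    (hd : DifferentiableOn ℂ D upperHalf) (hK : ∀ z : ℂ, 0 ≤ z.im → ‖D z‖ ≤ K * (1 + ‖z‖))
    (h0 : ∀ s : ℝ, D s = 0) {z : ℂ} (hz : 0 ≤ z.im) : D z = 0 := by
  have hK0 : 0 ≤ K := by simpa using (norm_nonneg _).trans (hK 0 (by simp))
  have hquot : D z / (z + Complex.I) = 0 := by
    refine eq_zero_of_norm_le_of_ofReal_eq_zero (D := fun z => D z / (z + Complex.I)) (K := K * 2)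
      (hc.div (by fun_prop) fun z => add_I_ne_zero)
      (hd.div (by fun_prop) fun z hz => add_I_ne_zero (le_of_lt hz)) (fun z hz => ?_)
      (fun s => by rw [h0, zero_div]) hz
    have h1 := one_le_norm_add_I hz
    rw [norm_div, div_le_iff₀ (by linarith), mul_assoc]
    refine (hK z hz).trans (mul_le_mul_of_nonneg_left ?_ hK0)
    linarith [norm_le_norm_add_I hz]
  exact (div_eq_zero_iff.1 hquot).resolve_right (add_I_ne_zero hz)

lemma ofReal_eq_zero_of_ne (hc : ContinuousOn D {z | 0 ≤ z.im})
    (h0 : ∀ s : ℝ, s ≠ 0 → D s = 0) (s : ℝ) : D s = 0 :=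
  congrFun ((continuous_comp_ofReal hc).ext_on (dense_compl_singleton 0)
    (continuous_const (y := (0 : ℂ))) h0) s

end PhragmenLindelof

section Inverse

variable {q q' : ℝ → ℝ}

lemma iFunction_ofReal_eq (hq : InL11 q) (hq' : InL11 q')
    (h : ∀ k : ℝ, 0 < k → iFunction q' k = iFunction q k) {s : ℝ} (hs : s ≠ 0) :
    iFunction q' s = iFunction q s := by
  rcases hs.lt_or_gt with hneg | hpos
  · have hconj := h (-s) (neg_pos.2 hneg)
    rw [iFunction_neg_ofReal hq, iFunction_neg_ofReal hq'] at hconj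
    exact (starRingEnd ℂ).injective hconj
  · exact h s hpos

lemma norm_jostDeriv_mul_jostFunction_le (hq : InL11 q) (hq' : InL11 q') {k : ℂ}
    (hk : 0 ≤ k.im) : ‖jostDeriv q k * jostFunction q' k‖ ≤
      (1 + tail q 0) * jostBound q * jostBound q' * (1 + ‖k‖) := by
  have ht := tail_nonneg q 0
  have := (jostBound_pos q).le
  calc ‖jostDeriv q k * jostFunction q' k‖
      ≤ ((‖k‖ + tail q 0) * jostBound q) * jostBound q' := by
        rw [norm_mul]
        gcongr
        exacts [norm_jostDeriv_le hq hk, norm_jostFunction_le hq' hk]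
    _ ≤ ((1 + tail q 0) * (1 + ‖k‖) * jostBound q) * jostBound q' := by
        have := (jostBound_pos q').le
        gcongr
        nlinarith [norm_nonneg k]
    _ = _ := by ring

theorem jostDeriv_mul_jostFunction_eq (hq : InL11 q) (hq' : InL11 q')
    (h : ∀ k : ℝ, 0 < k → iFunction q' k = iFunction q k) {z : ℂ} (hz : 0 ≤ z.im) :
    jostDeriv q' z * jostFunction q z = jostDeriv q z * jostFunction q' z := by
  set D : ℂ → ℂ := fun z => jostDeriv q' z * jostFunction q z - jostDeriv q z * jostFunction q' z
  have hc : ContinuousOn D {z | 0 ≤ z.im} :=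
    ((continuousOn_jostDeriv hq').mul (continuousOn_jostFunction hq)).sub
      ((continuousOn_jostDeriv hq).mul (continuousOn_jostFunction hq'))
  have hd : DifferentiableOn ℂ D upperHalf :=
    ((differentiableOn_jostDeriv hq').mul (differentiableOn_jostFunction hq)).sub
      ((differentiableOn_jostDeriv hq).mul (differentiableOn_jostFunction hq'))
  have h0 : ∀ s : ℝ, s ≠ 0 → D s = 0 := fun s hs => by
    have hI := iFunction_ofReal_eq hq hq' h hs
    rw [iFunction_eq_div, iFunction_eq_div, div_eq_div_iff (jostFunction_ofReal_ne_zero hq' hs)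
      (jostFunction_ofReal_ne_zero hq hs)] at hI
    exact sub_eq_zero.2 hI
  have hK : ∀ z : ℂ, 0 ≤ z.im → ‖D z‖ ≤ ((1 + tail q' 0) * jostBound q' * jostBound q +
      (1 + tail q 0) * jostBound q * jostBound q') * (1 + ‖z‖) := fun z hz =>
    (norm_sub_le _ _).trans ((add_le_add (norm_jostDeriv_mul_jostFunction_le hq' hq hz)
      (norm_jostDeriv_mul_jostFunction_le hq hq' hz)).trans_eq (add_mul _ _ _).symm)
  exact sub_eq_zero.1
    (eq_zero_of_norm_le_mul_of_ofReal_eq_zero hc hd hK (ofReal_eq_zero_of_ne hc h0) hz)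

lemma boundStates_subset (hq : InL11 q) (hq' : InL11 q')
    (h : ∀ k : ℝ, 0 < k → iFunction q' k = iFunction q k) : boundStates q' ⊆ boundStates q := by
  intro κ hκ
  obtain ⟨hpos, h0⟩ := (mem_boundStates_iff hq').1 hκ
  have him : 0 ≤ (Complex.I * (κ : ℂ)).im := by simpa using hpos.le
  have hmul := jostDeriv_mul_jostFunction_eq hq hq' h him
  rw [h0, mul_zero] at hmul
  exact (mem_boundStates_iff hq).2 ⟨hpos, (mul_eq_zero.1 hmul).resolve_left
    (jostDeriv_ne_zero_of_jostFunction_eq_zero hq' him h0)⟩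

theorem boundStates_eq (hq : InL11 q) (hq' : InL11 q')
    (h : ∀ k : ℝ, 0 < k → iFunction q' k = iFunction q k) : boundStates q' = boundStates q :=
  (boundStates_subset hq hq' h).antisymm
    (boundStates_subset hq' hq fun k hk => (h k hk).symm)

theorem eqOn_jostFunction (hq : InL11 q) (hq' : InL11 q')
    (h : ∀ k : ℝ, 0 < k → iFunction q' k = iFunction q k) :
    EqOn (jostFunction q') (jostFunction q) upperHalf := by
  intro z hz
  have hint : integrand (iFunction q') z =ᵐ[volume] integrand (iFunction q) z := by
    filter_upwards [ae_ne 0] with s hs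
    rw [integrand, integrand, iFunction_ofReal_eq hq hq' h hs]
  have hw : w (iFunction q') z = w (iFunction q) z := by
    rw [w, w, upperPoles_iFunction hq, upperPoles_iFunction hq', boundStates_eq hq hq' h]
  rw [(jostFunction_eq_exp_integrand hq' hz).2, (jostFunction_eq_exp_integrand hq hz).2,
    integral_congr_ae hint, hw]

end Inverse

end Schrodinger

theorem mainTheorem3 (q : ℝ → ℝ) (hq : Schrodinger.InL11 q) :
    -- the Jost solution exists and is unique, so `f` and `I` are well defined
    (∀ k : ℂ, 0 ≤ k.im → ∃ u v : ℝ → ℂ, Schrodinger.IsJostSolution q k u v ∧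
      ∀ u' v' : ℝ → ℂ, Schrodinger.IsJostSolution q k u' v' →
        Set.EqOn u' u (Set.Ici 0) ∧ Set.EqOn v' v (Set.Ici 0)) ∧
    -- `I` is meromorphic in the upper half-plane; its poles there are the finitely many `i k_j`,
    -- and they are simple
    MeromorphicOn (Schrodinger.iFunction q) Schrodinger.upperHalf ∧
    (Schrodinger.boundStates q).Finite ∧
    Schrodinger.upperPoles (Schrodinger.iFunction q) =
      (fun κ : ℝ => Complex.I * (κ : ℂ)) '' Schrodinger.boundStates q ∧
    (∀ p ∈ Schrodinger.upperPoles (Schrodinger.iFunction q),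
      meromorphicOrderAt (Schrodinger.iFunction q) p = -1) ∧
    -- the logarithm is taken of a positive number
    (∀ s : ℝ, s ≠ 0 → 0 < s / (Schrodinger.iFunction q s).im) ∧
    -- the formula for `f` in terms of `I`, whether or not `f(0) = 0`
    (∀ z : ℂ, 0 < z.im →
      MeasureTheory.Integrable (Schrodinger.integrand (Schrodinger.iFunction q) z) ∧
      Schrodinger.jostFunction q z =
        Complex.exp (1 / (2 * Real.pi * Complex.I) *
          ∫ s : ℝ, Schrodinger.integrand (Schrodinger.iFunction q) z s) *
        Schrodinger.w (Schrodinger.iFunction q) z) ∧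
    -- the second formula, when `f(0) = 0`
    (Schrodinger.jostFunction q 0 = 0 → ∀ z : ℂ, 0 < z.im →
      MeasureTheory.Integrable (Schrodinger.integrand₁ (Schrodinger.iFunction q) z) ∧
      Schrodinger.jostFunction q z =
        Complex.exp (1 / (2 * Real.pi * Complex.I) *
          ∫ s : ℝ, Schrodinger.integrand₁ (Schrodinger.iFunction q) z s) *
        Schrodinger.w₁ (Schrodinger.iFunction q) z) ∧
    -- the values `I(k)`, `k > 0`, determine the `k_j`, their number, and `f`
    (∀ q' : ℝ → ℝ, Schrodinger.InL11 q' →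
      (∀ k : ℝ, 0 < k → Schrodinger.iFunction q' k = Schrodinger.iFunction q k) →
      Schrodinger.boundStates q' = Schrodinger.boundStates q ∧
      Set.EqOn (Schrodinger.jostFunction q') (Schrodinger.jostFunction q)
        Schrodinger.upperHalf) := by
  refine ⟨fun k hk => ⟨_, _, Schrodinger.isJostSolution_jostSol hq hk,
      fun u v h => h.eqOn_jostSol hq hk⟩,
    fun p hp => Schrodinger.meromorphicAt_iFunction hq hp, Schrodinger.finite_boundStates hq,
    Schrodinger.upperPoles_iFunction hq, fun p hp => ?_, fun s hs => ?_,
    fun z hz => Schrodinger.jostFunction_eq_exp_integrand hq hz,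
    fun _ z hz => Schrodinger.jostFunction_eq_exp_integrand₁ hq hz,
    fun q' hq' h => ⟨Schrodinger.boundStates_eq hq hq' h,
      Schrodinger.eqOn_jostFunction hq hq' h⟩⟩
  · obtain ⟨him, h0⟩ := (Schrodinger.mem_upperPoles_iff hq).1 hp
    exact Schrodinger.meromorphicOrderAt_iFunction_of_eq_zero hq him h0
  · rw [Schrodinger.div_im_iFunction hq hs]
    have := norm_pos_iff.2 (Schrodinger.jostFunction_ofReal_ne_zero hq hs)
    positivity
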